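/- Let $\mathfrak g$ be a compact simple real Lie algebra with Killing form $\langle\cdot,\cdot\rangle$, let $\omega_{\mathfrak g}(X,Y,Z)=\langle X,[Y,Z]\rangle$, and let $M^n$ be a smooth manifold with a smooth 3-form $\omega^3$ of type $\omega_{\mathfrak g}$ and associated smooth Riemannian metric $K_{\mathfrak g}$; that is, at every $x\in M$ some linear isomorphism $I_x:T_xM\to\mathfrak g$ (an adapted frame) carries $\omega_{\mathfrak g}$ to $\omega^3(x)$ and $-\langle\cdot,\cdot\rangle$ to $K_{\mathfrak g}(x)$. The bracket of $\mathfrak g$ induces through $I_x$ a cross product on $T_xM$, which does not depend on the adapted frame. An (immersed) submanifold $N$ is strongly associative (resp. strongly coassociative) if every tangent space $W=T_xN$ (resp. normal space $W=T_x^\perp N$) is closed under the cross product and $\omega^3|_W$ is multi-symplectic, i.e. $v\mapsto v\rfloor\omega^3|_W$ is injective on $W$. Its Lie type at $x$ is the subalgebra $\mathfrak h=I_x(W)\subset\mathfrak g$, which is determined up to automorphisms of $\mathfrak g$. Let $H$ be the mean curvature vector of $N$ (the trace of the second fundamental form with respect to the Levi-Civita connection of $K_{\mathfrak g}$), $H^*=K_{\mathfrak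 g}(H,\cdot)$, and for an orthonormal basis $e_1,\dots,e_k$ of $T_xN$ belonging to the orientation of $T_xN$ put $\vec{T_xN}=e_1\wedge\dots\wedge e_k$ and $(\vec{T_xN}\rfloor\beta)(X)=\beta(e_1,\dots,e_k,X)$ for a $(k+1)$-form $\beta$. **Proposition 6.4.** 1. There is a function $c>0$ on the Lie subalgebras of $\mathfrak g$, invariant under the automorphisms of $\mathfrak g$, such that for all such $M^n,\omega^3,K_{\mathfrak g}$, every strongly associative 3-submanifold $N^3\subset M^n$ and every $x\in N^3$, $$H(x)^*=c(\mathfrak h)\;\vec{T_xN^3}\rfloor d\omega^3(x),$$ where $\mathfrak h$ is the Lie type of $N^3$ at $x$ and $T_xN^3$ is oriented so that $\omega^3(\vec{T_xN^3})>0$. The number $c(\mathfrak h)$ is the same at all points of a connected component of $N^3$. 2. There is a function $c>0$ on the Lie subalgebras of $\mathfrak g$, invariant under the automorphisms of $\mathfrak g$, such that for all such $M^n,\omega^3,K_{\mathfrak g}$, every strongly coassociative submanifold $N^{n-3}\subset M^n$ of codimension 3, every $x\in N^{n-3}$ and every orientation of $M$ near $x$, $$H(x)^*=c(\mathfrak h)\;\vec{T_xN^{n-3}}\rfloor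 d(*\omega^3)(x),$$ where $*$ is the Hodge star for that orientation, $\mathfrak h$ is the Lie type of $N^{n-3}$ at $x$ and $T_xN^{n-3}$ is oriented so that $(-1)^n\,(*\omega^3)(\vec{T_xN^{n-3}})>0$. The number $c(\mathfrak h)$ is the same at all points of a connected component of $N^{n-3}$. -/

import Mathlib

open scoped Manifold ContDiff
open Module

noncomputable section

namespace CartanGeometry

universe u v w

/-! ### Linear algebra -/

section Linear

variable {V : Type*} [AddCommGroup V] [Module ℝ V]

/-- A `(k+1)`-form is multi-symplectic if `v ↦ v ⌟ ω₃` is injective. -/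
def IsMultisymplectic {k : ℕ} (ω₃ : V [⋀^Fin (k + 1)]→ₗ[ℝ] ℝ) : Prop :=
  Function.Injective fun v : V => ω₃.curryLeft v

/-- The contraction `(e₁ ∧ ⋯ ∧ e_k) ⌟ β` of a `(k+1)`-form with a decomposable `k`-vector:
the covector `X ↦ β(e₁, …, e_k, X)`. -/
def contract [TopologicalSpace V] {k : ℕ} (e : Fin k → V) (β : V [⋀^Fin (k + 1)]→L[ℝ] ℝ) :
    V →L[ℝ] ℝ :=
  β.toContinuousMultilinearMap.toContinuousLinearMap
    (Fin.snoc (α := fun _ => V) e 0) (Fin.last k)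

theorem contract_apply [TopologicalSpace V] {k : ℕ} (e : Fin k → V)
    (β : V [⋀^Fin (k + 1)]→L[ℝ] ℝ) (X : V) :
    contract e β X = β (Fin.snoc (α := fun _ => V) e X) := by
  have h : Function.update (Fin.snoc (α := fun _ => V) e 0) (Fin.last k) X
      = Fin.snoc (α := fun _ => V) e X := Fin.update_snoc_last ..
  rw [← h]; rfl

theorem exists_orthonormal_basis [FiniteDimensional ℝ V] (B : V →ₗ[ℝ] V →ₗ[ℝ] ℝ)
    (symm : ∀ u v, B u v = B v u) (pos : ∀ u, u ≠ 0 → 0 < B u u) {n : ℕ}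
    (hn : finrank ℝ V = n) :
    ∃ b : Basis (Fin n) ℝ V, ∀ i j, B (b i) (b j) = if i = j then 1 else 0 := by
  subst hn
  let C : InnerProductSpace.Core ℝ V :=
    { inner := fun u v => B u v
      conj_inner_symm := fun u v => by simpa using symm v u
      re_inner_nonneg := fun u => by
        rcases eq_or_ne u 0 with rfl | h
        · simp
        · simpa using (pos u h).le
      add_left := fun u v w => by simp
      smul_left := fun u v r => by simp
      definite := fun u h => by
        by_contra hu
        exact (pos u hu).ne' h }
  let _ : NormedAddCommGroup V := C.toNormedAddCommGroup
  let _ : InnerProductSpace ℝ V := InnerProductSpace.ofCore C.toCore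
  refine ⟨(stdOrthonormalBasis ℝ V).toBasis, fun i j => ?_⟩
  have := (orthonormal_iff_ite.1 (stdOrthonormalBasis ℝ V).orthonormal) i j
  rw [OrthonormalBasis.coe_toBasis]
  exact this

theorem exists_riesz [FiniteDimensional ℝ V] (B : V →ₗ[ℝ] V →ₗ[ℝ] ℝ)
    (pos : ∀ u, u ≠ 0 → 0 < B u u) (α : V →ₗ[ℝ] ℝ) : ∃ v, ∀ w, B v w = α w := by
  have hinj : Function.Injective B := by
    rw [injective_iff_map_eq_zero]
    intro u hu
    by_contra h
    have := pos u h
    simp [hu] at this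
  have hsurj : Function.Surjective B :=
    (LinearMap.injective_iff_surjective_of_finrank_eq_finrank
      (Subspace.dual_finrank_eq (K := ℝ) (V := V)).symm).1 hinj
  obtain ⟨v, hv⟩ := hsurj α
  exact ⟨v, fun w => by rw [hv]⟩

theorem exists_normal_part [FiniteDimensional ℝ V] (B : V →ₗ[ℝ] V →ₗ[ℝ] ℝ)
    (pos : ∀ u, u ≠ 0 → 0 < B u u) (W : Submodule ℝ V) (v : V) :
    ∃ v', v - v' ∈ W ∧ ∀ u ∈ W, B v' u = 0 := by
  obtain ⟨t, ht⟩ := exists_riesz (V := W) (B.domRestrict₁₂ W W)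
    (fun u hu => pos u (by simpa using hu)) ((B v).domRestrict W)
  refine ⟨v - t, by simp, fun u hu => ?_⟩
  have h : B t u = B v u := ht ⟨u, hu⟩
  simp [h]

end Linear

/-! ### Differential forms on a manifold -/

section Forms

variable {n : ℕ} {M : Type u} [TopologicalSpace M] [ChartedSpace (EuclideanSpace ℝ (Fin n)) M]

/-- (Not necessarily smooth) differential `k`-forms on the `n`-manifold `M`. -/
abbrev DiffForm (n : ℕ) (M : Type u) [TopologicalSpace M]
    [ChartedSpace (EuclideanSpace ℝ (Fin n)) M] (k : ℕ) : Type u :=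
  ∀ x : M, TangentSpace (𝓡 n) x [⋀^Fin k]→L[ℝ] ℝ

/-- The expression of a differential form in the preferred chart at `x₀`, i.e. its pull-back under
the inverse of the chart. -/
def DiffForm.inChart {k : ℕ} (α : DiffForm n M k) (x₀ : M) (y : EuclideanSpace ℝ (Fin n)) :
    EuclideanSpace ℝ (Fin n) [⋀^Fin k]→L[ℝ] ℝ :=
  (α ((extChartAt (𝓡 n) x₀).symm y)).compContinuousLinearMap
    (mfderiv 𝓘(ℝ, EuclideanSpace ℝ (Fin n)) (𝓡 n) (extChartAt (𝓡 n) x₀).symm y)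

/-- A differential form is smooth on the open set `U` if its expressions in all charts are. -/
def DiffForm.IsSmoothOn {k : ℕ} (α : DiffForm n M k) (U : Set M) : Prop :=
  ∀ x₀ : M, ContDiffOn ℝ ∞ (α.inChart x₀)
    ((extChartAt (𝓡 n) x₀).target ∩ (extChartAt (𝓡 n) x₀).symm ⁻¹' U)

/-- The exterior derivative, computed at `x` in the preferred chart at `x`. -/
def DiffForm.d {k : ℕ} (α : DiffForm n M k) : DiffForm n M (k + 1) := fun x =>
  (extDeriv (α.inChart x) (extChartAt (𝓡 n) x x)).compContinuousLinearMap
    (mfderiv (𝓡 n) 𝓘(ℝ, EuclideanSpace ℝ (Fin n)) (extChartAt (𝓡 n) x) x)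

end Forms

/-! ### Riemannian metrics -/

section Metric

variable {n : ℕ} {M : Type u} [TopologicalSpace M] [ChartedSpace (EuclideanSpace ℝ (Fin n)) M]
  [IsManifold (𝓡 n) ∞ M]

/-- Smooth Riemannian metrics on `M`. -/
abbrev Metric (n : ℕ) (M : Type u) [TopologicalSpace M]
    [ChartedSpace (EuclideanSpace ℝ (Fin n)) M] [IsManifold (𝓡 n) ∞ M] : Type u :=
  Bundle.ContMDiffRiemannianMetric (𝓡 n) ∞ (EuclideanSpace ℝ (Fin n))
    (fun x : M => TangentSpace (𝓡 n) x)

instance (x : M) : FiniteDimensional ℝ (TangentSpace (𝓡 n) x) :=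
  inferInstanceAs (FiniteDimensional ℝ (EuclideanSpace ℝ (Fin n)))

/-- The scalar product at `x` as an algebraic bilinear map. -/
def bilin (K : Metric n M) (x : M) :
    TangentSpace (𝓡 n) x →ₗ[ℝ] TangentSpace (𝓡 n) x →ₗ[ℝ] ℝ :=
  (ContinuousLinearMap.coeLM ℝ).comp (K.inner x).toLinearMap

theorem bilin_pos (K : Metric n M) (x : M) (u : TangentSpace (𝓡 n) x) (hu : u ≠ 0) :
    0 < bilin K x u u := K.pos x u hu

/-- `e` is an orthonormal family of tangent vectors at `x`. -/
def IsOrthonormal (K : Metric n M) (x : M) {k : ℕ} (e : Fin k → TangentSpace (𝓡 n) x) : Prop :=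
  ∀ i j, K.inner x (e i) (e j) = if i = j then 1 else 0

/-- A choice of an orthonormal basis of `T_x M`. -/
def orthoBasis (K : Metric n M) (x : M) : Basis (Fin n) ℝ (TangentSpace (𝓡 n) x) :=
  (exists_orthonormal_basis (bilin K x) (K.symm x) (bilin_pos K x)
    (finrank_euclideanSpace_fin (𝕜 := ℝ) (n := n))).choose

theorem orthoBasis_orthonormal (K : Metric n M) (x : M) :
    IsOrthonormal K x (orthoBasis K x) :=
  (exists_orthonormal_basis (bilin K x) (K.symm x) (bilin_pos K x)
    (finrank_euclideanSpace_fin (𝕜 := ℝ) (n := n))).choose_spec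

/-- The vector dual to a covector. -/
def sharp (K : Metric n M) (x : M) (α : TangentSpace (𝓡 n) x →ₗ[ℝ] ℝ) : TangentSpace (𝓡 n) x :=
  (exists_riesz (bilin K x) (bilin_pos K x) α).choose

theorem inner_sharp (K : Metric n M) (x : M) (α : TangentSpace (𝓡 n) x →ₗ[ℝ] ℝ)
    (w : TangentSpace (𝓡 n) x) : K.inner x (sharp K x α) w = α w :=
  (exists_riesz (bilin K x) (bilin_pos K x) α).choose_spec w

/-- The component of `v` orthogonal to the subspace `W`. -/
def normalPart (K : Metric n M) (x : M) (W : Submodule ℝ (TangentSpace (𝓡 n) x))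
    (v : TangentSpace (𝓡 n) x) : TangentSpace (𝓡 n) x :=
  (exists_normal_part (bilin K x) (bilin_pos K x) W v).choose

theorem normalPart_spec (K : Metric n M) (x : M) (W : Submodule ℝ (TangentSpace (𝓡 n) x))
    (v : TangentSpace (𝓡 n) x) :
    v - normalPart K x W v ∈ W ∧ ∀ u ∈ W, K.inner x (normalPart K x W v) u = 0 :=
  (exists_normal_part (bilin K x) (bilin_pos K x) W v).choose_spec

/-- The orthogonal complement of `W` in `T_x M`. -/
def orthogonal (K : Metric n M) (x : M) (W : Submodule ℝ (TangentSpace (𝓡 n) x)) :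
    Submodule ℝ (TangentSpace (𝓡 n) x) where
  carrier := {v | ∀ u ∈ W, K.inner x v u = 0}
  add_mem' := fun ha hb u hu => by simp [ha u hu, hb u hu]
  zero_mem' := fun u _ => by simp
  smul_mem' := fun c a ha u hu => by simp [ha u hu]

/-- `μ` is a (local) Riemannian volume form on `U`: a smooth `n`-form on `U` with values `±1` on
orthonormal bases. On an open set, this is the same as an orientation of `U`. -/
def IsVolumeFormOn (K : Metric n M) (U : Set M) (μ : DiffForm n M n) : Prop :=
  μ.IsSmoothOn U ∧ ∀ y ∈ U, ∀ b : Fin n → TangentSpace (𝓡 n) y, IsOrthonormal K y b →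
    μ y b = 1 ∨ μ y b = -1

/-- The metric in the preferred chart at `x₀`. -/
def metricInChart (K : Metric n M) (x₀ : M) (y : EuclideanSpace ℝ (Fin n)) :
    EuclideanSpace ℝ (Fin n) →L[ℝ] EuclideanSpace ℝ (Fin n) →L[ℝ] ℝ :=
  let D : EuclideanSpace ℝ (Fin n) →L[ℝ] TangentSpace (𝓡 n) ((extChartAt (𝓡 n) x₀).symm y) :=
    mfderiv 𝓘(ℝ, EuclideanSpace ℝ (Fin n)) (𝓡 n) (extChartAt (𝓡 n) x₀).symm y
  (D.precomp ℝ).comp ((K.inner ((extChartAt (𝓡 n) x₀).symm y)).comp D)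

/-- The Christoffel symbols of the first kind of the Levi-Civita connection in the preferred chart
at `x₀`, as a covector depending on `u` and `v`:
`Γ(u, v)(w) = ½ (∂_u g(v, w) + ∂_v g(u, w) - ∂_w g(u, v))`. -/
def christoffel (K : Metric n M) (x₀ : M) (y u v : EuclideanSpace ℝ (Fin n)) :
    EuclideanSpace ℝ (Fin n) →ₗ[ℝ] ℝ where
  toFun w := 2⁻¹ * (fderiv ℝ (metricInChart K x₀) y u v w + fderiv ℝ (metricInChart K x₀) y v u w
    - fderiv ℝ (metricInChart K x₀) y w u v)
  map_add' w w' := by simp; ring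
  map_smul' c w := by simp; ring

end Metric

/-- The Hodge star `*ω₃` of a 3-form on a Riemannian `(k+3)`-manifold with volume form `μ`:
`*ω₃ = ∑_{i<j<l} ω₃(b_i, b_j, b_l) (b_l ⌟ b_j ⌟ b_i ⌟ μ)` for an orthonormal basis `b`, so that
`α ∧ *ω₃ = ⟨α, ω₃⟩ μ` and `(*ω₃)(b₄, …, b_n) = ω₃(b₁, b₂, b₃)` if `b` is positively oriented. -/
def hodgeStar {k : ℕ} {M : Type u} [TopologicalSpace M]
    [ChartedSpace (EuclideanSpace ℝ (Fin (k + 3))) M] [IsManifold (𝓡 (k + 3)) ∞ M]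
    (K : Metric (k + 3) M) (μ : DiffForm (k + 3) M (k + 3)) (ω₃ : DiffForm (k + 3) M 3) :
    DiffForm (k + 3) M k := fun x =>
  let b : Fin (k + 3) → EuclideanSpace ℝ (Fin (k + 3)) := orthoBasis K x
  let ωx : EuclideanSpace ℝ (Fin (k + 3)) [⋀^Fin 3]→L[ℝ] ℝ := ω₃ x
  let μx : EuclideanSpace ℝ (Fin (k + 3)) [⋀^Fin (k + 3)]→L[ℝ] ℝ := μ x
  let star : EuclideanSpace ℝ (Fin (k + 3)) [⋀^Fin k]→L[ℝ] ℝ :=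
    (6 : ℝ)⁻¹ • ∑ i, ∑ j, ∑ l, ωx ![b i, b j, b l] •
      ((μx.curryLeft (b i)).curryLeft (b j)).curryLeft (b l)
  star

/-! ### Immersed submanifolds and their mean curvature -/

section Submanifold

variable {n : ℕ} {M : Type u} [TopologicalSpace M] [ChartedSpace (EuclideanSpace ℝ (Fin n)) M]
  {k : ℕ} {N : Type v} [TopologicalSpace N] [ChartedSpace (EuclideanSpace ℝ (Fin k)) N]

/-- `f : N → M` is a smooth immersion, i.e. `N` is an immersed submanifold of `M`. -/
def IsImmersedSubmanifold (n k : ℕ) {M : Type u} [TopologicalSpace M]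
    [ChartedSpace (EuclideanSpace ℝ (Fin n)) M] {N : Type v} [TopologicalSpace N]
    [ChartedSpace (EuclideanSpace ℝ (Fin k)) N] (f : N → M) : Prop :=
  ContMDiff (𝓡 k) (𝓡 n) ∞ f ∧ ∀ x, Function.Injective (mfderiv (𝓡 k) (𝓡 n) f x)

/-- The tangent space of the submanifold, as a subspace of `T_{f x} M`. -/
def tangent (n k : ℕ) {M : Type u} [TopologicalSpace M]
    [ChartedSpace (EuclideanSpace ℝ (Fin n)) M] {N : Type v} [TopologicalSpace N]
    [ChartedSpace (EuclideanSpace ℝ (Fin k)) N] (f : N → M) (x : N) :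
    Submodule ℝ (TangentSpace (𝓡 n) (f x)) :=
  LinearMap.range (mfderiv (𝓡 k) (𝓡 n) f x).toLinearMap

variable [IsManifold (𝓡 n) ∞ M]

/-- The normal space of the submanifold. -/
def normal (k : ℕ) {N : Type v} [TopologicalSpace N] [ChartedSpace (EuclideanSpace ℝ (Fin k)) N]
    (K : Metric n M) (f : N → M) (x : N) : Submodule ℝ (TangentSpace (𝓡 n) (f x)) :=
  orthogonal K (f x) (tangent n k f x)

/-- The second fundamental form of the submanifold at `x`,
`II(u, v) = (∇_u df(v))^⊥ = (D²F(u, v) + Γ(DF u, DF v))^⊥`,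
where `F` is the expression of `f` in the preferred charts and `u`, `v` are vectors in the preferred
chart at `x`. -/
def secondFundamentalForm (K : Metric n M) (f : N → M) (x : N) (u v : EuclideanSpace ℝ (Fin k)) :
    TangentSpace (𝓡 n) (f x) :=
  let F : EuclideanSpace ℝ (Fin k) → EuclideanSpace ℝ (Fin n) :=
    writtenInExtChartAt (𝓡 k) (𝓡 n) x f
  let p := extChartAt (𝓡 k) x x
  let q := extChartAt (𝓡 n) (f x) (f x)
  -- The differential of the chart of `M` and its inverse.
  let Φ : TangentSpace (𝓡 n) (f x) →L[ℝ] EuclideanSpace ℝ (Fin n) :=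
    mfderiv (𝓡 n) 𝓘(ℝ, EuclideanSpace ℝ (Fin n)) (extChartAt (𝓡 n) (f x)) (f x)
  let Ψ : EuclideanSpace ℝ (Fin n) →L[ℝ] TangentSpace (𝓡 n) (f x) :=
    mfderiv 𝓘(ℝ, EuclideanSpace ℝ (Fin n)) (𝓡 n) (extChartAt (𝓡 n) (f x)).symm q
  normalPart K (f x) (tangent n k f x)
    (Ψ (fderiv ℝ (fderiv ℝ F) p u v) +
      sharp K (f x) ((christoffel K (f x) q (fderiv ℝ F p u) (fderiv ℝ F p v)).comp Φ.toLinearMap))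

/-- The first fundamental form of the submanifold in the preferred chart at `x`. -/
def firstFundamentalForm (K : Metric n M) (f : N → M) (x : N) : Matrix (Fin k) (Fin k) ℝ :=
  let D : EuclideanSpace ℝ (Fin k) →L[ℝ] TangentSpace (𝓡 n) (f x) :=
    (mfderiv (𝓡 k) (𝓡 n) f x).comp
      (mfderiv 𝓘(ℝ, EuclideanSpace ℝ (Fin k)) (𝓡 k) (extChartAt (𝓡 k) x).symm
        (extChartAt (𝓡 k) x x))
  Matrix.of fun i j =>
    K.inner (f x) (D (EuclideanSpace.single i 1)) (D (EuclideanSpace.single j 1))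

/-- The mean curvature vector: the trace `∑ g^{ij} II_{ij}` of the second fundamental form. -/
def meanCurvature (k : ℕ) {N : Type v} [TopologicalSpace N]
    [ChartedSpace (EuclideanSpace ℝ (Fin k)) N] (K : Metric n M) (f : N → M) (x : N) :
    TangentSpace (𝓡 n) (f x) :=
  ∑ i : Fin k, ∑ j : Fin k, (firstFundamentalForm (k := k) K f x)⁻¹ i j •
    secondFundamentalForm K f x (EuclideanSpace.single i 1) (EuclideanSpace.single j 1)

end Submanifold

/-! ### Cartan 3-forms -/

section Cartan

variable (𝔤 : Type w) [LieRing 𝔤] [LieAlgebra ℝ 𝔤]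

/-- A compact simple Lie algebra: simple, with negative definite Killing form. -/
def IsCompactSimple : Prop :=
  LieAlgebra.IsSimple ℝ 𝔤 ∧ ∀ X : 𝔤, X ≠ 0 → killingForm ℝ 𝔤 X X < 0

variable {𝔤}

/-- The Cartan 3-form `ω_𝔤(X, Y, Z) = ⟨X, [Y, Z]⟩`, with the Killing form `⟨ , ⟩`. -/
def cartanForm (X Y Z : 𝔤) : ℝ := killingForm ℝ 𝔤 X ⁅Y, Z⁆

variable {n : ℕ} {M : Type u} [TopologicalSpace M] [ChartedSpace (EuclideanSpace ℝ (Fin n)) M]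
  [IsManifold (𝓡 n) ∞ M]

/-- A linear isomorphism `T_x M ≅ 𝔤` which carries `ω_𝔤` to `ω₃ x` and the negative of the
Killing form to the metric at `x`. -/
def IsAdaptedFrame (ω₃ : DiffForm n M 3) (K : Metric n M) (x : M)
    (I : TangentSpace (𝓡 n) x ≃ₗ[ℝ] 𝔤) : Prop :=
  (∀ u v w, ω₃ x ![u, v, w] = cartanForm (I u) (I v) (I w)) ∧
    ∀ u v, K.inner x u v = -killingForm ℝ 𝔤 (I u) (I v)

variable (𝔤) in
/-- `ω₃` is a 3-form of type `ω_𝔤`, and `K` is an associated Riemannian metric: at every point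
some linear isomorphism with `𝔤` carries `ω_𝔤` to `ω₃` and minus the Killing form to `K`. -/
def IsCartanPair (ω₃ : DiffForm n M 3) (K : Metric n M) : Prop :=
  ∀ x, ∃ I : TangentSpace (𝓡 n) x ≃ₗ[ℝ] 𝔤, IsAdaptedFrame ω₃ K x I

/-- The cross product on `T_x M` that corresponds to the Lie bracket of `𝔤`. -/
def bracket {ω₃ : DiffForm n M 3} {K : Metric n M} (h : IsCartanPair 𝔤 ω₃ K) (x : M)
    (u v : TangentSpace (𝓡 n) x) : TangentSpace (𝓡 n) x :=
  (h x).choose.symm ⁅(h x).choose u, (h x).choose v⁆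

/-- The cross product does not depend on the adapted frame. -/
theorem bracket_eq {ω₃ : DiffForm n M 3} {K : Metric n M} (h : IsCartanPair 𝔤 ω₃ K) (x : M)
    (I : TangentSpace (𝓡 n) x ≃ₗ[ℝ] 𝔤) (hI : IsAdaptedFrame ω₃ K x I)
    (u v : TangentSpace (𝓡 n) x) : bracket h x u v = I.symm ⁅I u, I v⁆ := by
  have key : ∀ J : TangentSpace (𝓡 n) x ≃ₗ[ℝ] 𝔤, IsAdaptedFrame ω₃ K x J → ∀ w,
      K.inner x w (J.symm ⁅J u, J v⁆) = -ω₃ x ![w, u, v] := by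
    intro J hJ w
    rw [hJ.1, hJ.2, cartanForm, LinearEquiv.apply_symm_apply]
  by_contra hne
  have hpos := K.pos x _ (sub_ne_zero.2 hne)
  rw [map_sub, bracket, key _ (h x).choose_spec, key I hI, sub_self] at hpos
  exact lt_irrefl _ hpos

/-- The subspace `W` of `T_x M` is closed under the cross product, and the restriction of `ω₃` to it
is multi-symplectic. -/
def IsStrongAt {ω₃ : DiffForm n M 3} {K : Metric n M} (h : IsCartanPair 𝔤 ω₃ K) (x : M)
    (W : Submodule ℝ (TangentSpace (𝓡 n) x)) : Prop :=
  (∀ u ∈ W, ∀ v ∈ W, bracket h x u v ∈ W) ∧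
    IsMultisymplectic ((ω₃ x).toAlternatingMap.compLinearMap W.subtype)

/-- The submanifold is strongly associative: all its tangent spaces are closed under the cross
product, with multi-symplectic restriction of `ω₃`. -/
def IsStronglyAssociative (k : ℕ) {N : Type v} [TopologicalSpace N]
    [ChartedSpace (EuclideanSpace ℝ (Fin k)) N] {ω₃ : DiffForm n M 3} {K : Metric n M}
    (h : IsCartanPair 𝔤 ω₃ K) (f : N → M) : Prop :=
  ∀ x, IsStrongAt h (f x) (tangent n k f x)

/-- The submanifold is strongly coassociative: the same for its normal spaces. -/
def IsStronglyCoassociative (k : ℕ) {N : Type v} [TopologicalSpace N]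
    [ChartedSpace (EuclideanSpace ℝ (Fin k)) N] {ω₃ : DiffForm n M 3} {K : Metric n M}
    (h : IsCartanPair 𝔤 ω₃ K) (f : N → M) : Prop :=
  ∀ x, IsStrongAt h (f x) (normal k K f x)

/-- The subspace `W` of `T_x M` has Lie type `𝔥 ⊆ 𝔤`: some adapted frame maps `W` onto `𝔥`.
The Lie type is well-defined up to automorphisms of `𝔤`. -/
def HasLieType (ω₃ : DiffForm n M 3) (K : Metric n M) (x : M)
    (W : Submodule ℝ (TangentSpace (𝓡 n) x)) (𝔥 : LieSubalgebra ℝ 𝔤) : Prop :=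
  ∃ I : TangentSpace (𝓡 n) x ≃ₗ[ℝ] 𝔤, IsAdaptedFrame ω₃ K x I ∧
    W.map I.toLinearMap = 𝔥.toSubmodule

/-- Subspaces as in the definition of strongly (co)associative submanifolds have a Lie type. -/
theorem IsStrongAt.exists_hasLieType {ω₃ : DiffForm n M 3} {K : Metric n M}
    {h : IsCartanPair 𝔤 ω₃ K} {x : M} {W : Submodule ℝ (TangentSpace (𝓡 n) x)}
    (hW : IsStrongAt h x W) : ∃ 𝔥 : LieSubalgebra ℝ 𝔤, HasLieType ω₃ K x W 𝔥 := by
  refine ⟨{ W.map (h x).choose.toLinearMap with lie_mem' := ?_ }, _, (h x).choose_spec, rfl⟩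
  rintro _ _ ⟨u, hu, rfl⟩ ⟨v, hv, rfl⟩
  exact ⟨bracket h x u v, hW.1 u hu v hv, by simp [bracket]⟩

variable (𝔤) in
/-- A positive quantity that depends only on a Lie subalgebra of `𝔤` up to automorphisms of `𝔤`. -/
def IsLieTypeConstant (c : LieSubalgebra ℝ 𝔤 → ℝ) : Prop :=
  (∀ 𝔥, 0 < c 𝔥) ∧ ∀ (φ : 𝔤 ≃ₗ⁅ℝ⁆ 𝔤) (𝔥 : LieSubalgebra ℝ 𝔤), c (𝔥.map φ.toLieHom) = c 𝔥

end Cartan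

end CartanGeometry

end

/-! The argument is a first variation formula of calibration type, carried out in charts. It needs
no comass bound: criticality is enough. Call a `k`-form `φ` critical on a `k`-plane if `φ` vanishes
when one vector of a frame is replaced by a normal vector. Suppose `φ` is critical on all tangent
planes of `N` and, for normal `X`, its value on an orthonormal tangent frame `e` varies in the
direction `X` as the metric volume does: `∂_X φ(e) = ½ φ(e) ∑ ∂_X g(e_i, e_i)`. Differentiating
criticality along `N` then gives `dφ(X, e) = -φ(e) ⟨H, X⟩`, because the mixed second derivatives of
the immersion cancel by symmetry (`extDeriv_calibration`). The form `φ` is `ω³` in the associative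
case and `*ω³` in the coassociative case.

Criticality expresses closure under the cross product: `ω³(Z, u, v) = -⟨Z, [u, v]⟩` vanishes if `u,
v` lie in a closed subspace and `Z` is orthogonal to it (`IsStrongAt.form_eq_zero`). For `*ω³` one
evaluates the Hodge star in an orthonormal basis adapted to the tangent and normal spaces and counts
dimensions (`starSum_update_eq_zero`).

The condition on `∂_X φ` is where the type of `ω³` enters (`variation_form`). Let `b` be the
derivative of the bracket along a curve of 3-forms and metrics of the given type. Differentiating
the Jacobi identity makes `b` an infinitesimal deformation of the bracket, and differentiating
`tr(ad u ad u) = -⟨u, u⟩` gives `tr(b(u) ad u) = -½ g'(u, u)`. The trace identity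
`bracket_variation` then evaluates `⟨b(f₁, f₂), f₃⟩` whenever `[f₁, f₂]`, `[f₂, f₃]`, `[f₃, f₁]` are
the same multiple of `f₃`, `f₁`, `f₂`. Only the bracket is differentiated, and it is an explicit
function of the form and the metric, so no smooth family of adapted frames is needed. For `*ω³` the
condition is inherited from `ω³` on the normal space, since the squares of the two forms, divided by
Gram determinants, agree on orthogonal complements (`star_sq_eq`, `fderiv_star`).

The constant is `c = 1/√σ`, where `σ` is the square of `ω³` on an orthonormal basis of `W`. It
depends only on the Lie type, because adapted frames preserve both the form and the metric
(`HasLieType.lieTypeConst_eq`). Criticality and the same first variation show that `σ` is stationary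
along `N`, hence constant on connected components (`eq_of_mem_connectedComponent`). -/

noncomputable section

namespace CartanGeometry

universe u v w

/-! ### Orthonormal families, Gram determinants and the variation of a Lie bracket. -/

section LinearAlgebra

variable {V : Type*} [AddCommGroup V] [Module ℝ V]

/-- The Gram matrix of a family of vectors. -/
def gram {ι : Type*} (g : V →ₗ[ℝ] V →ₗ[ℝ] ℝ) (v : ι → V) : Matrix ι ι ℝ :=
  Matrix.of fun i j => g (v i) (v j)

/-- The family `f` is orthonormal with respect to `g`. -/
def IsOrtho {ι : Type*} [DecidableEq ι] (g : V →ₗ[ℝ] V →ₗ[ℝ] ℝ) (f : ι → V) : Prop :=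
  ∀ i j, g (f i) (f j) = if i = j then 1 else 0

theorem IsOrtho.eq_sum {ι : Type*} [DecidableEq ι] [Fintype ι] {g : V →ₗ[ℝ] V →ₗ[ℝ] ℝ}
    {f : ι → V} (hf : IsOrtho g f) {v : V} (hv : v ∈ Submodule.span ℝ (Set.range f)) :
    v = ∑ i, g v (f i) • f i := by
  obtain ⟨c, rfl⟩ := (Submodule.mem_span_range_iff_exists_fun ℝ).1 hv
  refine Finset.sum_congr rfl fun i _ => ?_
  congr 1
  simp [hf _ _]

theorem IsOrtho.linearIndependent {ι : Type*} [DecidableEq ι] [Fintype ι]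
    {g : V →ₗ[ℝ] V →ₗ[ℝ] ℝ} {f : ι → V} (hf : IsOrtho g f) : LinearIndependent ℝ f := by
  rw [Fintype.linearIndependent_iff]
  intro c hc i
  have := congrArg (fun v => g v (f i)) hc
  simpa [hf _ _] using this

theorem map_sum_smul {m : ℕ} (φ : V [⋀^Fin m]→ₗ[ℝ] ℝ) (f : Fin m → V) (A : Matrix (Fin m) (Fin m) ℝ) :
    φ (fun i => ∑ j, A i j • f j) = A.det * φ f := by
  have h := (φ.compLinearMap (Fintype.linearCombination ℝ f)).eq_smul_basis_det
    (Pi.basisFun ℝ (Fin m))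
  have h1 : φ.compLinearMap (Fintype.linearCombination ℝ f) (Pi.basisFun ℝ (Fin m)) = φ f :=
    congrArg φ (funext fun i => by simp [Fintype.linearCombination_apply, Pi.single_apply])
  rw [h1, Pi.basisFun_det] at h
  have h' := congrArg (fun ψ => ψ A) h
  rw [mul_comm]
  exact h'

/-- The square of a top degree form on the span of an orthonormal family is a multiple of the Gram
determinant. -/
theorem map_sq_eq {m : ℕ} {g : V →ₗ[ℝ] V →ₗ[ℝ] ℝ} (φ : V [⋀^Fin m]→ₗ[ℝ] ℝ) {f ν : Fin m → V}
    (hf : IsOrtho g f) (hν : ∀ i, ν i ∈ Submodule.span ℝ (Set.range f)) :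
    φ ν ^ 2 = φ f ^ 2 * (gram g ν).det := by
  have h1 : ν = fun i => ∑ j, g (ν i) (f j) • f j := funext fun i => hf.eq_sum (hν i)
  set A : Matrix (Fin m) (Fin m) ℝ := Matrix.of fun i j => g (ν i) (f j) with hA
  have h2 : gram g ν = A * A.transpose := by
    ext i j
    have : g (ν i) (ν j) = g (ν i) (∑ l, g (ν j) (f l) • f l) := by rw [← hf.eq_sum (hν j)]
    simp only [gram, Matrix.of_apply, this, Matrix.mul_apply, Matrix.transpose_apply, hA]
    simp [mul_comm]
  have h3 : φ ν = A.det * φ f := by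
    rw [← map_sum_smul]
    exact congrArg φ h1
  rw [h2, h3, Matrix.det_mul, Matrix.det_transpose]
  ring

/-- More arguments in `S` than its dimension allows are linearly dependent. All later vanishing
statements by counting dimensions rest on this. -/
theorem map_eq_zero_of_finrank_lt {ι : Type*} [Finite ι] (φ : V [⋀^ι]→ₗ[ℝ] ℝ) (v : ι → V)
    (S : Submodule ℝ V) [FiniteDimensional ℝ S] (J : Finset ι) (hJ : ∀ j ∈ J, v j ∈ S)
    (h : finrank ℝ S < J.card) : φ v = 0 := by
  refine φ.map_linearDependent v fun hv => ?_
  have h1 : LinearIndependent ℝ (fun j : J => (⟨v j, hJ j j.2⟩ : S)) := by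
    apply LinearIndependent.of_comp S.subtype
    exact hv.comp (fun j : J => (j : ι)) Subtype.val_injective
  have := h1.fintype_card_le_finrank
  simp at this
  omega

/-- The contraction of a bilinear form with the metric, in an orthonormal basis and in an arbitrary
basis. -/
theorem sum_orthonormal_eq {ι κ : Type*} [Fintype ι] [DecidableEq ι] [Fintype κ]
    {g : V →ₗ[ℝ] V →ₗ[ℝ] ℝ} {b : ι → V} (hb : IsOrtho g b)
    (hspan : ⊤ ≤ Submodule.span ℝ (Set.range b)) (c : Basis κ ℝ V) (r : κ → V)
    (hr : ∀ j v, g (r j) v = c.coord j v) (ψ : V → V → ℝ)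
    (h1 : ∀ v, IsLinearMap ℝ (fun u => ψ u v)) (h2 : ∀ u, IsLinearMap ℝ (ψ u)) :
    ∑ i, ψ (b i) (b i) = ∑ j, ψ (c j) (r j) := by
  let Ψ : V →ₗ[ℝ] V →ₗ[ℝ] ℝ := LinearMap.mk₂ ℝ ψ (fun u u' v => (h1 v).1 u u')
    (fun a u v => (h1 v).2 a u) (fun u v v' => (h2 u).1 v v') (fun a u v => (h2 u).2 a v)
  change ∑ i, Ψ (b i) (b i) = ∑ j, Ψ (c j) (r j)
  -- The vector `r j` is the `j`-th coordinate covector with its index raised, so its coefficients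
  -- in the orthonormal family are the values of that covector.
  have hrj : ∀ j, r j = ∑ i, c.coord j (b i) • b i := fun j => by
    conv_lhs => rw [hb.eq_sum (hspan (Submodule.mem_top (x := r j)))]
    simp only [hr]
  have hbi : ∀ i, ∑ j, c.coord j (b i) • c j = b i := fun i => c.sum_repr (b i)
  calc ∑ i, Ψ (b i) (b i) = ∑ i, Ψ (∑ j, c.coord j (b i) • c j) (b i) := by simp only [hbi]
    _ = ∑ j, Ψ (c j) (r j) := by
      simp only [hrj, map_sum, map_smul, LinearMap.sum_apply, LinearMap.smul_apply]
      exact Finset.sum_comm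

theorem sum_orthonormal_congr {ι κ : Type*} [Fintype ι] [DecidableEq ι] [Fintype κ] [DecidableEq κ]
    {g : V →ₗ[ℝ] V →ₗ[ℝ] ℝ} {b : ι → V} {c : κ → V} (hb : IsOrtho g b) (hc : IsOrtho g c)
    (hbs : ⊤ ≤ Submodule.span ℝ (Set.range b)) (hcs : ⊤ ≤ Submodule.span ℝ (Set.range c))
    (symm : ∀ u v, g u v = g v u) (ψ : V → V → ℝ)
    (h1 : ∀ v, IsLinearMap ℝ (fun u => ψ u v)) (h2 : ∀ u, IsLinearMap ℝ (ψ u)) :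
    ∑ i, ψ (b i) (b i) = ∑ j, ψ (c j) (c j) := by
  let C : Basis κ ℝ V := Basis.mk hc.linearIndependent hcs
  have hC : ∀ j, C j = c j := fun j => by simp [C]
  rw [sum_orthonormal_eq hb hbs C c _ ψ h1 h2]
  · simp only [hC]
  · intro j v
    have : (∑ i, g v (c i) • C i) = v := by
      simp only [hC]
      exact (hc.eq_sum (hcs Submodule.mem_top)).symm
    rw [symm, ← this]
    have hrep : ∀ x, (C.repr (c x)) j = if x = j then 1 else 0 := fun x => by
      rw [← hC, C.repr_self, Finsupp.single_apply]
    simp [hC, hc _ _, hrep]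

/-- The infinitesimal variation of a Lie bracket `A` in the direction `b`, with the corresponding
variation of its Killing form, determines `b` on subalgebras isomorphic to `𝔰𝔬(3)`. -/
theorem bracket_variation (A b : V →ₗ[ℝ] Module.End ℝ V) (g : V → V → ℝ)
    (hA : ∀ u v, A u v = -A v u) (hb : ∀ u v, b u v = -b v u)
    (hlie : ∀ u v, A (A u v) = A u * A v - A v * A u)
    (hjac : ∀ u v w, b (A u v) w + A (b u v) w + (b (A v w) u + A (b v w) u)
      + (b (A w u) v + A (b w u) v) = 0)
    (hkill : ∀ u v, LinearMap.trace ℝ V (A u * A v) = -g u v) (u v w : V) :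
    g (b u v) w = LinearMap.trace ℝ V (b (A u v) * A w) - LinearMap.trace ℝ V (b u * A (A v w))
      + LinearMap.trace ℝ V (b v * A (A u w)) := by
  -- The linearised Jacobi identity in operator form: the derivative of `ad [u, v] = [ad u, ad v]`.
  have h1 : b (A u v) + A (b u v) = b u * A v - A v * b u + (A u * b v - b v * A u) := by
    ext x
    have := hjac u v x
    rw [hb (A v x), hA (b v x), hb (A x u), hA (b x u), hA x u, hb x u] at this
    simp only [map_neg] at this
    simp only [LinearMap.add_apply, LinearMap.sub_apply, Module.End.mul_apply]
    rw [← sub_eq_zero, ← this]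
    abel
  -- Pairing with `ad w` under the trace turns `A (b u v)` into `-g (b u v) w`. Cyclicity collects
  -- commutators of `ad`s on the other side, and these are again `ad` of brackets.
  have h2 := congrArg (fun T => LinearMap.trace ℝ V (T * A w)) h1
  have e1 : LinearMap.trace ℝ V (A v * b u * A w) = LinearMap.trace ℝ V (b u * (A w * A v)) := by
    rw [mul_assoc, LinearMap.trace_mul_comm, mul_assoc]
  have e2 : LinearMap.trace ℝ V (A u * b v * A w) = LinearMap.trace ℝ V (b v * (A w * A u)) := by
    rw [mul_assoc, LinearMap.trace_mul_comm, mul_assoc]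
  simp only [add_mul, sub_mul, map_add, map_sub, hkill, e1, e2] at h2
  simp only [hlie v w, hlie u w, mul_sub, map_sub]
  simp only [mul_assoc] at h2
  linarith

/-- The derivative of the determinant at the identity matrix. -/
theorem sum_det_updateRow_one {m : ℕ} (D : Matrix (Fin m) (Fin m) ℝ) :
    ∑ i, ((1 : Matrix (Fin m) (Fin m) ℝ).updateRow i (D i)).det = D.trace := by
  refine Finset.sum_congr rfl fun i _ => ?_
  have h : D i = ∑ j, D i j • (1 : Matrix (Fin m) (Fin m) ℝ) j := by
    ext l
    simp [Matrix.one_apply]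
  rw [h, Matrix.det_updateRow_sum]
  simp

end LinearAlgebra

/-! ### The bracket as a differentiable function of the 3-form and the metric. -/

section Calculus

set_option maxSynthPendingDepth 3

open Filter Topology

variable {E : Type*} [NormedAddCommGroup E] [NormedSpace ℝ E]

/-- A continuous bilinear form as an algebraic bilinear form. -/
def lin₂ (T : E →L[ℝ] E →L[ℝ] ℝ) : E →ₗ[ℝ] E →ₗ[ℝ] ℝ :=
  (ContinuousLinearMap.coeLM ℝ).comp T.toLinearMap

@[simp]
theorem lin₂_apply (T : E →L[ℝ] E →L[ℝ] ℝ) (u v : E) : lin₂ T u v = T u v := rfl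

/-- A 3-form as a trilinear form. -/
def curry₃ : (E [⋀^Fin 3]→L[ℝ] ℝ) →L[ℝ] (E →L[ℝ] E →L[ℝ] E →L[ℝ] ℝ) :=
  let c₁ : (E [⋀^Fin 1]→L[ℝ] ℝ) →L[ℝ] (E →L[ℝ] ℝ) :=
    (ContinuousAlternatingMap.ofSubsingletonLIE (𝕜 := ℝ) (E := E) (F := ℝ)
      (0 : Fin 1)).symm.toContinuousLinearEquiv
  let c₂ : (E [⋀^Fin 2]→L[ℝ] ℝ) →L[ℝ] (E →L[ℝ] E →L[ℝ] ℝ) :=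
    (ContinuousLinearMap.compL ℝ E (E [⋀^Fin 1]→L[ℝ] ℝ) (E →L[ℝ] ℝ) c₁).comp
      ContinuousAlternatingMap.curryLeftLI.toContinuousLinearMap
  (ContinuousLinearMap.compL ℝ E (E [⋀^Fin 2]→L[ℝ] ℝ) (E →L[ℝ] E →L[ℝ] ℝ) c₂).comp
    ContinuousAlternatingMap.curryLeftLI.toContinuousLinearMap

theorem curry₃_apply (w : E [⋀^Fin 3]→L[ℝ] ℝ) (u v z : E) : curry₃ w u v z = w ![u, v, z] := by
  change w _ = w _
  congr 1
  ext i
  fin_cases i <;> rfl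

/-- A linear isomorphism with `𝔤` that carries `ω_𝔤` to `w` and minus the Killing form to `g`. -/
def IsAdapted {𝔤 : Type*} [LieRing 𝔤] [LieAlgebra ℝ 𝔤] (w : E [⋀^Fin 3]→L[ℝ] ℝ)
    (g : E →L[ℝ] E →L[ℝ] ℝ) (J : E ≃ₗ[ℝ] 𝔤) : Prop :=
  (∀ u v z, w ![u, v, z] = cartanForm (J u) (J v) (J z)) ∧
    ∀ u v, g u v = -killingForm ℝ 𝔤 (J u) (J v)

/-- Raising of indices. -/
theorem exists_equiv_of_pos [FiniteDimensional ℝ E] (g : E →L[ℝ] E →L[ℝ] ℝ)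
    (pos : ∀ u, u ≠ 0 → 0 < g u u) : ∃ e : E ≃L[ℝ] (E →L[ℝ] ℝ), (e : E →L[ℝ] E →L[ℝ] ℝ) = g := by
  have hinj : Function.Injective g := by
    rw [injective_iff_map_eq_zero]
    intro u hu
    by_contra h
    have := pos u h
    simp [hu] at this
  have hfr : finrank ℝ E = finrank ℝ (E →L[ℝ] ℝ) := by
    rw [← LinearEquiv.finrank_eq (LinearMap.toContinuousLinearMap : (E →ₗ[ℝ] ℝ) ≃ₗ[ℝ] _)]
    exact (Subspace.dual_finrank_eq (K := ℝ) (V := E)).symm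
  refine ⟨(LinearEquiv.ofInjectiveOfFinrankEq g.toLinearMap hinj hfr).toContinuousLinearEquiv, ?_⟩
  ext u v
  rfl

theorem inverse_apply_left [FiniteDimensional ℝ E] (g : E →L[ℝ] E →L[ℝ] ℝ)
    (pos : ∀ u, u ≠ 0 → 0 < g u u) (α : E →L[ℝ] ℝ) : g (g.inverse α) = α := by
  obtain ⟨e, rfl⟩ := exists_equiv_of_pos g pos
  simp

theorem differentiableAt_inverse [FiniteDimensional ℝ E] {H : Type*} [NormedAddCommGroup H]
    [NormedSpace ℝ H] {g : H → E →L[ℝ] E →L[ℝ] ℝ} {q : H}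
    (hg : DifferentiableAt ℝ g q) (pos : ∀ u, u ≠ 0 → 0 < g q u u) :
    DifferentiableAt ℝ (fun y => (g y).inverse) q := by
  obtain ⟨e, he⟩ := exists_equiv_of_pos (g q) pos
  have : CompleteSpace E := FiniteDimensional.complete ℝ E
  have h : DifferentiableAt ℝ ContinuousLinearMap.inverse (g q) := by
    rw [← he]
    exact (contDiffAt_map_inverse (n := 1) e).differentiableAt (by simp)
  exact DifferentiableAt.comp (g := ContinuousLinearMap.inverse) q h hg

/-- The bracket defined by a 3-form and a metric. -/
def crossProduct (w : E [⋀^Fin 3]→L[ℝ] ℝ) (g : E →L[ℝ] E →L[ℝ] ℝ) : E →L[ℝ] E →L[ℝ] E :=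
  -((ContinuousLinearMap.compL ℝ E (E →L[ℝ] ℝ) E g.inverse).comp (curry₃ w))

/-- The minus sign reflects that the metric is minus the Killing form. Defining the product by this
relation, and not through an adapted isomorphism, is what makes it differentiable in `w` and `g`. -/
theorem inner_crossProduct [FiniteDimensional ℝ E] (w : E [⋀^Fin 3]→L[ℝ] ℝ)
    (g : E →L[ℝ] E →L[ℝ] ℝ) (pos : ∀ u, u ≠ 0 → 0 < g u u) (u v z : E) :
    g (crossProduct w g u v) z = -w ![u, v, z] := by
  have : crossProduct w g u v = -g.inverse (curry₃ w u v) := rfl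
  rw [this, map_neg, inverse_apply_left g pos, neg_apply, curry₃_apply]

variable {𝔤 : Type*} [LieRing 𝔤] [LieAlgebra ℝ 𝔤]

theorem IsAdapted.pos {w : E [⋀^Fin 3]→L[ℝ] ℝ} {g : E →L[ℝ] E →L[ℝ] ℝ} {J : E ≃ₗ[ℝ] 𝔤}
    (h : IsAdapted w g J) (h𝔤 : IsCompactSimple 𝔤) (u : E) (hu : u ≠ 0) : 0 < g u u := by
  rw [h.2]
  have := h𝔤.2 (J u) (by simpa using hu)
  linarith

/-- By invariance of the Killing form, `⟨X, [Y, Z]⟩ = ⟨[X, Y], Z⟩`, so both sides have the same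
scalar product with every vector. -/
theorem IsAdapted.crossProduct_eq [FiniteDimensional ℝ E] {w : E [⋀^Fin 3]→L[ℝ] ℝ}
    {g : E →L[ℝ] E →L[ℝ] ℝ} {J : E ≃ₗ[ℝ] 𝔤} (h : IsAdapted w g J) (h𝔤 : IsCompactSimple 𝔤)
    (u v : E) : crossProduct w g u v = J.symm ⁅J u, J v⁆ := by
  obtain ⟨e, he⟩ := exists_equiv_of_pos g (h.pos h𝔤)
  apply e.injective
  have he' : ∀ x, e x = g x := fun x => by rw [← he]; rfl
  rw [he', he']
  ext z
  rw [inner_crossProduct w g (h.pos h𝔤), h.1, h.2, cartanForm, LinearEquiv.apply_symm_apply,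
    LieModule.traceForm_apply_lie_apply]

theorem IsAdapted.symm {w : E [⋀^Fin 3]→L[ℝ] ℝ} {g : E →L[ℝ] E →L[ℝ] ℝ} {J : E ≃ₗ[ℝ] 𝔤}
    (h : IsAdapted w g J) (u v : E) : g u v = g v u := by
  rw [h.2, h.2, LieModule.traceForm_comm]

/-- The operator `ad u` of a bracket on `E`. -/
def adLin (B : E →L[ℝ] E →L[ℝ] E) : E →ₗ[ℝ] Module.End ℝ E :=
  (ContinuousLinearMap.coeLM ℝ).comp B.toLinearMap

@[simp]
theorem adLin_apply (B : E →L[ℝ] E →L[ℝ] E) (u v : E) : adLin B u v = B u v := rfl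

/-- The metric is recovered from the bracket alone. This constraint ties the variation of the metric
to that of the bracket. -/
theorem IsAdapted.trace_eq [FiniteDimensional ℝ E] {w : E [⋀^Fin 3]→L[ℝ] ℝ}
    {g : E →L[ℝ] E →L[ℝ] ℝ} {J : E ≃ₗ[ℝ] 𝔤} (h : IsAdapted w g J) (h𝔤 : IsCompactSimple 𝔤)
    (u v : E) : LinearMap.trace ℝ E (adLin (crossProduct w g) u * adLin (crossProduct w g) v)
      = -g u v := by
  rw [h.2, neg_neg, killingForm_apply_apply, ← LinearMap.trace_conj' _ J.symm]
  congr 1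
  ext x
  simp [h.crossProduct_eq h𝔤, LinearEquiv.conj_apply]

end Calculus

/-! ### First variation of a 3-form of type `ω_𝔤`. -/

section Variation

set_option maxSynthPendingDepth 3

open Filter Topology

theorem map_swap₀₁ {V : Type*} [AddCommGroup V] [Module ℝ V] (w : V [⋀^Fin 3]→ₗ[ℝ] ℝ) (a b c : V) :
    w ![b, a, c] = -w ![a, b, c] := by
  rw [← w.map_swap ![a, b, c] (i := 0) (j := 1) (by decide)]
  congr 1
  ext i
  fin_cases i <;> rfl

theorem map_swap₁₂ {V : Type*} [AddCommGroup V] [Module ℝ V] (w : V [⋀^Fin 3]→ₗ[ℝ] ℝ) (a b c : V) :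
    w ![a, c, b] = -w ![a, b, c] := by
  rw [← w.map_swap ![a, b, c] (i := 1) (j := 2) (by decide)]
  congr 1
  ext i
  fin_cases i <;> rfl

theorem map_rotate {V : Type*} [AddCommGroup V] [Module ℝ V] (w : V [⋀^Fin 3]→ₗ[ℝ] ℝ) (a b c : V) :
    w ![b, c, a] = w ![a, b, c] := by
  rw [map_swap₁₂, map_swap₀₁, neg_neg]

variable {E : Type*} [NormedAddCommGroup E] [NormedSpace ℝ E] [FiniteDimensional ℝ E]
variable {𝔤 : Type*} [LieRing 𝔤] [LieAlgebra ℝ 𝔤]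

theorem hasDerivAt_trace {S T : ℝ → E →L[ℝ] E} {S' T' : E →L[ℝ] E} (hS : HasDerivAt S S' 0)
    (hT : HasDerivAt T T' 0) :
    HasDerivAt (fun s => LinearMap.trace ℝ E ((S s : E →ₗ[ℝ] E) * (T s : E →ₗ[ℝ] E)))
      (LinearMap.trace ℝ E ((S' : E →ₗ[ℝ] E) * (T 0 : E →ₗ[ℝ] E))
        + LinearMap.trace ℝ E ((S 0 : E →ₗ[ℝ] E) * (T' : E →ₗ[ℝ] E))) 0 := by
  let tr : (E →L[ℝ] E) →L[ℝ] ℝ :=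
    ((LinearMap.trace ℝ E).comp (ContinuousLinearMap.coeLM ℝ)).toContinuousLinearMap
  have h := tr.hasFDerivAt.comp_hasDerivAt 0 (hS.clm_comp hT)
  rw [map_add] at h
  exact h

/-- First variation of a 3-form of type `ω_𝔤` on a 3-dimensional subalgebra. -/
theorem variation_form (h𝔤 : IsCompactSimple 𝔤) {g : ℝ → E →L[ℝ] E →L[ℝ] ℝ}
    {w : ℝ → E [⋀^Fin 3]→L[ℝ] ℝ} {g' : E →L[ℝ] E →L[ℝ] ℝ} {w' : E [⋀^Fin 3]→L[ℝ] ℝ}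
    (hg : HasDerivAt g g' 0) (hw : HasDerivAt w w' 0)
    (hJ : ∀ᶠ s in 𝓝 0, ∃ J : E ≃ₗ[ℝ] 𝔤, IsAdapted (w s) (g s) J) {f : Fin 3 → E}
    (hcrit : ∀ i Y, w 0 (Function.update f i Y) = w 0 f * g 0 (f i) Y) :
    w' f = 2⁻¹ * w 0 f * ∑ i, g' (f i) (f i) := by
  obtain ⟨J, hJ0⟩ := hJ.self_of_nhds
  have hpos := hJ0.pos h𝔤
  -- The isomorphisms `J` exist for each `s` separately, with no regularity in `s`. The bracket `B
  -- s` is nevertheless differentiable, and all identities that `J` yields can be stated for `B` and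
  -- then differentiated.
  set B : ℝ → E →L[ℝ] E →L[ℝ] E := fun s => crossProduct (w s) (g s) with hBdef
  have hBd : DifferentiableAt ℝ B 0 := by
    have h1 := differentiableAt_inverse hg.differentiableAt hpos
    have h2 : DifferentiableAt ℝ (fun s => curry₃ (w s)) 0 :=
      (curry₃ (E := E)).differentiableAt.comp 0 hw.differentiableAt
    have h3 : DifferentiableAt ℝ
        (fun s => ContinuousLinearMap.compL ℝ E (E →L[ℝ] ℝ) E (g s).inverse) 0 :=
      (ContinuousLinearMap.compL ℝ E (E →L[ℝ] ℝ) E).differentiableAt.comp 0 h1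
    exact (h3.clm_comp h2).neg
  obtain ⟨b, hB⟩ : ∃ b, HasDerivAt B b 0 := ⟨_, hBd.hasDerivAt⟩
  have hB1 : ∀ u, HasDerivAt (fun s => B s u) (b u) 0 := fun u => by
    simpa using hB.clm_apply (hasDerivAt_const 0 u)
  have hB2 : ∀ u v, HasDerivAt (fun s => B s u v) (b u v) 0 := fun u v => by
    simpa using (hB1 u).clm_apply (hasDerivAt_const 0 v)
  have hBB : ∀ u v x, HasDerivAt (fun s => B s (B s u v) x) (b (B 0 u v) x + B 0 (b u v) x) 0 :=
    fun u v x => by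
      simpa using (hB.clm_apply (hB2 u v)).clm_apply (hasDerivAt_const 0 x)
  have heq : ∀ᶠ s in 𝓝 0, ∃ J : E ≃ₗ[ℝ] 𝔤, ∀ u v, B s u v = J.symm ⁅J u, J v⁆ := by
    filter_upwards [hJ] with s ⟨J, hs⟩
    exact ⟨J, hs.crossProduct_eq h𝔤⟩
  have hA : ∀ u v, B 0 u v = -B 0 v u := fun u v => by
    obtain ⟨J, hs⟩ := heq.self_of_nhds
    rw [hs, hs, ← lie_skew, map_neg]
  have hb : ∀ u v, b u v = -b v u := fun u v => by
    refine (hB2 u v).unique ((hB2 v u).neg.congr_of_eventuallyEq ?_)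
    filter_upwards [heq] with s ⟨J, hs⟩
    simp only [Pi.neg_apply, hs]
    rw [← lie_skew, map_neg]
  have hlie : ∀ u v, adLin (B 0) (adLin (B 0) u v)
      = adLin (B 0) u * adLin (B 0) v - adLin (B 0) v * adLin (B 0) u := fun u v => by
    obtain ⟨J, hs⟩ := heq.self_of_nhds
    ext x
    simp only [adLin_apply, LinearMap.sub_apply, Module.End.mul_apply, hs,
      LinearEquiv.apply_symm_apply, lie_lie, map_sub]
  have hjac : ∀ u v x, b (B 0 u v) x + B 0 (b u v) x + (b (B 0 v x) u + B 0 (b v x) u)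
      + (b (B 0 x u) v + B 0 (b x u) v) = 0 := fun u v x => by
    refine (((hBB u v x).add (hBB v x u)).add (hBB x u v)).unique
      ((hasDerivAt_const (0 : ℝ) (0 : E)).congr_of_eventuallyEq ?_)
    filter_upwards [heq] with s ⟨J, hs⟩
    simp only [Pi.add_apply, hs, LinearEquiv.apply_symm_apply]
    rw [← map_add, ← map_add]
    have := lie_jacobi (J u) (J v) (J x)
    have skew : ∀ X Y Z : 𝔤, ⁅⁅X, Y⁆, Z⁆ = -⁅Z, ⁅X, Y⁆⁆ := fun X Y Z => (lie_skew _ _).symm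
    rw [← map_zero J.symm, ← neg_zero, ← this, skew, skew, skew]
    congr 1
    abel
  have hkill : ∀ u v, LinearMap.trace ℝ E (adLin (B 0) u * adLin (B 0) v) = -g 0 u v :=
    hJ0.trace_eq h𝔤
  -- Derivative of `tr(ad u ad u) = -g(u, u)`; the two terms of the product rule agree by cyclicity
  -- of the trace, hence the factor one half.
  have hq : ∀ u, LinearMap.trace ℝ E (adLin b u * adLin (B 0) u) = -(2⁻¹ * g' u u) := fun u => by
    have hg1 : HasDerivAt (fun s => -g s u u) (-g' u u) 0 := by
      have h : HasDerivAt (fun s => g s u u) (g' u u) 0 := by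
        simpa using (hg.clm_apply (hasDerivAt_const 0 u)).clm_apply (hasDerivAt_const 0 u)
      exact h.neg
    have h1 := hasDerivAt_trace (hB1 u) (hB1 u)
    have h2 := h1.unique (hg1.congr_of_eventuallyEq (by
      filter_upwards [hJ] with s ⟨J, hs⟩
      exact hs.trace_eq h𝔤 u u))
    rw [LinearMap.trace_mul_comm ℝ (B 0 u : E →ₗ[ℝ] E)] at h2
    change LinearMap.trace ℝ E ((b u : E →ₗ[ℝ] E) * (B 0 u : E →ₗ[ℝ] E)) = _
    linarith
  have hder : ∀ u v z, g' (B 0 u v) z + g 0 (b u v) z = -w' ![u, v, z] := fun u v z => by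
    have h1 : HasDerivAt (fun s => g s (B s u v) z) (g' (B 0 u v) z + g 0 (b u v) z) 0 := by
      simpa using (hg.clm_apply (hB2 u v)).clm_apply (hasDerivAt_const 0 z)
    have h2 : HasDerivAt (fun s => -w s ![u, v, z]) (-w' ![u, v, z]) 0 :=
      ((ContinuousAlternatingMap.apply ℝ E ℝ ![u, v, z]).hasFDerivAt.comp_hasDerivAt 0 hw).neg
    refine h1.unique (h2.congr_of_eventuallyEq ?_)
    filter_upwards [hJ] with s ⟨J, hs⟩
    exact inner_crossProduct _ _ (hs.pos h𝔤) u v z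
  have hinj : ∀ u v, (∀ z, g 0 u z = g 0 v z) → u = v := fun u v huv => by
    by_contra hne
    have := hpos _ (sub_ne_zero.2 hne)
    rw [(g 0).map_sub, sub_apply, huv, sub_self] at this
    exact lt_irrefl _ this
  have hB0 : ∀ u v z, g 0 (B 0 u v) z = -w 0 ![u, v, z] := inner_crossProduct _ _ hpos
  set t := w 0 f with ht
  have hf3 : f = ![f 0, f 1, f 2] := by ext i; fin_cases i <;> rfl
  -- By criticality, contracting `w 0` with two of the `f i` gives a multiple of the metric dual of
  -- the third. This yields the relations of `𝔰𝔬(3)`, scaled by `-t`: `[f₀, f₁] = -t f₂` and its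
  -- cyclic permutations.
  have c0 : ∀ Y, w 0 ![Y, f 1, f 2] = t * g 0 (f 0) Y := fun Y => by
    rw [← hcrit]; congr 1; ext i; fin_cases i <;> rfl
  have c1 : ∀ Y, w 0 ![f 0, Y, f 2] = t * g 0 (f 1) Y := fun Y => by
    rw [← hcrit]; congr 1; ext i; fin_cases i <;> rfl
  have c2 : ∀ Y, w 0 ![f 0, f 1, Y] = t * g 0 (f 2) Y := fun Y => by
    rw [← hcrit]; congr 1; ext i; fin_cases i <;> rfl
  have b01 : B 0 (f 0) (f 1) = -t • f 2 := hinj _ _ fun z => by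
    rw [hB0, c2]; simp
  have b12 : B 0 (f 1) (f 2) = -t • f 0 := hinj _ _ fun z => by
    rw [hB0, show w 0 ![f 1, f 2, z] = w 0 ![z, f 1, f 2] from
      map_rotate (w 0).toAlternatingMap z (f 1) (f 2), c0]
    simp
  have b02 : B 0 (f 0) (f 2) = t • f 1 := hinj _ _ fun z => by
    rw [hB0, show w 0 ![f 0, f 2, z] = -w 0 ![f 0, z, f 2] from
      map_swap₁₂ (w 0).toAlternatingMap (f 0) z (f 2), c1]
    simp
  -- With these relations every trace on the right is a multiple of `tr(b(f i) ad (f i))`, which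
  -- `hq` evaluates. The result is `(t/2) (g'(f₂, f₂) - g'(f₀, f₀) - g'(f₁, f₁))`, and `hder`
  -- contributes the further `-t g'(f₂, f₂)` that makes the sum symmetric.
  have key := bracket_variation (adLin (B 0)) (adLin b) (fun u v => g 0 u v) hA hb hlie hjac hkill
    (f 0) (f 1) (f 2)
  simp only [adLin_apply, b01, b12, b02, map_smul, smul_mul_assoc, mul_smul_comm, hq,
    smul_eq_mul] at key
  have h1 := hder (f 0) (f 1) (f 2)
  rw [b01, ← hf3] at h1
  simp only [map_smul, smul_apply, smul_eq_mul] at h1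
  rw [Fin.sum_univ_three]
  linarith

/-- `variation_form` along the line through `q` in the direction `X`. Invariantly, in view of
`hcrit`, this says that the Levi-Civita derivative `∇_X w` vanishes on `f`. -/
theorem fderiv_form (h𝔤 : IsCompactSimple 𝔤) {g : E → E →L[ℝ] E →L[ℝ] ℝ}
    {w : E → E [⋀^Fin 3]→L[ℝ] ℝ} {q : E} (hg : DifferentiableAt ℝ g q)
    (hw : DifferentiableAt ℝ w q)
    (hJ : ∀ᶠ y in 𝓝 q, ∃ J : E ≃ₗ[ℝ] 𝔤, IsAdapted (w y) (g y) J) {f : Fin 3 → E}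
    (hcrit : ∀ i Y, w q (Function.update f i Y) = w q f * g q (f i) Y) (X : E) :
    fderiv ℝ w q X f = 2⁻¹ * w q f * ∑ i, fderiv ℝ g q X (f i) (f i) := by
  have hl : HasDerivAt (fun s : ℝ => q + s • X) X 0 := by
    simpa using ((hasDerivAt_id (0 : ℝ)).smul_const X).const_add q
  have hq : q + (0 : ℝ) • X = q := by simp
  have hg' : HasDerivAt (fun s : ℝ => g (q + s • X)) (fderiv ℝ g q X) 0 :=
    HasFDerivAt.comp_hasDerivAt (l := g) 0 (by rw [hq]; exact hg.hasFDerivAt) hl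
  have hw' : HasDerivAt (fun s : ℝ => w (q + s • X)) (fderiv ℝ w q X) 0 :=
    HasFDerivAt.comp_hasDerivAt (l := w) 0 (by rw [hq]; exact hw.hasFDerivAt) hl
  have := variation_form h𝔤 hg' hw' (f := f)
    (hl.continuousAt.eventually (p := fun y => ∃ J : E ≃ₗ[ℝ] 𝔤, IsAdapted (w y) (g y) J)
      (by simpa using hJ)) (by rw [hq]; exact hcrit)
  rwa [hq] at this

end Variation

/-! ### The first variation formula for critical forms. -/

section Calibration

set_option maxSynthPendingDepth 3

open Filter Topology Function

variable {E : Type*} [NormedAddCommGroup E] [NormedSpace ℝ E]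
variable {H : Type*} [NormedAddCommGroup H] [NormedSpace ℝ H]

theorem map_cons_removeNth {V : Type*} [AddCommGroup V] [Module ℝ V] {k : ℕ}
    (φ : V [⋀^Fin (k + 1)]→ₗ[ℝ] ℝ) (e : Fin (k + 1) → V) (j : Fin (k + 1)) (X : V) :
    (-1 : ℝ) ^ (j : ℕ) * φ (Fin.cons X (j.removeNth e)) = φ (update e j X) := by
  have h := φ.map_insertNth j X (j.removeNth e)
  rw [Fin.insertNth_removeNth] at h
  rw [h, Matrix.vecCons]
  simp

/-- In the alternating sum, the term that differentiates along `e j` has `X` in front. Moving `X`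
into the empty slot `j` absorbs the sign up to a global minus. -/
theorem extDeriv_cons {k : ℕ} {φ : E → E [⋀^Fin k]→L[ℝ] ℝ} {q : E} (hφ : DifferentiableAt ℝ φ q)
    (X : E) (e : Fin k → E) :
    extDeriv φ q (Fin.cons X e) =
      fderiv ℝ φ q X e - ∑ j, fderiv ℝ φ q (e j) (update e j X) := by
  have hc : ∀ (c : Fin k → E) (v : E), fderiv ℝ (fun y => φ y c) q v = fderiv ℝ φ q v c :=
    fun c v => fderiv_continuousAlternatingMap_apply_const_apply hφ c v
  rw [extDeriv_apply hφ, Fin.sum_univ_succ]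
  simp only [hc]
  cases k with
  | zero => simp
  | succ k =>
    simp only [Fin.val_zero, pow_zero, one_smul, Fin.cons_zero, Fin.removeNth_zero, Fin.tail_cons,
      Fin.cons_succ, Fin.val_succ, sub_eq_add_neg, ← Finset.sum_neg_distrib]
    congr 1
    refine Finset.sum_congr rfl fun j _ => ?_
    have h := map_cons_removeNth (fderiv ℝ φ q (e j)).toAlternatingMap e j X
    simp only [ContinuousAlternatingMap.coe_toAlternatingMap] at h
    rw [← h]
    have : j.succ.removeNth (Fin.cons X e : Fin (k + 2) → E) = Fin.cons X (j.removeNth e) := by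
      ext i
      refine Fin.cases ?_ (fun i => ?_) i <;> simp [Fin.removeNth]
    rw [this, pow_succ, zsmul_eq_mul]
    simp

theorem hasFDerivAt_metric {G : H → E →L[ℝ] E →L[ℝ] ℝ} {G' : H →L[ℝ] E →L[ℝ] E →L[ℝ] ℝ} {p : H}
    (hG : HasFDerivAt G G' p) {u v : H → E} {u' v' : H →L[ℝ] E} (hu : HasFDerivAt u u' p)
    (hv : HasFDerivAt v v' p) :
    ∃ L : H →L[ℝ] ℝ, HasFDerivAt (fun s => G s (u s) (v s)) L p ∧
      ∀ x, L x = G' x (u p) (v p) + G p (u' x) (v p) + G p (u p) (v' x) := by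
  refine ⟨_, (hG.clm_apply hu).clm_apply hv, fun x => ?_⟩
  simp
  ring

/-- The first variation formula: if the `k`-form `φ` is critical on the tangent spaces of the
submanifold `F`, then its exterior derivative is given by the mean curvature. -/
theorem extDeriv_calibration {k : ℕ} {φ : E → E [⋀^Fin k]→L[ℝ] ℝ} {g : E → E →L[ℝ] E →L[ℝ] ℝ}
    {F : H → E} {p : H} (hF : ContDiffAt ℝ 2 F p) (hφ : DifferentiableAt ℝ φ (F p))
    (hg : DifferentiableAt ℝ g (F p)) (a : Fin k → H)
    (hcal : ∀ᶠ s in 𝓝 p, ∀ Y j,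
      ∑ i, g (F s) (fderiv ℝ F s (a j)) (fderiv ℝ F s (a i))
        * φ (F s) (update (fun l => fderiv ℝ F s (a l)) i Y)
      = g (F s) (fderiv ℝ F s (a j)) Y * φ (F s) (fun l => fderiv ℝ F s (a l)))
    {e : Fin k → E} (hea : ∀ i, fderiv ℝ F p (a i) = e i) (he : IsOrtho (lin₂ (g (F p))) e)
    {X : E} (hX : ∀ i, g (F p) (e i) X = 0)
    (hdX : fderiv ℝ φ (F p) X e = 2⁻¹ * φ (F p) e * ∑ i, fderiv ℝ g (F p) X (e i) (e i)) :
    extDeriv φ (F p) (Fin.cons X e) = -φ (F p) e *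
      ∑ j, (g (F p) (fderiv ℝ (fderiv ℝ F) p (a j) (a j)) X + fderiv ℝ g (F p) (e j) (e j) X
        - 2⁻¹ * fderiv ℝ g (F p) X (e j) (e j)) := by
  have hF1 : HasFDerivAt F (fderiv ℝ F p) p := (hF.differentiableAt (by norm_num)).hasFDerivAt
  have hF2 : HasFDerivAt (fderiv ℝ F) (fderiv ℝ (fderiv ℝ F) p) p :=
    ((hF.fderiv_right (m := 1) (by norm_num)).differentiableAt (by norm_num)).hasFDerivAt
  set S := fderiv ℝ (fderiv ℝ F) p with hS
  have hsymm : ∀ u v, S u v = S v u :=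
    hF.isSymmSndFDerivAt (by simp)
  have hT : ∀ i, HasFDerivAt (fun s => fderiv ℝ F s (a i)) (S.flip (a i)) p := fun i => by
    have := hF2.clm_apply (hasFDerivAt_const (a i) p)
    convert this using 1
    ext v
    simp
  have hφF : HasFDerivAt (fun s => φ (F s)) ((fderiv ℝ φ (F p)).comp (fderiv ℝ F p)) p :=
    hφ.hasFDerivAt.comp p hF1
  have hgF : HasFDerivAt (fun s => g (F s)) ((fderiv ℝ g (F p)).comp (fderiv ℝ F p)) p :=
    hg.hasFDerivAt.comp p hF1
  -- The frame is orthonormal at `p` only, so `hcal` expresses criticality at nearby points through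
  -- the Gram matrix, without inverting it. At `p` it reduces to `φ(update e i Y) = g(e i, Y) φ(e)`.
  have hcal0 : ∀ i, φ (F p) (update e i X) = 0 := fun i => by
    have := hcal.self_of_nhds X i
    simp only [hea, hX] at this
    simpa [show ∀ i j, g (F p) (e i) (e j) = if i = j then 1 else 0 from he] using this
  -- the derivative of the form, with one slot replaced by `X`
  have hform : ∀ i, ∃ L : H →L[ℝ] ℝ,
      HasFDerivAt (fun s => φ (F s) (update (fun l => fderiv ℝ F s (a l)) i X)) L p ∧
      ∀ v, L v = fderiv ℝ φ (F p) (fderiv ℝ F p v) (update e i X)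
        + ∑ l, φ (F p) (update (update e i X) l (if l = i then 0 else S v (a l))) := fun i => by
    have hu : ∀ l, HasFDerivAt (fun s => update (fun l => fderiv ℝ F s (a l)) i X l)
        (if l = i then 0 else S.flip (a l)) p := fun l => by
      by_cases h : l = i
      · subst h
        simpa using hasFDerivAt_const X p
      · simpa [h] using hT l
    have := hφF.continuousAlternatingMap_apply hu
    refine ⟨_, this, fun v => ?_⟩
    simp only [hea, add_apply, ContinuousLinearMap.comp_apply, sum_apply]
    congr 1
    refine Finset.sum_congr rfl fun l _ => ?_
    change φ (F p) (update _ l _) = _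
    congr 2
    by_cases h : l = i <;> simp [h]
  choose L hL hLv using hform
  -- Differentiate `hcal` with `Y = X` in the direction `a j`. Derivatives of the Gram matrix drop
  -- out by `hcal0`, orthonormality at `p` leaves only `i = j` on the left, and on the right the
  -- derivative of `φ` is multiplied by `g(e j, X) = 0`.
  have hslot : ∀ j, fderiv ℝ φ (F p) (e j) (update e j X)
      + ∑ l, φ (F p) (update (update e j X) l (if l = j then 0 else S (a j) (a l)))
      = (fderiv ℝ g (F p) (e j) (e j) X + g (F p) (S (a j) (a j)) X) * φ (F p) e := fun j => by
    choose M hM hMv using fun i => hasFDerivAt_metric hgF (hT j) (hT i)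
    obtain ⟨M', hM', hMv'⟩ := hasFDerivAt_metric hgF (hT j) (hasFDerivAt_const X p)
    have h1 := HasFDerivAt.fun_sum (u := Finset.univ) fun i _ => (hM i).mul (hL i)
    have h2 := hM'.mul (hφF.continuousAlternatingMap_apply hT)
    have h3 := h1.unique (h2.congr_of_eventuallyEq (by
      filter_upwards [hcal] with s hs
      exact hs X j))
    have h4 := congrArg (fun L => L (a j)) h3
    have he' : ∀ i j, g (F p) (e i) (e j) = if i = j then 1 else 0 := he
    simp only [hea, hcal0, zero_smul, add_zero, he', hX, zero_add, sum_apply, smul_apply,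
      smul_eq_mul, ite_mul, one_mul, zero_mul, Finset.sum_ite_eq, Finset.mem_univ, if_true,
      hLv, hMv', ContinuousLinearMap.comp_apply, ContinuousLinearMap.flip_apply, zero_apply,
      map_zero] at h4
    rw [h4]
    ring
  -- The second derivative `S` is symmetric, whereas exchanging `j` and `l` interchanges the slots
  -- of `X` and `S (a j) (a l)`. The double sum is therefore its own negative.
  have hskew : ∑ j, ∑ l, φ (F p) (update (update e j X) l (if l = j then 0 else S (a j) (a l)))
      = 0 := by
    have h1 : ∀ j l, φ (F p) (update (update e j X) l (if l = j then 0 else S (a j) (a l)))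
        = -φ (F p) (update (update e l X) j (if j = l then 0 else S (a l) (a j))) := fun j l => by
      by_cases h : l = j
      · subst h
        simp
      · rw [if_neg h, if_neg (Ne.symm h), hsymm (a l) (a j)]
        have := (φ (F p)).toAlternatingMap.map_swap (update (update e l X) j (S (a j) (a l)))
          (i := l) (j := j) h
        simp only [ContinuousAlternatingMap.coe_toAlternatingMap] at this
        rw [← this]
        congr 1
        ext i
        by_cases hi : i = l
        · subst hi
          simp
        · by_cases hj : i = j
          · subst hj
            simp [h, Ne.symm h]
          · simp [Equiv.swap_apply_of_ne_of_ne hi hj, hi, hj]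
    have h2 : ∑ j, ∑ l, φ (F p) (update (update e j X) l (if l = j then 0 else S (a j) (a l)))
        = -∑ j, ∑ l, φ (F p) (update (update e j X) l (if l = j then 0 else S (a j) (a l))) := by
      conv_lhs => rw [Finset.sum_comm]
      simp only [← Finset.sum_neg_distrib]
      exact Finset.sum_congr rfl fun l _ => Finset.sum_congr rfl fun j _ => h1 j l
    linarith
  have hsum := Finset.sum_congr (rfl : (Finset.univ : Finset (Fin k)) = _) fun j _ => hslot j
  rw [Finset.sum_add_distrib, hskew, add_zero, ← Finset.sum_mul] at hsum
  rw [extDeriv_cons hφ, hsum, hdX, Finset.sum_sub_distrib, ← Finset.mul_sum]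
  simp only [Finset.sum_add_distrib]
  ring

end Calibration

/-! ### Gram determinants along a map, and moving normal frames. -/

section NormalFrames

set_option maxSynthPendingDepth 3

open Filter Topology Function

variable {E : Type*} [NormedAddCommGroup E] [NormedSpace ℝ E]
variable {H : Type*} [NormedAddCommGroup H] [NormedSpace ℝ H]

theorem hasFDerivAt_det_of_eq_one {m : ℕ} {M : H → Matrix (Fin m) (Fin m) ℝ} {p : H}
    {M' : Fin m → Fin m → H →L[ℝ] ℝ} (hM : ∀ i j, HasFDerivAt (fun s => M s i j) (M' i j) p)
    (h1 : M p = 1) : HasFDerivAt (fun s => (M s).det) (∑ i, M' i i) p := by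
  let D : (Fin m → ℝ) [⋀^Fin m]→L[ℝ] ℝ :=
    { Matrix.detRowAlternating (R := ℝ) (n := Fin m) with
      cont := by
        change Continuous fun A : Matrix (Fin m) (Fin m) ℝ => A.det
        exact continuous_id.matrix_det }
  have hrow : ∀ i, HasFDerivAt (fun s => M s i) (ContinuousLinearMap.pi (M' i)) p := fun i =>
    hasFDerivAt_pi.2 fun j => hM i j
  have h := (hasFDerivAt_const D p).continuousAlternatingMap_apply hrow
  refine h.congr_fderiv ?_
  ext v
  have h2 := sum_det_updateRow_one (Matrix.of fun i j => M' i j v)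
  simp only [ContinuousLinearMap.comp_zero, zero_add, sum_apply,
    ContinuousLinearMap.comp_apply]
  rw [Matrix.trace] at h2
  refine Eq.trans ?_ h2
  refine Finset.sum_congr rfl fun i _ => ?_
  rw [← h1]
  rfl

theorem gram_eq_one {ι : Type*} [DecidableEq ι] {V : Type*} [AddCommGroup V] [Module ℝ V]
    {g : V →ₗ[ℝ] V →ₗ[ℝ] ℝ} {f : ι → V} (hf : IsOrtho g f) : gram g f = 1 := by
  ext i j
  simp [gram, hf i j, Matrix.one_apply]

/-- At an orthonormal frame the Gram matrix is the identity, where the derivative of the determinant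
is the trace. -/
theorem hasFDerivAt_det_gram {m : ℕ} {G : H → E →L[ℝ] E →L[ℝ] ℝ}
    {G' : H →L[ℝ] E →L[ℝ] E →L[ℝ] ℝ} {p : H} (hG : HasFDerivAt G G' p)
    (symm : ∀ u v, G p u v = G p v u) {ν : Fin m → H → E}
    {ν' : Fin m → H →L[ℝ] E} (hν : ∀ i, HasFDerivAt (ν i) (ν' i) p)
    (hf : IsOrtho (lin₂ (G p)) (fun i => ν i p)) :
    ∃ L : H →L[ℝ] ℝ, HasFDerivAt (fun s => (gram (lin₂ (G s)) (fun i => ν i s)).det) L p ∧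
      ∀ x, L x = ∑ i, (G' x (ν i p) (ν i p) + 2 * G p (ν i p) (ν' i x)) := by
  choose M hM hMv using fun i j => hasFDerivAt_metric hG (hν i) (hν j)
  refine ⟨_, hasFDerivAt_det_of_eq_one (fun i j => hM i j) (gram_eq_one hf), fun x => ?_⟩
  rw [sum_apply]
  refine Finset.sum_congr rfl fun i _ => ?_
  rw [hMv, symm (ν' i x)]
  ring

/-- The norm of a form of type `ω_𝔤` on moving 3-dimensional subalgebras is constant to first
order. -/
theorem hasFDerivAt_sq_sub {g : E → E →L[ℝ] E →L[ℝ] ℝ} {w : E → E [⋀^Fin 3]→L[ℝ] ℝ} {y : H → E}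
    {p : H} (hy : DifferentiableAt ℝ y p) (hg : DifferentiableAt ℝ g (y p))
    (hw : DifferentiableAt ℝ w (y p)) (symm : ∀ u v, g (y p) u v = g (y p) v u)
    {ν : Fin 3 → H → E} (hν : ∀ i, DifferentiableAt ℝ (ν i) p) {f : Fin 3 → E}
    (hνf : ∀ i, ν i p = f i) (hf : IsOrtho (lin₂ (g (y p))) f)
    (hcrit : ∀ i Y, w (y p) (update f i Y) = w (y p) f * g (y p) (f i) Y)
    (hvar : ∀ X, fderiv ℝ w (y p) X f
      = 2⁻¹ * w (y p) f * ∑ i, fderiv ℝ g (y p) X (f i) (f i)) :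
    HasFDerivAt (fun s => w (y s) (fun i => ν i s) ^ 2
      - w (y p) f ^ 2 * (gram (lin₂ (g (y s))) (fun i => ν i s)).det) (0 : H →L[ℝ] ℝ) p := by
  have hf' : (fun i => ν i p) = f := funext hνf
  have hG := hg.hasFDerivAt.comp p hy.hasFDerivAt
  have hW := (hw.hasFDerivAt.comp p hy.hasFDerivAt).continuousAlternatingMap_apply
    (fun i => (hν i).hasFDerivAt)
  obtain ⟨L, hL, hLv⟩ := hasFDerivAt_det_gram hG symm (fun i => (hν i).hasFDerivAt)
    (by rw [hf']; exact hf)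
  refine ((hW.pow 2).sub (hL.const_mul (w (y p) f ^ 2))).congr_fderiv ?_
  ext x
  simp only [Function.comp_apply, sub_apply, smul_apply, add_apply, sum_apply,
    ContinuousLinearMap.comp_apply, hLv, smul_eq_mul, zero_apply, hνf]
  change _ * (fderiv ℝ w (y p) (fderiv ℝ y p x) f
    + ∑ i, w (y p) (update f i (fderiv ℝ (ν i) p x))) - _ = 0
  -- Criticality turns the effect of moving the frame into `w(f) ∑ g(f i, ν' i)`, and `hvar` gives
  -- the effect of moving the base point. Together they match the derivative of the Gram
  -- determinant.
  simp only [hcrit, hvar, ← Finset.mul_sum, Finset.sum_add_distrib]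
  simp
  ring

/-- A moving frame of normal vectors. -/
theorem exists_normal_frame [FiniteDimensional ℝ E] {k m : ℕ} {G : H → E →L[ℝ] E →L[ℝ] ℝ} {p : H}
    (hG : DifferentiableAt ℝ G p) {T : Fin k → H → E}
    (hT : ∀ i, DifferentiableAt ℝ (T i) p) (hTo : IsOrtho (lin₂ (G p)) (fun i => T i p))
    {f : Fin m → E} (hf : ∀ i j, G p (f i) (T j p) = 0) :
    ∃ ν : Fin m → H → E, (∀ i, DifferentiableAt ℝ (ν i) p) ∧ (∀ i, ν i p = f i) ∧
      ∀ᶠ s in 𝓝 p, ∀ i j, G s (ν i s) (T j s) = 0 := by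
  have : CompleteSpace E := FiniteDimensional.complete ℝ E
  -- `A s` is the identity at `p`. Since the `T j p` are orthonormal, `G p (A s v) (T j p) = G s v
  -- (T j s)`, so the inverse of `A s` carries vectors normal at `p` to vectors normal at `s`.
  let A : H → E →L[ℝ] E := fun s => ContinuousLinearMap.id ℝ E
    + ∑ j, ((G s).flip (T j s) - (G p).flip (T j p)).smulRight (T j p)
  have hAd : DifferentiableAt ℝ A p := by
    have hd : ∀ j, DifferentiableAt ℝ (fun s => (G s).flip (T j s)) p := fun j => by
      have h1 : DifferentiableAt ℝ (fun s => (G s).flip) p :=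
        (ContinuousLinearMap.flipₗᵢ ℝ E E ℝ).toContinuousLinearEquiv.differentiableAt.comp p hG
      exact h1.clm_apply (hT j)
    refine (differentiableAt_const _).add (DifferentiableAt.fun_sum fun j _ => ?_)
    exact (ContinuousLinearMap.smulRightL ℝ E E).flip (T j p) |>.differentiableAt.comp p
      ((hd j).sub_const _)
  have hAp : A p = ContinuousLinearMap.id ℝ E := by simp [A]
  let e : E ≃L[ℝ] E := ContinuousLinearEquiv.refl ℝ E
  have he : (e : E →L[ℝ] E) = A p := by rw [hAp]; rfl
  have hinv : DifferentiableAt ℝ (fun s => (A s).inverse) p := by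
    have h : DifferentiableAt ℝ ContinuousLinearMap.inverse (A p) := by
      rw [← he]
      exact (contDiffAt_map_inverse (n := 1) e).differentiableAt (by simp)
    exact DifferentiableAt.comp (g := ContinuousLinearMap.inverse) p h hAd
  have hev : ∀ᶠ s in 𝓝 p, ∀ v, A s ((A s).inverse v) = v := by
    have := hAd.continuousAt.eventually (by rw [← he]; exact ContinuousLinearEquiv.nhds e)
    filter_upwards [this] with s ⟨e', hs⟩ v
    rw [← hs]
    simp
  refine ⟨fun i s => (A s).inverse (f i), fun i => hinv.clm_apply (differentiableAt_const _),
    fun i => ?_, ?_⟩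
  · have := hev.self_of_nhds (f i)
    rw [hAp] at this
    change (A p).inverse (f i) = f i
    rw [hAp]
    exact this
  · filter_upwards [hev] with s hs i j
    have h1 := congrArg (fun v => G p v (T j p)) (hs (f i))
    have hTo' : ∀ i j, G p (T i p) (T j p) = if i = j then 1 else 0 := hTo
    simpa [A, hf, hTo'] using h1

end NormalFrames

/-! ### Linear algebra of the Hodge star of a 3-form. -/

section HodgeStar

set_option maxSynthPendingDepth 3

open Function

variable {V : Type*} [AddCommGroup V] [Module ℝ V]

open Matrix in
theorem isLinearMap_vecCons {m : ℕ} (α : V [⋀^Fin (m + 1)]→ₗ[ℝ] ℝ) (v : Fin m → V) :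
    IsLinearMap ℝ fun a => α (vecCons a v) :=
  ⟨fun a b => congrArg (fun β => β v) (α.curryLeft.map_add a b),
    fun a b => congrArg (fun β => β v) (α.curryLeft.map_smul a b)⟩

open Matrix in
theorem isLinearMap_vecCons₂ {m : ℕ} (α : V [⋀^Fin (m + 2)]→ₗ[ℝ] ℝ) (b : V) (v : Fin m → V) :
    IsLinearMap ℝ fun a => α (vecCons b (vecCons a v)) :=
  isLinearMap_vecCons (α.curryLeft b) v

open Matrix in
theorem isLinearMap_vecCons₃ {m : ℕ} (α : V [⋀^Fin (m + 3)]→ₗ[ℝ] ℝ) (b c : V) (v : Fin m → V) :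
    IsLinearMap ℝ fun a => α (vecCons b (vecCons c (vecCons a v))) :=
  isLinearMap_vecCons₂ (α.curryLeft b) c v

/-- The two families of pairs represent the same element of `V ⊗ V`. -/
def SamePairing {ι κ : Type*} [Fintype ι] [Fintype κ] (x x' : ι → V) (y y' : κ → V) : Prop :=
  ∀ ψ : V → V → ℝ, (∀ v, IsLinearMap ℝ (fun u => ψ u v)) → (∀ u, IsLinearMap ℝ (ψ u)) →
    ∑ i, ψ (x i) (x' i) = ∑ j, ψ (y j) (y' j)

open Matrix in
-- The triple sum is bilinear in each of the three pairs, so the families are exchanged one pair at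
-- a time, the innermost first.
theorem SamePairing.sum₃ {ι κ : Type*} [Fintype ι] [Fintype κ] {x x' : ι → V} {y y' : κ → V}
    (h : SamePairing x x' y y') {k m : ℕ} (α : V [⋀^Fin (m + 3)]→ₗ[ℝ] ℝ)
    (β : V [⋀^Fin (k + 3)]→ₗ[ℝ] ℝ) (u : Fin m → V) (v : Fin k → V) :
    ∑ i, ∑ j, ∑ l, α (vecCons (x i) (vecCons (x j) (vecCons (x l) u)))
        * β (vecCons (x' i) (vecCons (x' j) (vecCons (x' l) v)))
      = ∑ i, ∑ j, ∑ l, α (vecCons (y i) (vecCons (y j) (vecCons (y l) u)))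
        * β (vecCons (y' i) (vecCons (y' j) (vecCons (y' l) v))) := by
  have e3 : ∀ a b a' b', ∑ l, α (vecCons a (vecCons b (vecCons (x l) u)))
        * β (vecCons a' (vecCons b' (vecCons (x' l) v)))
      = ∑ l, α (vecCons a (vecCons b (vecCons (y l) u)))
        * β (vecCons a' (vecCons b' (vecCons (y' l) v))) := fun a b a' b' =>
    h (fun s t => α (vecCons a (vecCons b (vecCons s u)))
        * β (vecCons a' (vecCons b' (vecCons t v))))
      (fun t => ⟨fun s s' => by rw [(isLinearMap_vecCons₃ α a b u).1, add_mul],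
        fun r s => by rw [(isLinearMap_vecCons₃ α a b u).2, smul_eq_mul, smul_eq_mul, mul_assoc]⟩)
      (fun t => ⟨fun s s' => by rw [(isLinearMap_vecCons₃ β a' b' v).1, mul_add],
        fun r s => by
          rw [(isLinearMap_vecCons₃ β a' b' v).2, smul_eq_mul, smul_eq_mul, mul_left_comm]⟩)
  have e2 : ∀ a a', ∑ j, ∑ l, α (vecCons a (vecCons (x j) (vecCons (y l) u)))
        * β (vecCons a' (vecCons (x' j) (vecCons (y' l) v)))
      = ∑ j, ∑ l, α (vecCons a (vecCons (y j) (vecCons (y l) u)))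
        * β (vecCons a' (vecCons (y' j) (vecCons (y' l) v))) := fun a a' =>
    h (fun s t => ∑ l, α (vecCons a (vecCons s (vecCons (y l) u)))
        * β (vecCons a' (vecCons t (vecCons (y' l) v))))
      (fun t => ⟨fun s s' => by
          simp only [(isLinearMap_vecCons₂ α a _).1, add_mul, Finset.sum_add_distrib],
        fun r s => by
          simp only [(isLinearMap_vecCons₂ α a _).2, smul_eq_mul, mul_assoc, Finset.mul_sum]⟩)
      (fun t => ⟨fun s s' => by
          simp only [(isLinearMap_vecCons₂ β a' _).1, mul_add, Finset.sum_add_distrib],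
        fun r s => by
          simp only [(isLinearMap_vecCons₂ β a' _).2, smul_eq_mul, mul_left_comm _ r,
            Finset.mul_sum]⟩)
  simp only [e3, e2]
  exact h (fun s t => ∑ j, ∑ l, α (vecCons s (vecCons (y j) (vecCons (y l) u)))
        * β (vecCons t (vecCons (y' j) (vecCons (y' l) v))))
      (fun t => ⟨fun s s' => by
          simp only [(isLinearMap_vecCons α _).1, add_mul, Finset.sum_add_distrib],
        fun r s => by
          simp only [(isLinearMap_vecCons α _).2, smul_eq_mul, mul_assoc, Finset.mul_sum]⟩)
      (fun t => ⟨fun s s' => by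
          simp only [(isLinearMap_vecCons β _).1, mul_add, Finset.sum_add_distrib],
        fun r s => by
          simp only [(isLinearMap_vecCons β _).2, smul_eq_mul, mul_left_comm _ r,
            Finset.mul_sum]⟩)

open Matrix in
/-- The value of the Hodge star of the 3-form `w` on `v`, computed in the family `b`. -/
def starSum {ι : Type*} [Fintype ι] {k : ℕ} (b : ι → V) (w : V [⋀^Fin 3]→ₗ[ℝ] ℝ)
    (μ : V [⋀^Fin (k + 3)]→ₗ[ℝ] ℝ) (v : Fin k → V) : ℝ :=
  6⁻¹ * ∑ i, ∑ j, ∑ l, w ![b i, b j, b l] * μ (vecCons (b i) (vecCons (b j) (vecCons (b l) v)))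

/-- The tensor `∑ b i ⊗ b i` is the inverse metric and does not depend on the orthonormal basis. The
Hodge star may thus be evaluated in a basis adapted to any given splitting. -/
theorem starSum_congr {ι κ : Type*} [Fintype ι] [DecidableEq ι] [Fintype κ] [DecidableEq κ]
    {g : V →ₗ[ℝ] V →ₗ[ℝ] ℝ} {b : ι → V} {c : κ → V} (hb : IsOrtho g b) (hc : IsOrtho g c)
    (hbs : ⊤ ≤ Submodule.span ℝ (Set.range b)) (hcs : ⊤ ≤ Submodule.span ℝ (Set.range c))
    (symm : ∀ u v, g u v = g v u) {k : ℕ} (w : V [⋀^Fin 3]→ₗ[ℝ] ℝ)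
    (μ : V [⋀^Fin (k + 3)]→ₗ[ℝ] ℝ) (v : Fin k → V) : starSum b w μ v = starSum c w μ v := by
  have h : SamePairing b b c c := fun ψ h1 h2 =>
    sum_orthonormal_congr hb hc hbs hcs symm ψ h1 h2
  exact congrArg (6⁻¹ * ·) (h.sum₃ (m := 0) w μ ![] v)

/-- Only triples of distinct members of `f` survive, and these are the six permutations of one
triple. -/
theorem sum₃_eq_of_symmetric {V : Type*} {k : ℕ} {f : Fin 3 → V} {e : Fin k → V} (S : V → V → V → ℝ)
    (s1 : ∀ x y z, S y x z = S x y z) (s2 : ∀ x y z, S x z y = S x y z) (s0 : ∀ x z, S x x z = 0)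
    (he : ∀ a x y, S (e a) (Sum.elim f e x) (Sum.elim f e y) = 0) :
    ∑ i, ∑ j, ∑ l, S (Sum.elim f e i) (Sum.elim f e j) (Sum.elim f e l)
      = 6 * S (f 0) (f 1) (f 2) := by
  have a1 : ∀ a i j, S (e a) (f i) (f j) = 0 := fun a i j => he a (Sum.inl i) (Sum.inl j)
  have a2 : ∀ a i j, S (e a) (e i) (f j) = 0 := fun a i j => he a (Sum.inr i) (Sum.inl j)
  have a3 : ∀ a i j, S (e a) (f i) (e j) = 0 := fun a i j => he a (Sum.inl i) (Sum.inr j)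
  have a4 : ∀ a i j, S (e a) (e i) (e j) = 0 := fun a i j => he a (Sum.inr i) (Sum.inr j)
  have a5 : ∀ a i j, S (f i) (e a) (f j) = 0 := fun a i j => by rw [s1, a1]
  have a6 : ∀ a i j, S (f i) (e a) (e j) = 0 := fun a i j => by rw [s1, a3]
  have a7 : ∀ a i j, S (f i) (f j) (e a) = 0 := fun a i j => by rw [s2, a5]
  have s0' : ∀ x z, S x z x = 0 := fun x z => by rw [s2, s0]
  have s0'' : ∀ x z, S z x x = 0 := fun x z => by rw [s1, s0']
  simp only [Fintype.sum_sum_type, Sum.elim_inl, Sum.elim_inr, a1, a2, a3, a4, a5, a6, a7,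
    Finset.sum_const_zero, add_zero, Fin.sum_univ_three, s0, s0', s0'', zero_add]
  rw [s2 (f 0) (f 1) (f 2), s1 (f 0) (f 1) (f 2), s2 (f 1) (f 0) (f 2), s1 (f 0) (f 1) (f 2),
    s1 (f 0) (f 2) (f 1), s2 (f 0) (f 1) (f 2), s2 (f 2) (f 0) (f 1), s1 (f 0) (f 2) (f 1),
    s2 (f 0) (f 1) (f 2)]
  ring

open Matrix in
theorem map_vecCons_swap₀₁ {k : ℕ} (μ : V [⋀^Fin (k + 3)]→ₗ[ℝ] ℝ) (a b c : V) (v : Fin k → V) :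
    μ (vecCons b (vecCons a (vecCons c v))) = -μ (vecCons a (vecCons b (vecCons c v))) := by
  rw [← μ.map_swap (vecCons a (vecCons b (vecCons c v))) (i := 0) (j := 1) (by simp)]
  congr 1
  ext i
  refine Fin.cases rfl (fun i => Fin.cases rfl (fun i => ?_) i) i
  rw [Function.comp_apply, Equiv.swap_apply_of_ne_of_ne]
  · rfl
  · exact Fin.succ_ne_zero _
  · exact fun h => Fin.succ_ne_zero _ (Fin.succ_injective _ h)

open Matrix in
theorem map_vecCons_swap₁₂ {k : ℕ} (μ : V [⋀^Fin (k + 3)]→ₗ[ℝ] ℝ) (a b c : V) (v : Fin k → V) :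
    μ (vecCons a (vecCons c (vecCons b v))) = -μ (vecCons a (vecCons b (vecCons c v))) := by
  rw [← μ.map_swap (vecCons a (vecCons b (vecCons c v))) (i := 1) (j := 2)
    (by simp [Fin.ext_iff, Nat.mod_eq_of_lt])]
  congr 1
  ext i
  refine Fin.cases rfl (fun i => Fin.cases rfl (fun i => Fin.cases rfl (fun i => ?_) i) i) i
  rw [Function.comp_apply, Equiv.swap_apply_of_ne_of_ne]
  · rfl
  · exact fun h => Fin.succ_ne_zero _ (Fin.succ_injective _ h)
  · exact fun h => Fin.succ_ne_zero _ (Fin.succ_injective _ (Fin.succ_injective _ h))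

open Matrix in
-- As a product of two alternating expressions the summand is symmetric in the three basis vectors,
-- so `sum₃_eq_of_symmetric` applies and its factor `6` cancels the normalisation.
theorem starSum_eq_of_vanish {k : ℕ} {f : Fin 3 → V} {e : Fin k → V} (w : V [⋀^Fin 3]→ₗ[ℝ] ℝ)
    (μ : V [⋀^Fin (k + 3)]→ₗ[ℝ] ℝ) (v : Fin k → V)
    (h : ∀ a x y, w ![e a, Sum.elim f e x, Sum.elim f e y]
      * μ (vecCons (e a) (vecCons (Sum.elim f e x) (vecCons (Sum.elim f e y) v))) = 0) :
    starSum (Sum.elim f e) w μ v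
      = w f * μ (vecCons (f 0) (vecCons (f 1) (vecCons (f 2) v))) := by
  rw [starSum, sum₃_eq_of_symmetric (S := fun a b c => w ![a, b, c]
    * μ (vecCons a (vecCons b (vecCons c v)))) _ _ _ h]
  · rw [show (![f 0, f 1, f 2] : Fin 3 → V) = f by ext i; fin_cases i <;> rfl]
    ring
  · intro x y z
    rw [map_swap₀₁ w x y z, map_vecCons_swap₀₁ μ x y z v, neg_mul_neg]
  · intro x y z
    rw [map_swap₁₂ w x y z, map_vecCons_swap₁₂ μ x y z v, neg_mul_neg]
  · intro x z
    rw [w.map_eq_zero_of_eq _ (i := 0) (j := 1) rfl (by decide), zero_mul]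

theorem map_eq_zero_of_finrank_add_lt {ι : Type*} [Fintype ι] [DecidableEq ι]
    (φ : V [⋀^ι]→ₗ[ℝ] ℝ) (v : ι → V) (S : Submodule ℝ V) [FiniteDimensional ℝ S] (C : Finset ι)
    (hC : ∀ j ∉ C, v j ∈ S) (h : finrank ℝ S + C.card < Fintype.card ι) : φ v = 0 := by
  refine map_eq_zero_of_finrank_lt φ v S Cᶜ (fun j hj => hC j (by simpa using hj)) ?_
  rw [Finset.card_compl]
  omega

theorem finrank_span_of_isOrtho {m : ℕ} {g : V →ₗ[ℝ] V →ₗ[ℝ] ℝ} {f : Fin m → V}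
    (hf : IsOrtho g f) : finrank ℝ (Submodule.span ℝ (Set.range f)) = m := by
  rw [finrank_span_eq_card hf.linearIndependent, Fintype.card_fin]

/-- On an orthonormal basis `e` of a subspace, the Hodge star is given by the value of the 3-form on
an orthonormal basis of the orthogonal complement. -/
theorem starSum_self {k : ℕ} {f : Fin 3 → V} {e : Fin k → V} (w : V [⋀^Fin 3]→ₗ[ℝ] ℝ)
    (μ : V [⋀^Fin (k + 3)]→ₗ[ℝ] ℝ) :
    starSum (Sum.elim f e) w μ e
      = w f * μ (Matrix.vecCons (f 0) (Matrix.vecCons (f 1) (Matrix.vecCons (f 2) e))) := by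
  refine starSum_eq_of_vanish w μ e fun a x y => ?_
  rw [μ.map_eq_zero_of_eq _ (i := 0) (j := a.succ.succ.succ) (by simp) (Fin.succ_ne_zero _).symm,
    mul_zero]

/-- The Hodge star of a 3-form is critical on the orthogonal complements of subalgebras. -/
theorem starSum_update_eq_zero {k : ℕ} {g : V →ₗ[ℝ] V →ₗ[ℝ] ℝ} {f : Fin 3 → V} {e : Fin k → V}
    (hf : IsOrtho g f) (he : IsOrtho g e) (w : V [⋀^Fin 3]→ₗ[ℝ] ℝ) (μ : V [⋀^Fin (k + 3)]→ₗ[ℝ] ℝ)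
    (hw : ∀ a i j, w ![e a, f i, f j] = 0) {T : Fin k → V}
    (hT : ∀ i, T i ∈ Submodule.span ℝ (Set.range e)) (i : Fin k) {Y : V}
    (hY : Y ∈ Submodule.span ℝ (Set.range f)) :
    starSum (Sum.elim f e) w μ (update T i Y) = 0 := by
  have hfm : ∀ j, f j ∈ Submodule.span ℝ (Set.range f) := fun j => Submodule.subset_span ⟨j, rfl⟩
  have hem : ∀ j, e j ∈ Submodule.span ℝ (Set.range e) := fun j => Submodule.subset_span ⟨j, rfl⟩
  have hfd : FiniteDimensional ℝ (Submodule.span ℝ (Set.range f)) :=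
    FiniteDimensional.span_of_finite ℝ (Set.finite_range f)
  have hfe : FiniteDimensional ℝ (Submodule.span ℝ (Set.range e)) :=
    FiniteDimensional.span_of_finite ℝ (Set.finite_range e)
  rw [starSum_eq_of_vanish w μ]
  -- The surviving term has four arguments, `f 0`, `f 1`, `f 2` and `Y`, in the 3-dimensional span
  -- of `f`. The exceptional slots are the `k - 1` slots of the remaining `T j`.
  · rw [map_eq_zero_of_finrank_add_lt μ _ (Submodule.span ℝ (Set.range f))
      ((Finset.univ.erase i).image fun j : Fin k => j.succ.succ.succ), mul_zero]
    · intro j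
      refine Fin.cases (fun _ => hfm 0) (fun j => ?_) j
      refine Fin.cases (fun _ => hfm 1) (fun j => ?_) j
      refine Fin.cases (fun _ => hfm 2) (fun j hj => ?_) j
      have : j = i := by
        by_contra h
        exact hj (Finset.mem_image_of_mem _ (Finset.mem_erase.2 ⟨h, Finset.mem_univ _⟩))
      subst this
      simpa using hY
    · have h1 := Finset.card_image_le (s := Finset.univ.erase i)
        (f := fun j : Fin k => j.succ.succ.succ)
      have h2 := Finset.card_erase_add_one (Finset.mem_univ i)
      rw [Finset.card_univ, Fintype.card_fin] at h2
      rw [finrank_span_of_isOrtho hf, Fintype.card_fin]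
      omega
  -- If at least two of the three basis vectors come from `e`, then together with the `k - 1`
  -- remaining `T j` there are `k + 1` arguments in the `k`-dimensional span of `e`. At most two
  -- slots are exceptional: that of `Y` and one of the basis vectors. One vector from `e` and two
  -- from `f` is the case excluded by `hw`.
  · have key : ∀ a x y, (Sum.elim f e x ∈ Submodule.span ℝ (Set.range e) ∨
        Sum.elim f e y ∈ Submodule.span ℝ (Set.range e)) →
        μ (Matrix.vecCons (e a) (Matrix.vecCons (Sum.elim f e x)
          (Matrix.vecCons (Sum.elim f e y) (update T i Y)))) = 0 := by
      intro a x y hxy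
      obtain ⟨c, hc⟩ : ∃ c : Fin 2, ∀ d : Fin 2, d ≠ c →
          ![Sum.elim f e x, Sum.elim f e y] d ∈ Submodule.span ℝ (Set.range e) := by
        rcases hxy with h | h
        · refine ⟨1, fun d hd => ?_⟩
          fin_cases d
          · exact h
          · exact absurd rfl hd
        · refine ⟨0, fun d hd => ?_⟩
          fin_cases d
          · exact absurd rfl hd
          · exact h
      refine map_eq_zero_of_finrank_add_lt μ _ (Submodule.span ℝ (Set.range e))
        {(c.castLE (by omega) : Fin (k + 2)).succ, i.succ.succ.succ} ?_ ?_
      · intro j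
        refine Fin.cases (fun _ => hem a) (fun j => ?_) j
        refine Fin.cases (fun hj => ?_) (fun j => ?_) j
        · refine hc 0 fun h => hj ?_
          simp [← h]
        refine Fin.cases (fun hj => ?_) (fun j hj => ?_) j
        · refine hc 1 fun h => hj ?_
          simp only [← h, Finset.mem_insert]
          exact Or.inl rfl
        · have : j ≠ i := by
            rintro rfl
            simp at hj
          simpa [this] using hT j
      · rw [finrank_span_of_isOrtho he, Fintype.card_fin]
        have := Finset.card_le_two (a := (c.castLE (by omega) : Fin (k + 2)).succ)
          (b := i.succ.succ.succ)
        omega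
    rintro a (x | x) (y | y)
    · rw [Sum.elim_inl, Sum.elim_inl, hw, zero_mul]
    · rw [key a (Sum.inl x) (Sum.inr y) (Or.inr (hem y)), mul_zero]
    · rw [key a (Sum.inr x) (Sum.inl y) (Or.inl (hem x)), mul_zero]
    · rw [key a (Sum.inr x) (Sum.inr y) (Or.inl (hem x)), mul_zero]

end HodgeStar

/-! ### Orthonormal bases adapted to a subspace and its orthogonal complement. -/

section AdaptedBases

open Function

variable {V : Type*} [AddCommGroup V] [Module ℝ V]

theorem IsOrtho.comp {ι κ : Type*} [DecidableEq ι] [DecidableEq κ] {g : V →ₗ[ℝ] V →ₗ[ℝ] ℝ}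
    {b : ι → V} (hb : IsOrtho g b) {σ : κ → ι} (hσ : Injective σ) :
    IsOrtho g fun i => b (σ i) := fun i j => by
  rw [hb]
  simp [hσ.eq_iff]

theorem IsOrtho.inl {k m : ℕ} {g : V →ₗ[ℝ] V →ₗ[ℝ] ℝ} {f : Fin m → V} {e : Fin k → V}
    (h : IsOrtho g (Sum.elim f e)) : IsOrtho g f := h.comp Sum.inl_injective

theorem IsOrtho.inr {k m : ℕ} {g : V →ₗ[ℝ] V →ₗ[ℝ] ℝ} {f : Fin m → V} {e : Fin k → V}
    (h : IsOrtho g (Sum.elim f e)) : IsOrtho g e := h.comp Sum.inr_injective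

open Matrix in
theorem IsOrtho.vecCons₃ {k : ℕ} {g : V →ₗ[ℝ] V →ₗ[ℝ] ℝ} {f : Fin 3 → V} {e : Fin k → V}
    (h : IsOrtho g (Sum.elim f e)) :
    IsOrtho g (vecCons (f 0) (vecCons (f 1) (vecCons (f 2) e))) := by
  let σ : Fin (k + 3) → Fin 3 ⊕ Fin k :=
    vecCons (Sum.inl 0) (vecCons (Sum.inl 1) (vecCons (Sum.inl 2) Sum.inr))
  have hσ : Injective σ := by
    simp only [σ, Matrix.vecCons, Fin.cons_injective_iff]
    simp [Sum.inr_injective]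
  have h1 := h.comp hσ
  convert h1 using 1
  ext i
  refine Fin.cases rfl (fun i => Fin.cases rfl (fun i => Fin.cases rfl (fun i => rfl) i) i) i

theorem exists_adapted_basis [FiniteDimensional ℝ V] (B : V →ₗ[ℝ] V →ₗ[ℝ] ℝ)
    (symm : ∀ u v, B u v = B v u) (pos : ∀ u, u ≠ 0 → 0 < B u u) {k m : ℕ} (T : Submodule ℝ V)
    (hT : finrank ℝ T = k) (hV : finrank ℝ V = k + m) :
    ∃ (f : Fin m → V) (e : Fin k → V), IsOrtho B (Sum.elim f e) ∧
      Submodule.span ℝ (Set.range e) = T ∧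
      (∀ v, v ∈ Submodule.span ℝ (Set.range f) ↔ ∀ u ∈ T, B v u = 0) ∧
      ⊤ ≤ Submodule.span ℝ (Set.range (Sum.elim f e)) := by
  let P : Submodule ℝ V :=
    { carrier := {v | ∀ u ∈ T, B v u = 0}
      add_mem' := fun ha hb u hu => by simp [ha u hu, hb u hu]
      zero_mem' := fun u _ => by simp
      smul_mem' := fun c a ha u hu => by simp [ha u hu] }
  have hTP : IsCompl T P := by
    constructor
    · rw [Submodule.disjoint_def]
      intro x hx hx'
      by_contra h
      exact (pos x h).ne' (hx' x hx)
    · rw [codisjoint_iff, eq_top_iff]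
      intro v _
      obtain ⟨v', h1, h2⟩ := exists_normal_part B pos T v
      rw [← sub_add_cancel v v']
      exact Submodule.add_mem_sup h1 h2
  have hP : finrank ℝ P = m := by
    have := Submodule.finrank_add_eq_of_isCompl hTP
    omega
  obtain ⟨e, he⟩ := exists_orthonormal_basis (B.domRestrict₁₂ T T) (fun u v => symm u v)
    (fun u hu => pos u (by simpa using hu)) hT
  obtain ⟨f, hf⟩ := exists_orthonormal_basis (B.domRestrict₁₂ P P) (fun u v => symm u v)
    (fun u hu => pos u (by simpa using hu)) hP
  have hspan : ∀ (S : Submodule ℝ V) (r : ℕ) (b : Basis (Fin r) ℝ S),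
      Submodule.span ℝ (Set.range fun i => (b i : V)) = S := fun S r b => by
    have : (Set.range fun i => (b i : V)) = S.subtype '' Set.range b := by
      rw [← Set.range_comp]; rfl
    rw [this, Submodule.span_image, b.span_eq, Submodule.map_top, Submodule.range_subtype]
  refine ⟨fun i => f i, fun i => e i, ?_, hspan T k e, fun v => ?_, ?_⟩
  · rintro (i | i) (j | j)
    · exact (hf i j).trans (by simp)
    · simpa using (f i).2 _ (e j).2
    · rw [symm]
      simpa using (f j).2 _ (e i).2
    · exact (he i j).trans (by simp)
  · rw [hspan P m f]
    rfl
  · rw [Set.Sum.elim_range, Submodule.span_union, hspan P m f, hspan T k e, sup_comm,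
      codisjoint_iff.1 hTP.codisjoint]

open Matrix in
-- On orthonormal bases of complementary subspaces `φ e = ± w f`. Squaring removes the sign of the
-- volume form, and the Gram determinants allow arbitrary families in place of `f` and `e`, which
-- can then be moved and differentiated.
theorem star_sq_eq {k : ℕ} {g : V →ₗ[ℝ] V →ₗ[ℝ] ℝ} {f : Fin 3 → V} {e : Fin k → V}
    (h : IsOrtho g (Sum.elim f e)) {w : V [⋀^Fin 3]→ₗ[ℝ] ℝ} {μ : V [⋀^Fin (k + 3)]→ₗ[ℝ] ℝ}
    (hμ : ∀ b, IsOrtho g b → μ b ^ 2 = 1) {φ : V [⋀^Fin k]→ₗ[ℝ] ℝ}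
    (hφ : ∀ v, φ v = starSum (Sum.elim f e) w μ v) {ν : Fin 3 → V} {T : Fin k → V}
    (hν : ∀ i, ν i ∈ Submodule.span ℝ (Set.range f))
    (hT : ∀ i, T i ∈ Submodule.span ℝ (Set.range e)) :
    φ T ^ 2 * (gram g ν).det = w ν ^ 2 * (gram g T).det := by
  rw [map_sq_eq φ h.inr hT, map_sq_eq w h.inl hν, hφ e, starSum_self, mul_pow, hμ _ h.vecCons₃]
  ring

end AdaptedBases

/-! ### First variation and differentiability of the Hodge star. -/

section StarVariation

set_option maxSynthPendingDepth 3

open Function Filter Topology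

variable {E : Type*} [NormedAddCommGroup E] [NormedSpace ℝ E] [FiniteDimensional ℝ E]

/-- Differentiate `hsq` along a moving normal frame `ν`. By `hasFDerivAt_sq_sub` the square of `w`
on `ν` is stationary relative to the Gram determinant of `ν`, so the square of `φ` on `e` is
stationary relative to that of `e`. Dividing by `φ q e` gives the claim. -/
theorem fderiv_star {k : ℕ} {g : E → E →L[ℝ] E →L[ℝ] ℝ} {w : E → E [⋀^Fin 3]→L[ℝ] ℝ}
    {φ : E → E [⋀^Fin k]→L[ℝ] ℝ} {q : E} (hg : DifferentiableAt ℝ g q)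
    (hw : DifferentiableAt ℝ w q) (hφ : DifferentiableAt ℝ φ q)
    (symm : ∀ u v, g q u v = g q v u) {f : Fin 3 → E} {e : Fin k → E}
    (hfe : IsOrtho (lin₂ (g q)) (Sum.elim f e))
    (hcrit : ∀ i Y, w q (update f i Y) = w q f * g q (f i) Y)
    (hvar : ∀ X, fderiv ℝ w q X f = 2⁻¹ * w q f * ∑ i, fderiv ℝ g q X (f i) (f i))
    (hsq : ∀ᶠ y in 𝓝 q, ∀ ν : Fin 3 → E, (∀ i j, g y (ν i) (e j) = 0) →
      φ y e ^ 2 * (gram (lin₂ (g y)) ν).det = w y ν ^ 2 * (gram (lin₂ (g y)) e).det)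
    (hne : φ q e ≠ 0) (X : E) :
    fderiv ℝ φ q X e = 2⁻¹ * φ q e * ∑ i, fderiv ℝ g q X (e i) (e i) := by
  have hfe0 : ∀ i j, g q (f i) (e j) = 0 := fun i j => by
    simpa using hfe (Sum.inl i) (Sum.inr j)
  obtain ⟨ν, hν, hνf, hνe⟩ := exists_normal_frame hg (T := fun j _ => e j)
    (fun j => differentiableAt_const _) hfe.inr hfe0
  have hνf' : (fun i => ν i q) = f := funext hνf
  have h0 := hasFDerivAt_sq_sub (y := fun s : E => s) differentiableAt_id hg hw symm hν hνf hfe.inl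
    hcrit hvar
  have hφ' : HasFDerivAt (fun s => φ s e) ((ContinuousAlternatingMap.apply ℝ E ℝ e).comp
      (fderiv ℝ φ q)) q := (ContinuousAlternatingMap.apply ℝ E ℝ e).hasFDerivAt.comp q
        hφ.hasFDerivAt
  obtain ⟨L, hL, -⟩ := hasFDerivAt_det_gram hg.hasFDerivAt symm (fun i => (hν i).hasFDerivAt)
    (by rw [hνf']; exact hfe.inl)
  obtain ⟨M, hM, hMv⟩ := hasFDerivAt_det_gram hg.hasFDerivAt symm
    (fun i => hasFDerivAt_const (e i) q) hfe.inr
  have h1 := (hφ'.pow 2).mul hL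
  -- The square `w(ν)²` is split into the stationary difference and a constant times the Gram
  -- determinant. The unknown derivative `L` of that determinant then occurs on both sides and
  -- cancels.
  have h2 := (h0.add (hL.const_mul (w q f ^ 2))).mul hM
  have h3 := h1.unique (h2.congr_of_eventuallyEq (by
    filter_upwards [hνe, hsq] with s hs hs'
    have := hs' _ hs
    simp only [Pi.mul_apply, Pi.add_apply] at this ⊢
    rw [this]
    ring))
  have h4 := congrArg (fun L => L X) h3
  have hsq0 : φ q e ^ 2 = w q f ^ 2 := by
    have := hsq.self_of_nhds f hfe0
    rwa [gram_eq_one hfe.inl, gram_eq_one hfe.inr, Matrix.det_one, Matrix.det_one, mul_one,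
      mul_one] at this
  simp only [Pi.add_apply, hνf, gram_eq_one hfe.inl, gram_eq_one hfe.inr,
    Matrix.det_one, add_apply, smul_apply, smul_eq_mul, hMv,
    ContinuousLinearMap.comp_apply, zero_apply, map_zero, mul_zero, add_zero, zero_add, sub_self,
    mul_one, one_mul, hsq0] at h4
  change w q f ^ 2 * L X + 2 • φ q e ^ (2 - 1) * fderiv ℝ φ q X e = _ at h4
  rw [← hsq0, show 2 - 1 = 1 from rfl, pow_one, nsmul_eq_mul, Nat.cast_two] at h4
  refine mul_left_cancel₀ hne ?_
  linarith

/-- The orthonormal bases depend on `y` without any regularity. They are replaced by a fixed basis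
`c` and the vectors `r j y` dual to its coordinates, which represent the same inverse metric and
depend differentiably on `y`. -/
theorem differentiableAt_star {k : ℕ} {ι : Type*} [Fintype ι] [DecidableEq ι]
    {g : E → E →L[ℝ] E →L[ℝ] ℝ} {w : E → E [⋀^Fin 3]→L[ℝ] ℝ}
    {μ : E → E [⋀^Fin (k + 3)]→L[ℝ] ℝ} {φ : E → E [⋀^Fin k]→L[ℝ] ℝ} {q : E}
    (hg : DifferentiableAt ℝ g q) (hw : DifferentiableAt ℝ w q) (hμ : DifferentiableAt ℝ μ q)
    (pos : ∀ᶠ y in 𝓝 q, ∀ u, u ≠ 0 → 0 < g y u u)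
    (h : ∀ᶠ y in 𝓝 q, ∃ b : ι → E, IsOrtho (lin₂ (g y)) b ∧
      ⊤ ≤ Submodule.span ℝ (Set.range b) ∧
      ∀ v, φ y v = starSum b (w y).toAlternatingMap (μ y).toAlternatingMap v) :
    DifferentiableAt ℝ φ q := by
  let c := Module.finBasis ℝ E
  let r : Fin (finrank ℝ E) → E → E := fun j y => (g y).inverse (c.coord j).toContinuousLinearMap
  have hr : ∀ j, DifferentiableAt ℝ (r j) q := fun j =>
    (differentiableAt_inverse hg pos.self_of_nhds).clm_apply (differentiableAt_const _)
  have hcurry : ∀ {m : ℕ} {ψ : E → E [⋀^Fin (m + 1)]→L[ℝ] ℝ} {u : E → E},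
      DifferentiableAt ℝ ψ q → DifferentiableAt ℝ u q →
      DifferentiableAt ℝ (fun y => (ψ y).curryLeft (u y)) q := fun {m ψ u} hψ hu =>
    ((ContinuousAlternatingMap.curryLeftLI (𝕜 := ℝ) (E := E) (F := ℝ)
      (n := m)).toContinuousLinearMap.differentiableAt.comp q hψ).clm_apply hu
  have hw' : ∀ i j l, DifferentiableAt ℝ (fun y => w y ![c i, c j, c l]) q := fun i j l =>
    (ContinuousAlternatingMap.apply ℝ E ℝ ![c i, c j, c l]).differentiableAt.comp q hw
  have hψ : DifferentiableAt ℝ (fun y => (6 : ℝ)⁻¹ • ∑ i, ∑ j, ∑ l, w y ![c i, c j, c l] •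
      (((μ y).curryLeft (r i y)).curryLeft (r j y)).curryLeft (r l y)) q := by
    refine DifferentiableAt.fun_const_smul ?_ _
    refine DifferentiableAt.fun_sum fun i _ => DifferentiableAt.fun_sum fun j _ =>
      DifferentiableAt.fun_sum fun l _ => ?_
    exact (hw' i j l).smul (hcurry (hcurry (hcurry hμ (hr i)) (hr j)) (hr l))
  refine hψ.congr_of_eventuallyEq ?_
  filter_upwards [pos, h] with y hpos ⟨b, hb, hbs, hφ⟩
  ext v
  have hpair : SamePairing b b c (fun j => r j y) := fun ψ h1 h2 =>
    sum_orthonormal_eq hb hbs c _ (fun j u => by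
      rw [lin₂_apply, inverse_apply_left (g y) hpos]
      rfl) ψ h1 h2
  rw [hφ, starSum]
  refine (congrArg (6⁻¹ * ·) (hpair.sum₃ (m := 0) (w y).toAlternatingMap (μ y).toAlternatingMap
    ![] v)).trans ?_
  simp only [ContinuousAlternatingMap.smul_apply, ContinuousAlternatingMap.sum_apply, smul_eq_mul]
  rfl

end StarVariation

/-! ### Metric, forms and adapted frames in a chart. -/

section Charts

set_option maxSynthPendingDepth 3

open Filter Topology Function

variable {n : ℕ} {M : Type u} [TopologicalSpace M] [ChartedSpace (EuclideanSpace ℝ (Fin n)) M]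
  [IsManifold (𝓡 n) ∞ M]

theorem isManifold_one : IsManifold (𝓡 n) 1 M := IsManifold.of_le (n := ∞) (by simp)

/-- The differential of the inverse of the preferred chart at `x₀`. -/
def chartD (x₀ : M) (y : EuclideanSpace ℝ (Fin n)) :
    EuclideanSpace ℝ (Fin n) →L[ℝ] TangentSpace (𝓡 n) ((extChartAt (𝓡 n) x₀).symm y) :=
  mfderiv 𝓘(ℝ, EuclideanSpace ℝ (Fin n)) (𝓡 n) (extChartAt (𝓡 n) x₀).symm y

theorem metricInChart_apply (K : Metric n M) (x₀ : M) (y u v : EuclideanSpace ℝ (Fin n)) :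
    metricInChart K x₀ y u v = K.inner _ (chartD x₀ y u) (chartD x₀ y v) := rfl

omit [IsManifold (𝓡 n) ∞ M] in
theorem inChart_apply {k : ℕ} (α : DiffForm n M k) (x₀ : M) (y : EuclideanSpace ℝ (Fin n))
    (v : Fin k → EuclideanSpace ℝ (Fin n)) :
    α.inChart x₀ y v = α _ fun i => chartD x₀ y (v i) := rfl

theorem chartD_bijective (x₀ : M) {y : EuclideanSpace ℝ (Fin n)}
    (hy : y ∈ (extChartAt (𝓡 n) x₀).target) : Bijective (chartD x₀ y) := by
  have := isManifold_one (n := n) (M := M)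
  have h := isInvertible_mfderivWithin_extChartAt_symm (I := 𝓡 n) hy
  rw [ModelWithCorners.Boundaryless.range_eq_univ, mfderivWithin_univ] at h
  exact h.bijective

/-- The differential of the inverse of the preferred chart, as a linear isomorphism. -/
def chartIso (x₀ : M) {y : EuclideanSpace ℝ (Fin n)} (hy : y ∈ (extChartAt (𝓡 n) x₀).target) :
    EuclideanSpace ℝ (Fin n) ≃ₗ[ℝ] TangentSpace (𝓡 n) ((extChartAt (𝓡 n) x₀).symm y) :=
  LinearEquiv.ofBijective (chartD x₀ y).toLinearMap (chartD_bijective x₀ hy)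

theorem chartIso_apply (x₀ : M) {y : EuclideanSpace ℝ (Fin n)}
    (hy : y ∈ (extChartAt (𝓡 n) x₀).target) (v : EuclideanSpace ℝ (Fin n)) :
    chartIso x₀ hy v = chartD x₀ y v := rfl

theorem contMDiffOn_chartD (x₀ : M) (u : EuclideanSpace ℝ (Fin n)) :
    ContMDiffOn 𝓘(ℝ, EuclideanSpace ℝ (Fin n)) ((𝓡 n).prod 𝓘(ℝ, EuclideanSpace ℝ (Fin n))) 1
      (fun y => (⟨(extChartAt (𝓡 n) x₀).symm y, chartD x₀ y u⟩ : TangentBundle (𝓡 n) M))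
      (extChartAt (𝓡 n) x₀).target := by
  have ho : IsOpen (extChartAt (𝓡 n) x₀).target := isOpen_extChartAt_target x₀
  have h1 : ContMDiffOn 𝓘(ℝ, EuclideanSpace ℝ (Fin n)) (𝓡 n) ∞ (extChartAt (𝓡 n) x₀).symm
    (extChartAt (𝓡 n) x₀).target := contMDiffOn_extChartAt_symm x₀
  have h2 := h1.contMDiffOn_tangentMapWithin (m := 1) 
    (by rw [one_add_one_eq_two]; exact ENat.LEInfty.out) ho.uniqueMDiffOn
  have h3 : ContMDiff 𝓘(ℝ, EuclideanSpace ℝ (Fin n))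
      (𝓘(ℝ, EuclideanSpace ℝ (Fin n)).prod 𝓘(ℝ, EuclideanSpace ℝ (Fin n))) 1
      (fun y => (⟨y, u⟩ : TangentBundle 𝓘(ℝ, EuclideanSpace ℝ (Fin n)) (EuclideanSpace ℝ (Fin n))))
      :=
    contMDiff_vectorSpace_iff_contDiff (V := fun _ => u) |>.2 contDiff_const
  refine (h2.comp h3.contMDiffOn (fun y hy => hy)).congr fun y hy => ?_
  simp only [Function.comp_apply, tangentMapWithin]
  rw [mfderivWithin_of_isOpen ho hy]
  rfl

theorem contDiffOn_metricInChart (K : Metric n M) (x₀ : M) :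
    ContDiffOn ℝ 1 (metricInChart K x₀) (extChartAt (𝓡 n) x₀).target := by
  rw [contDiffOn_clm_apply]
  intro u
  rw [contDiffOn_clm_apply]
  intro v
  have h1 : ContMDiffOn 𝓘(ℝ, EuclideanSpace ℝ (Fin n)) (𝓡 n) 1 (extChartAt (𝓡 n) x₀).symm
    (extChartAt (𝓡 n) x₀).target := (contMDiffOn_extChartAt_symm (n := ∞) x₀).of_le (by simp)
  have h2 := (K.contMDiff.of_le (m := 1) (by simp)).comp_contMDiffOn h1
  have h3 := ContMDiffOn.clm_bundle_apply₂ (F₁ := EuclideanSpace ℝ (Fin n))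
    (F₂ := EuclideanSpace ℝ (Fin n)) (F₃ := ℝ) (E₁ := fun x : M => TangentSpace (𝓡 n) x)
    (E₂ := fun x : M => TangentSpace (𝓡 n) x) (E₃ := Bundle.Trivial M ℝ) (n := 1)
    (b := (extChartAt (𝓡 n) x₀).symm) h2 (contMDiffOn_chartD x₀ u) (contMDiffOn_chartD x₀ v)
  have h4 := fun y hy => (Bundle.contMDiffWithinAt_totalSpace.1 (h3 y hy)).2
  intro y hy
  exact (h4 y hy).contDiffWithinAt

theorem differentiableAt_metricInChart (K : Metric n M) (x₀ : M) {y : EuclideanSpace ℝ (Fin n)}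
    (hy : y ∈ (extChartAt (𝓡 n) x₀).target) : DifferentiableAt ℝ (metricInChart K x₀) y :=
  ((contDiffOn_metricInChart K x₀).contDiffAt
    ((isOpen_extChartAt_target x₀).mem_nhds hy)).differentiableAt (by simp)

omit [IsManifold (𝓡 n) ∞ M] in
theorem DiffForm.IsSmoothOn.differentiableAt {k : ℕ} {α : DiffForm n M k} {U : Set M}
    (h : α.IsSmoothOn U) (hU : IsOpen U) (x₀ : M) {y : EuclideanSpace ℝ (Fin n)}
    (hy : y ∈ (extChartAt (𝓡 n) x₀).target) (hyU : (extChartAt (𝓡 n) x₀).symm y ∈ U) :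
    DifferentiableAt ℝ (α.inChart x₀) y := by
  have ho := (continuousOn_extChartAt_symm (I := 𝓡 n) x₀).isOpen_inter_preimage
    (isOpen_extChartAt_target x₀) hU
  exact ((h x₀).contDiffAt (ho.mem_nhds ⟨hy, hyU⟩)).differentiableAt (by simp)

theorem IsAdaptedFrame.inChart {𝔤 : Type w} [LieRing 𝔤] [LieAlgebra ℝ 𝔤] {ω₃ : DiffForm n M 3}
    {K : Metric n M} (x₀ : M) {y : EuclideanSpace ℝ (Fin n)}
    (hy : y ∈ (extChartAt (𝓡 n) x₀).target)
    {J : TangentSpace (𝓡 n) ((extChartAt (𝓡 n) x₀).symm y) ≃ₗ[ℝ] 𝔤}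
    (hJ : IsAdaptedFrame ω₃ K ((extChartAt (𝓡 n) x₀).symm y) J) :
    IsAdapted (ω₃.inChart x₀ y) (metricInChart K x₀ y) ((chartIso x₀ hy).trans J) := by
  refine ⟨fun u v z => ?_, fun u v => ?_⟩
  · rw [inChart_apply]
    refine Eq.trans ?_ (hJ.1 (chartD x₀ y u) (chartD x₀ y v) (chartD x₀ y z))
    congr 1
    ext1 i
    fin_cases i <;> rfl
  · rw [metricInChart_apply]
    exact hJ.2 _ _

end Charts

/-! ### Criticality of a form, tested on normal vectors. -/

section Calibration

open Function

variable {V : Type*} [AddCommGroup V] [Module ℝ V]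

section

variable [FiniteDimensional ℝ V]

/-- Split `Y = ∑ c l • T l + Z` with `Z` normal; then `φ (update T i Y) = c i * φ T`. This produces
the hypothesis `hcal` of `extDeriv_calibration`. -/
theorem calibration_of_normal {k : ℕ} (φ : V [⋀^Fin k]→ₗ[ℝ] ℝ) (B : V →ₗ[ℝ] V →ₗ[ℝ] ℝ)
    (symm : ∀ u v, B u v = B v u) (pos : ∀ u, u ≠ 0 → 0 < B u u) (T : Fin k → V)
    (h : ∀ i Z, (∀ j, B Z (T j) = 0) → φ (update T i Z) = 0) (Y : V) (j : Fin k) :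
    ∑ i, B (T j) (T i) * φ (update T i Y) = B (T j) Y * φ T := by
  obtain ⟨Z, hZ₁, hZ₂⟩ := exists_normal_part B pos (Submodule.span ℝ (Set.range T)) Y
  obtain ⟨c, hc⟩ := (Submodule.mem_span_range_iff_exists_fun ℝ).1 hZ₁
  have hZ : ∀ l, B Z (T l) = 0 := fun l => hZ₂ _ (Submodule.subset_span ⟨l, rfl⟩)
  have hY : Y = (∑ l, c l • T l) + Z := by rw [hc]; simp
  have key : ∀ i, φ (update T i Y) = c i * φ T := by
    intro i
    have h1 : φ (update T i Y) = φ.toMultilinearMap.toLinearMap T i Y := rfl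
    have h2 : ∀ l, φ.toMultilinearMap.toLinearMap T i (T l) = if l = i then φ T else 0 := by
      intro l
      have h3 : φ.toMultilinearMap.toLinearMap T i (T l) = φ (update T i (T l)) := rfl
      rw [h3]
      split_ifs with hli
      · rw [hli, update_eq_self]
      · exact φ.map_update_self T (Ne.symm hli)
    have h4 : φ.toMultilinearMap.toLinearMap T i Z = 0 := h i Z hZ
    rw [h1, hY, map_add, h4, add_zero, map_sum]
    simp [h2]
  have hZj : B (T j) Z = 0 := by rw [symm, hZ]
  rw [hY, map_add, hZj, add_zero, map_sum, Finset.sum_mul]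
  refine Finset.sum_congr rfl fun i _ => ?_
  rw [← hY, key, map_smul, smul_eq_mul]
  ring

/-- The case of an orthonormal family. -/
theorem map_update_of_normal {k : ℕ} (φ : V [⋀^Fin k]→ₗ[ℝ] ℝ) (B : V →ₗ[ℝ] V →ₗ[ℝ] ℝ)
    (symm : ∀ u v, B u v = B v u) (pos : ∀ u, u ≠ 0 → 0 < B u u) {f : Fin k → V}
    (hf : IsOrtho B f) (h : ∀ i Z, (∀ j, B Z (f j) = 0) → φ (update f i Z) = 0) (j : Fin k)
    (Y : V) : φ (update f j Y) = φ f * B (f j) Y := by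
  have := calibration_of_normal φ B symm pos f h Y j
  have h1 : ∀ i, B (f j) (f i) = if j = i then 1 else 0 := hf j
  simp only [h1, ite_mul, one_mul, zero_mul, Finset.sum_ite_eq, Finset.mem_univ, if_true] at this
  rw [this, mul_comm]

/-- An orthonormal basis adapted to the span of `T` and its orthogonal complement. -/
theorem exists_adapted_basis_span (B : V →ₗ[ℝ] V →ₗ[ℝ] ℝ)
    (symm : ∀ u v, B u v = B v u) (pos : ∀ u, u ≠ 0 → 0 < B u u) {k m : ℕ} {T : Fin k → V}
    (hT : LinearIndependent ℝ T) (hV : finrank ℝ V = k + m) :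
    ∃ (f : Fin m → V) (e : Fin k → V), IsOrtho B (Sum.elim f e) ∧
      Submodule.span ℝ (Set.range e) = Submodule.span ℝ (Set.range T) ∧
      (∀ v, v ∈ Submodule.span ℝ (Set.range f) ↔ ∀ j, B v (T j) = 0) ∧
      ⊤ ≤ Submodule.span ℝ (Set.range (Sum.elim f e)) := by
  obtain ⟨f, e, h1, h2, h3, h4⟩ := exists_adapted_basis B symm pos (k := k) (m := m)
    (Submodule.span ℝ (Set.range T)) (by rw [finrank_span_eq_card hT, Fintype.card_fin]) hV
  refine ⟨f, e, h1, h2, fun v => (h3 v).trans ⟨fun h j => h _ (Submodule.subset_span ⟨j, rfl⟩),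
    fun h u hu => ?_⟩, h4⟩
  induction hu using Submodule.span_induction with
  | mem x hx => obtain ⟨j, rfl⟩ := hx; exact h j
  | zero => simp
  | add x y _ _ hx hy => rw [map_add, hx, hy, add_zero]
  | smul c x _ hx => rw [map_smul, hx, smul_zero]

end

theorem IsOrtho.mem_span_right {m k : ℕ} {B : V →ₗ[ℝ] V →ₗ[ℝ] ℝ} {f : Fin m → V} {e : Fin k → V}
    (h : IsOrtho B (Sum.elim f e)) (hs : ⊤ ≤ Submodule.span ℝ (Set.range (Sum.elim f e))) {Z : V}
    (hZ : ∀ j, B Z (f j) = 0) : Z ∈ Submodule.span ℝ (Set.range e) := by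
  rw [h.eq_sum (hs (Submodule.mem_top (x := Z))), Fintype.sum_sum_type]
  simp only [Sum.elim_inl, Sum.elim_inr, hZ, zero_smul, Finset.sum_const_zero, zero_add]
  exact Submodule.sum_mem _ fun i _ => Submodule.smul_mem _ _ (Submodule.subset_span ⟨i, rfl⟩)

theorem IsOrtho.sumElim {m k : ℕ} {B : V →ₗ[ℝ] V →ₗ[ℝ] ℝ} (symm : ∀ u v, B u v = B v u)
    {f : Fin m → V} {e : Fin k → V} (hf : IsOrtho B f) (he : IsOrtho B e)
    (hfe : ∀ i j, B (f i) (e j) = 0) : IsOrtho B (Sum.elim f e) := by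
  rintro (i | i) (j | j)
  · simpa using hf i j
  · simpa using hfe i j
  · simpa using (symm _ _).trans (hfe j i)
  · simpa using he i j

theorem map_eq_zero_of_mem_span (w : V [⋀^Fin 3]→ₗ[ℝ] ℝ) {k : ℕ} {T : Fin k → V} {Z Z' : V}
    (h : ∀ i, w ![T i, Z, Z'] = 0) {u : V} (hu : u ∈ Submodule.span ℝ (Set.range T)) :
    w ![u, Z, Z'] = 0 := by
  have hl := isLinearMap_vecCons w ![Z, Z']
  induction hu using Submodule.span_induction with
  | mem x hx => obtain ⟨j, rfl⟩ := hx; exact h j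
  | zero => exact hl.map_zero
  | add x y _ _ hx hy => exact (hl.map_add x y).trans (by rw [hx, hy, add_zero])
  | smul c x _ hx => exact (hl.map_smul c x).trans (by rw [hx, smul_zero])

/-- If a 3-form `w` vanishes on triples with two arguments from a family `f` and one argument
orthogonal to it, its value on `update f i Z` with `Z` orthogonal to `f` is zero. -/
theorem map_update_eq_zero_of_mixed (w : V [⋀^Fin 3]→ₗ[ℝ] ℝ) (f : Fin 3 → V) {Z : V}
    (h : ∀ i j, w ![f i, f j, Z] = 0) (i : Fin 3) : w (update f i Z) = 0 := by
  fin_cases i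
  · have : update f 0 Z = ![Z, f 1, f 2] := by ext1 i; fin_cases i <;> rfl
    simp only [Fin.zero_eta]
    rw [this, ← map_rotate, h]
  · have : update f 1 Z = ![f 0, Z, f 2] := by ext1 i; fin_cases i <;> rfl
    simp only [Fin.mk_one]
    rw [this, map_swap₁₂, h, neg_zero]
  · have : update f 2 Z = ![f 0, f 1, Z] := by ext1 i; fin_cases i <;> rfl
    simp only [Fin.reduceFinMk]
    rw [this, h]

end Calibration

/-! ### The two cases in a vector space with variable metric and form. -/

section Flat

set_option maxSynthPendingDepth 3

open Filter Topology Function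

variable {E : Type*} [NormedAddCommGroup E] [NormedSpace ℝ E] [FiniteDimensional ℝ E]
variable {H : Type*} [NormedAddCommGroup H] [NormedSpace ℝ H]
variable {𝔤 : Type*} [LieRing 𝔤] [LieAlgebra ℝ 𝔤]

/-- A quantity `σ` that is computed as a ratio of the squares of values of a 3-form and Gram
determinants is stationary if the numerator is stationary relative to the denominator. -/
theorem hasFDerivAt_zero_of_ratio {σ N D : H → ℝ} {p : H} (hD : ContinuousAt D p) (hD1 : D p = 1)
    (hN : HasFDerivAt (fun s => N s - σ p * D s) (0 : H →L[ℝ] ℝ) p)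
    (h : ∀ᶠ s in 𝓝 p, N s = σ s * D s) : HasFDerivAt σ (0 : H →L[ℝ] ℝ) p := by
  rw [hasFDerivAt_iff_isLittleO] at hN ⊢
  have hp : N p = σ p * D p := h.self_of_nhds
  have hD' : Tendsto (fun s => (D s)⁻¹) (𝓝 p) (𝓝 1) := by
    have := hD.tendsto.inv₀ (by rw [hD1]; exact one_ne_zero)
    rwa [hD1, inv_one] at this
  -- Since `σ s - σ p = (N s - σ p * D s) / D s`, this is a little-o term times a bounded one. No
  -- continuity of `σ` is presupposed.
  have h1 := (hN.norm_right.mul_isBigO (hD'.isBigO_one ℝ))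
  simp only [mul_one] at h1
  refine h1.of_norm_right.congr' ?_ (EventuallyEq.refl _ _)
  filter_upwards [h, hD.eventually_ne (by rw [hD1]; exact one_ne_zero)] with s hs hs'
  rw [hs, hp]
  simp only [zero_apply, sub_zero]
  field_simp
  ring

/-- Closure under the bracket enters through `hcl`, which makes `w` critical on the tangent spaces:
near `p` this feeds `extDeriv_calibration`, and at `p` it feeds `fderiv_form`. -/
theorem extDeriv_form_of_closed (h𝔤 : IsCompactSimple 𝔤) {g : E → E →L[ℝ] E →L[ℝ] ℝ}
    {w : E → E [⋀^Fin 3]→L[ℝ] ℝ} {F : H → E} {p : H} (hF : ContDiffAt ℝ 2 F p)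
    (hg : DifferentiableAt ℝ g (F p)) (hw : DifferentiableAt ℝ w (F p))
    (hJ : ∀ᶠ y in 𝓝 (F p), ∃ J : E ≃ₗ[ℝ] 𝔤, IsAdapted (w y) (g y) J) (a : Fin 3 → H)
    (hcl : ∀ᶠ s in 𝓝 p, ∀ Z, (∀ j, g (F s) Z (fderiv ℝ F s (a j)) = 0) →
      ∀ i j, w (F s) ![fderiv ℝ F s (a i), fderiv ℝ F s (a j), Z] = 0)
    {e : Fin 3 → E} (hea : ∀ i, fderiv ℝ F p (a i) = e i) (he : IsOrtho (lin₂ (g (F p))) e)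
    {X : E} (hX : ∀ i, g (F p) (e i) X = 0) :
    extDeriv w (F p) (Fin.cons X e) = -w (F p) e *
      ∑ j, (g (F p) (fderiv ℝ (fderiv ℝ F) p (a j) (a j)) X + fderiv ℝ g (F p) (e j) (e j) X
        - 2⁻¹ * fderiv ℝ g (F p) X (e j) (e j)) := by
  have hJF : ∀ᶠ s in 𝓝 p, ∃ J : E ≃ₗ[ℝ] 𝔤, IsAdapted (w (F s)) (g (F s)) J :=
    hF.continuousAt.eventually hJ
  refine extDeriv_calibration hF hw hg a ?_ hea he hX ?_
  · filter_upwards [hJF, hcl] with s ⟨J, hJs⟩ hs Y j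
    exact calibration_of_normal (w (F s)).toAlternatingMap (lin₂ (g (F s))) hJs.symm (hJs.pos h𝔤)
      (fun l => fderiv ℝ F s (a l)) (fun i Z hZ => map_update_eq_zero_of_mixed _ _ (hs Z hZ) i) Y j
  · obtain ⟨J, hJp⟩ := hJF.self_of_nhds
    refine fderiv_form h𝔤 hg hw hJ (fun i Y => ?_) X
    refine map_update_of_normal (w (F p)).toAlternatingMap (lin₂ (g (F p))) hJp.symm (hJp.pos h𝔤)
      he (fun i Z hZ => map_update_eq_zero_of_mixed _ _ (fun i j => ?_) i) i Y
    have := hcl.self_of_nhds Z (fun j => by rw [hea]; exact hZ j) i j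
    rwa [hea, hea] at this

theorem hasFDerivAt_ratio_tangent (h𝔤 : IsCompactSimple 𝔤) {g : E → E →L[ℝ] E →L[ℝ] ℝ}
    {w : E → E [⋀^Fin 3]→L[ℝ] ℝ} {F : H → E} {p : H} (hF : ContDiffAt ℝ 2 F p)
    (hg : DifferentiableAt ℝ g (F p)) (hw : DifferentiableAt ℝ w (F p))
    (hJ : ∀ᶠ y in 𝓝 (F p), ∃ J : E ≃ₗ[ℝ] 𝔤, IsAdapted (w y) (g y) J) (a : Fin 3 → H)
    (hcl : ∀ Z, (∀ j, g (F p) Z (fderiv ℝ F p (a j)) = 0) →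
      ∀ i j, w (F p) ![fderiv ℝ F p (a i), fderiv ℝ F p (a j), Z] = 0)
    (he : IsOrtho (lin₂ (g (F p))) fun i => fderiv ℝ F p (a i)) {σ : H → ℝ}
    (hσ : ∀ᶠ s in 𝓝 p, w (F s) (fun i => fderiv ℝ F s (a i)) ^ 2
      = σ s * (gram (lin₂ (g (F s))) fun i => fderiv ℝ F s (a i)).det) :
    HasFDerivAt σ (0 : H →L[ℝ] ℝ) p := by
  obtain ⟨J, hJp⟩ := hJ.self_of_nhds
  have hcrit : ∀ i Y, w (F p) (update (fun i => fderiv ℝ F p (a i)) i Y)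
      = w (F p) (fun i => fderiv ℝ F p (a i)) * g (F p) (fderiv ℝ F p (a i)) Y := fun i Y =>
    map_update_of_normal (w (F p)).toAlternatingMap (lin₂ (g (F p))) hJp.symm (hJp.pos h𝔤)
      he (fun i Z hZ => map_update_eq_zero_of_mixed _ _ (hcl Z hZ) i) i Y
  have hF1 : DifferentiableAt ℝ F p := hF.differentiableAt (by simp)
  have hF2 : DifferentiableAt ℝ (fderiv ℝ F) p :=
    (hF.fderiv_right (m := 1) (by norm_num)).differentiableAt (by simp)
  have hT : ∀ i, DifferentiableAt ℝ (fun s => fderiv ℝ F s (a i)) p := fun i =>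
    hF2.clm_apply (differentiableAt_const _)
  have hσp := hσ.self_of_nhds
  rw [gram_eq_one he, Matrix.det_one, mul_one] at hσp
  have h1 := hasFDerivAt_sq_sub hF1 hg hw hJp.symm hT (fun i => rfl) he hcrit
    (fderiv_form h𝔤 hg hw hJ hcrit)
  rw [hσp] at h1
  have hG : DifferentiableAt ℝ (fun s => g (F s)) p := hg.comp p hF1
  obtain ⟨L, hL, -⟩ := hasFDerivAt_det_gram (G := fun s => g (F s)) hG.hasFDerivAt hJp.symm
    (fun i => (hT i).hasFDerivAt) he
  refine hasFDerivAt_zero_of_ratio hL.continuousAt ?_ h1 hσ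
  rw [gram_eq_one he, Matrix.det_one]

/-- If the orthogonal complement of `T` is closed under the bracket, the form `w` is critical
on its orthonormal bases. -/
theorem map_update_of_coclosed {V : Type*} [AddCommGroup V] [Module ℝ V] [FiniteDimensional ℝ V]
    (w : V [⋀^Fin 3]→ₗ[ℝ] ℝ) {B : V →ₗ[ℝ] V →ₗ[ℝ] ℝ}
    (symm : ∀ u v, B u v = B v u) (pos : ∀ u, u ≠ 0 → 0 < B u u) {k : ℕ} {T : Fin k → V}
    {f : Fin 3 → V} {e : Fin k → V} (h : IsOrtho B (Sum.elim f e))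
    (hs : ⊤ ≤ Submodule.span ℝ (Set.range (Sum.elim f e)))
    (heT : Submodule.span ℝ (Set.range e) ≤ Submodule.span ℝ (Set.range T))
    (hw : ∀ a i j, w ![T a, f i, f j] = 0) (i : Fin 3) (Y : V) :
    w (update f i Y) = w f * B (f i) Y := by
  refine map_update_of_normal w B symm pos h.inl (fun i Z hZ => ?_) i Y
  refine map_update_eq_zero_of_mixed _ _ (fun i j => ?_) i
  exact (map_rotate w Z (f i) (f j)).trans
    (map_eq_zero_of_mem_span w (fun a => hw a i j) (heT (h.mem_span_right hs hZ)))

/-- The images of the `a i` frame the tangent spaces only, so a differentiable frame of the normal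
spaces is supplied by `exists_normal_frame`. Criticality of `w` is needed at `p` alone. -/
theorem hasFDerivAt_ratio_normal (h𝔤 : IsCompactSimple 𝔤) {g : E → E →L[ℝ] E →L[ℝ] ℝ}
    {w : E → E [⋀^Fin 3]→L[ℝ] ℝ} {k : ℕ} {F : H → E} {p : H} (hF : ContDiffAt ℝ 2 F p)
    (hE : finrank ℝ E = k + 3)
    (hg : DifferentiableAt ℝ g (F p)) (hw : DifferentiableAt ℝ w (F p))
    (hJ : ∀ᶠ y in 𝓝 (F p), ∃ J : E ≃ₗ[ℝ] 𝔤, IsAdapted (w y) (g y) J) (a : Fin k → H)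
    (hcl : ∀ Z Z', (∀ j, g (F p) Z (fderiv ℝ F p (a j)) = 0) →
      (∀ j, g (F p) Z' (fderiv ℝ F p (a j)) = 0) → ∀ i, w (F p) ![fderiv ℝ F p (a i), Z, Z'] = 0)
    (he : IsOrtho (lin₂ (g (F p))) fun i => fderiv ℝ F p (a i)) {σ : H → ℝ}
    (hσ : ∀ᶠ s in 𝓝 p, ∀ ν : Fin 3 → E, (∀ i j, g (F s) (ν i) (fderiv ℝ F s (a j)) = 0) →
      w (F s) ν ^ 2 = σ s * (gram (lin₂ (g (F s))) ν).det) :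
    HasFDerivAt σ (0 : H →L[ℝ] ℝ) p := by
  obtain ⟨J, hJp⟩ := hJ.self_of_nhds
  have symm := hJp.symm
  have pos := hJp.pos h𝔤
  obtain ⟨f, e, h1, h2, h3, h4⟩ := exists_adapted_basis_span (lin₂ (g (F p))) symm pos
    he.linearIndependent hE
  have hfT : ∀ i j, g (F p) (f i) (fderiv ℝ F p (a j)) = 0 := fun i =>
    (h3 _).1 (Submodule.subset_span ⟨i, rfl⟩)
  have hcrit : ∀ i Y, w (F p) (update f i Y) = w (F p) f * g (F p) (f i) Y :=
    map_update_of_coclosed (w (F p)).toAlternatingMap (B := lin₂ (g (F p))) symm pos h1 h4 h2.le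
      (fun c i j => hcl _ _ (hfT i) (hfT j) c)
  have hF1 : DifferentiableAt ℝ F p := hF.differentiableAt (by simp)
  have hF2 : DifferentiableAt ℝ (fderiv ℝ F) p :=
    (hF.fderiv_right (m := 1) (by norm_num)).differentiableAt (by simp)
  have hT : ∀ i, DifferentiableAt ℝ (fun s => fderiv ℝ F s (a i)) p := fun i =>
    hF2.clm_apply (differentiableAt_const _)
  have hG : DifferentiableAt ℝ (fun s => g (F s)) p := hg.comp p hF1
  obtain ⟨ν, hν, hνf, hνT⟩ := exists_normal_frame hG hT he hfT
  have hνp : (fun i => ν i p) = f := funext hνf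
  have hνo : IsOrtho (lin₂ (g (F p))) fun i => ν i p := by rw [hνp]; exact h1.inl
  have hσ' : ∀ᶠ s in 𝓝 p, w (F s) (fun i => ν i s) ^ 2
      = σ s * (gram (lin₂ (g (F s))) fun i => ν i s).det := by
    filter_upwards [hσ, hνT] with s hs hs'
    exact hs _ hs'
  have hσp := hσ'.self_of_nhds
  rw [gram_eq_one hνo, Matrix.det_one, mul_one, hνp] at hσp
  have h5 := hasFDerivAt_sq_sub hF1 hg hw symm hν hνf h1.inl hcrit (fderiv_form h𝔤 hg hw hJ hcrit)
  rw [hσp] at h5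
  obtain ⟨L, hL, -⟩ := hasFDerivAt_det_gram (G := fun s => g (F s)) hG.hasFDerivAt symm
    (fun i => (hν i).hasFDerivAt) hνo
  refine hasFDerivAt_zero_of_ratio hL.continuousAt ?_ h5 hσ'
  rw [gram_eq_one hνo, Matrix.det_one]

theorem extDeriv_star_of_coclosed (h𝔤 : IsCompactSimple 𝔤) {g : E → E →L[ℝ] E →L[ℝ] ℝ}
    {w : E → E [⋀^Fin 3]→L[ℝ] ℝ} {k : ℕ} {μ : E → E [⋀^Fin (k + 3)]→L[ℝ] ℝ}
    {φ : E → E [⋀^Fin k]→L[ℝ] ℝ} {F : H → E} {p : H} (hF : ContDiffAt ℝ 2 F p)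
    (hE : finrank ℝ E = k + 3)
    (hg : DifferentiableAt ℝ g (F p)) (hw : DifferentiableAt ℝ w (F p))
    (hμ : DifferentiableAt ℝ μ (F p))
    (hJ : ∀ᶠ y in 𝓝 (F p), ∃ J : E ≃ₗ[ℝ] 𝔤, IsAdapted (w y) (g y) J)
    (hφ : ∀ᶠ y in 𝓝 (F p), ∃ b : Fin (k + 3) → E, IsOrtho (lin₂ (g y)) b ∧
      ⊤ ≤ Submodule.span ℝ (Set.range b) ∧
      ∀ v, φ y v = starSum b (w y).toAlternatingMap (μ y).toAlternatingMap v)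
    (hμ1 : ∀ᶠ y in 𝓝 (F p), ∀ b, IsOrtho (lin₂ (g y)) b → μ y b ^ 2 = 1) (a : Fin k → H)
    (hli : ∀ᶠ s in 𝓝 p, LinearIndependent ℝ fun j => fderiv ℝ F s (a j))
    (hcl : ∀ᶠ s in 𝓝 p, ∀ Z Z', (∀ j, g (F s) Z (fderiv ℝ F s (a j)) = 0) →
      (∀ j, g (F s) Z' (fderiv ℝ F s (a j)) = 0) → ∀ i, w (F s) ![fderiv ℝ F s (a i), Z, Z'] = 0)
    {e : Fin k → E} (hea : ∀ i, fderiv ℝ F p (a i) = e i) (he : IsOrtho (lin₂ (g (F p))) e)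
    (hne : φ (F p) e ≠ 0) {X : E} (hX : ∀ i, g (F p) (e i) X = 0) :
    extDeriv φ (F p) (Fin.cons X e) = -φ (F p) e *
      ∑ j, (g (F p) (fderiv ℝ (fderiv ℝ F) p (a j) (a j)) X + fderiv ℝ g (F p) (e j) (e j) X
        - 2⁻¹ * fderiv ℝ g (F p) X (e j) (e j)) := by
  have hpos : ∀ᶠ y in 𝓝 (F p), ∀ u, u ≠ 0 → 0 < g y u u := by
    filter_upwards [hJ] with y ⟨J, hJ⟩ using hJ.pos h𝔤
  have hdφ : DifferentiableAt ℝ φ (F p) := differentiableAt_star hg hw hμ hpos hφ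
  -- At each nearby point, and for each `k`-plane there, the Hodge star can be computed in a basis
  -- adapted to that plane. The plane need not be tangent to the submanifold.
  have star : ∀ᶠ y in 𝓝 (F p), ∀ T : Fin k → E, LinearIndependent ℝ T →
      ∃ (f : Fin 3 → E) (e : Fin k → E), IsOrtho (lin₂ (g y)) (Sum.elim f e) ∧
      Submodule.span ℝ (Set.range e) = Submodule.span ℝ (Set.range T) ∧
      (∀ v, v ∈ Submodule.span ℝ (Set.range f) ↔ ∀ j, g y v (T j) = 0) ∧
      ⊤ ≤ Submodule.span ℝ (Set.range (Sum.elim f e)) ∧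
      ∀ v, φ y v = starSum (Sum.elim f e) (w y).toAlternatingMap (μ y).toAlternatingMap v := by
    filter_upwards [hJ, hφ] with y ⟨J, hJ⟩ ⟨b, hb, hbs, hφb⟩ T hT
    obtain ⟨f, e, h1, h2, h3, h4⟩ := exists_adapted_basis_span (lin₂ (g y)) hJ.symm (hJ.pos h𝔤)
      hT hE
    exact ⟨f, e, h1, h2, h3, h4, fun v => (hφb v).trans
      (starSum_congr hb h1 hbs h4 hJ.symm _ _ v)⟩
  refine extDeriv_calibration hF hdφ hg a ?_ hea he hX ?_
  · filter_upwards [hF.continuousAt.eventually hJ, hcl, hli, hF.continuousAt.eventually star]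
      with s ⟨J, hJs⟩ hs hli hstar Y j
    obtain ⟨f, e, h1, h2, h3, h4, h5⟩ := hstar _ hli
    refine calibration_of_normal (φ (F s)).toAlternatingMap (lin₂ (g (F s))) hJs.symm (hJs.pos h𝔤)
      (fun l => fderiv ℝ F s (a l)) (fun i Z hZ => (h5 _).trans ?_) Y j
    have hfT : ∀ i, ∀ j, g (F s) (f i) (fderiv ℝ F s (a j)) = 0 := fun i =>
      (h3 _).1 (Submodule.subset_span ⟨i, rfl⟩)
    refine starSum_update_eq_zero h1.inl h1.inr _ _ (fun c i j => ?_) (fun i => ?_) i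
      ((h3 Z).2 hZ)
    · exact map_eq_zero_of_mem_span (w (F s)).toAlternatingMap (fun i' => hs _ _ (hfT i) (hfT j) i')
        (h2.le (Submodule.subset_span ⟨c, rfl⟩))
    · rw [h2]
      exact Submodule.subset_span ⟨i, rfl⟩
  · obtain ⟨J, hJp⟩ := hJ.self_of_nhds
    have symm := hJp.symm
    have pos := hJp.pos h𝔤
    obtain ⟨f, e', h1, h2, h3, h4⟩ := exists_adapted_basis_span (lin₂ (g (F p))) symm pos
      he.linearIndependent hE
    have hfe : ∀ i j, g (F p) (f i) (e j) = 0 := fun i =>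
      (h3 _).1 (Submodule.subset_span ⟨i, rfl⟩)
    have hcrit : ∀ i Y, w (F p) (update f i Y) = w (F p) f * g (F p) (f i) Y :=
      map_update_of_coclosed (w (F p)).toAlternatingMap (B := lin₂ (g (F p))) symm pos h1 h4 h2.le
        (fun c i j => by
          rw [← hea]
          refine hcl.self_of_nhds _ _ (fun l => ?_) (fun l => ?_) c <;> rw [hea] <;> exact hfe _ _)
    refine fderiv_star hg hw hdφ symm (h1.inl.sumElim symm he hfe) hcrit
      (fderiv_form h𝔤 hg hw hJ hcrit) ?_ hne X
    -- Here the plane is the fixed span of `e`, also at points `y` off the submanifold. Only duality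
    -- of the star is used there, not closure under the bracket.
    filter_upwards [star, hμ1] with y hstar hμy ν hν
    obtain ⟨f', e'', h1', h2', h3', -, h5'⟩ := hstar _ he.linearIndependent
    refine star_sq_eq h1' hμy (φ := (φ y).toAlternatingMap) h5' (fun i => (h3' _).2 (hν i))
      (fun i => ?_)
    rw [h2']
    exact Submodule.subset_span ⟨i, rfl⟩

end Flat

/-! ### Passage from the manifold to the preferred charts. -/

section Transfer

set_option maxSynthPendingDepth 3

open Filter Topology Function

variable {n : ℕ} {M : Type u} [TopologicalSpace M] [ChartedSpace (EuclideanSpace ℝ (Fin n)) M]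
  [IsManifold (𝓡 n) ∞ M]

omit [IsManifold (𝓡 n) ∞ M] in
theorem symm_extChartAt_self (x : M) :
    (extChartAt (𝓡 n) x).symm (extChartAt (𝓡 n) x x) = x := extChartAt_to_inv x

/-- Each tangent space is the model space, identified through the preferred chart at its own base
point, so the chart has identity differential there. The explicit type in `@Eq` forgets the base
point, because the two sides live over points that are equal only propositionally. -/
theorem chartD_self (x : M) (u : EuclideanSpace ℝ (Fin n)) :
    @Eq (EuclideanSpace ℝ (Fin n)) (chartD x (extChartAt (𝓡 n) x x) u) u := by
  have := isManifold_one (n := n) (M := M)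
  have h := mfderivWithin_range_extChartAt_symm (I := 𝓡 n) (x := x)
  rw [ModelWithCorners.Boundaryless.range_eq_univ, mfderivWithin_univ] at h
  exact congrArg (fun L : EuclideanSpace ℝ (Fin n) →L[ℝ] EuclideanSpace ℝ (Fin n) => L u) h

theorem mfderiv_extChartAt_self_apply (x : M) (u : EuclideanSpace ℝ (Fin n)) :
    @Eq (EuclideanSpace ℝ (Fin n))
      (mfderiv (𝓡 n) 𝓘(ℝ, EuclideanSpace ℝ (Fin n)) (extChartAt (𝓡 n) x) x u) u := by
  have := isManifold_one (n := n) (M := M)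
  have h := mfderiv_extChartAt_self (I := 𝓡 n) (x := x)
  exact congrArg (fun L : EuclideanSpace ℝ (Fin n) →L[ℝ] EuclideanSpace ℝ (Fin n) => L u) h

theorem metricInChart_self (K : Metric n M) (x : M) (u v : EuclideanSpace ℝ (Fin n)) :
    metricInChart K x (extChartAt (𝓡 n) x x) u v = K.inner x u v := by
  have h : ∀ z : M, z = x → ∀ u v : EuclideanSpace ℝ (Fin n), K.inner z u v = K.inner x u v := by
    rintro _ rfl u v
    rfl
  rw [metricInChart_apply]
  refine (h _ (symm_extChartAt_self x) _ _).trans ?_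
  exact congrArg₂ (fun a b : EuclideanSpace ℝ (Fin n) => K.inner x a b) (chartD_self x u)
    (chartD_self x v)

theorem inChart_self {k : ℕ} (α : DiffForm n M k) (x : M) (v : Fin k → EuclideanSpace ℝ (Fin n)) :
    α.inChart x (extChartAt (𝓡 n) x x) v = α x v := by
  have h : ∀ z : M, z = x → ∀ v : Fin k → EuclideanSpace ℝ (Fin n), α z v = α x v := by
    rintro _ rfl u
    rfl
  rw [inChart_apply]
  refine (h _ (symm_extChartAt_self x) _).trans ?_
  exact congrArg (fun a : Fin k → EuclideanSpace ℝ (Fin n) => α x a)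
    (funext fun i => chartD_self x (v i))

theorem d_apply {k : ℕ} (α : DiffForm n M k) (x : M)
    (v : Fin (k + 1) → EuclideanSpace ℝ (Fin n)) :
    α.d x v = extDeriv (α.inChart x) (extChartAt (𝓡 n) x x) v := by
  refine congrArg (fun a : Fin (k + 1) → EuclideanSpace ℝ (Fin n) =>
    extDeriv (α.inChart x) (extChartAt (𝓡 n) x x) a) ?_
  exact funext fun i => mfderiv_extChartAt_self_apply x (v i)

variable {k : ℕ} {N : Type v} [TopologicalSpace N] [ChartedSpace (EuclideanSpace ℝ (Fin k)) N]

omit [IsManifold (𝓡 n) ∞ M] in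
theorem contDiffAt_written {f : N → M} (hf : ContMDiff (𝓡 k) (𝓡 n) ∞ f) (x : N) :
    ContDiffAt ℝ 2 (writtenInExtChartAt (𝓡 k) (𝓡 n) x f) (extChartAt (𝓡 k) x x) := by
  have h := (contMDiffAt_iff.1 (hf x)).2
  rw [ModelWithCorners.Boundaryless.range_eq_univ, contDiffWithinAt_univ] at h
  exact h.of_le ENat.LEInfty.out

omit [IsManifold (𝓡 n) ∞ M] in
theorem fderiv_written {f : N → M} (hf : ContMDiff (𝓡 k) (𝓡 n) ∞ f) (x : N)
    (u : EuclideanSpace ℝ (Fin k)) :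
    @Eq (EuclideanSpace ℝ (Fin n))
      (fderiv ℝ (writtenInExtChartAt (𝓡 k) (𝓡 n) x f) (extChartAt (𝓡 k) x x) u)
      (mfderiv (𝓡 k) (𝓡 n) f x u) := by
  have h := ((hf x).mdifferentiableAt (by simp)).mfderiv
  rw [ModelWithCorners.Boundaryless.range_eq_univ, fderivWithin_univ] at h
  exact congrArg (fun L : EuclideanSpace ℝ (Fin k) →L[ℝ] EuclideanSpace ℝ (Fin n) => L u) h.symm

/-- The expression of `f` in charts maps the tangent spaces to the tangent spaces of the
submanifold. -/
theorem eventually_tangent [IsManifold (𝓡 k) ∞ N] {f : N → M} (hf : ContMDiff (𝓡 k) (𝓡 n) ∞ f) (x : N)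
    (P : N → ∀ z : M, Submodule ℝ (TangentSpace (𝓡 n) z) → Prop)
    (hP : ∀ x', P x' (f x') (tangent n k f x')) :
    ∀ᶠ s in 𝓝 (extChartAt (𝓡 k) x x),
      P ((extChartAt (𝓡 k) x).symm s)
        ((extChartAt (𝓡 n) (f x)).symm (writtenInExtChartAt (𝓡 k) (𝓡 n) x f s))
        (LinearMap.range ((chartD (f x) (writtenInExtChartAt (𝓡 k) (𝓡 n) x f s)).comp
          (fderiv ℝ (writtenInExtChartAt (𝓡 k) (𝓡 n) x f) s)).toLinearMap) := by
  set F := writtenInExtChartAt (𝓡 k) (𝓡 n) x f with hF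
  set ψ := (extChartAt (𝓡 k) x).symm with hψ
  have h1 : ∀ᶠ s in 𝓝 (extChartAt (𝓡 k) x x), s ∈ (extChartAt (𝓡 k) x).target :=
    extChartAt_target_mem_nhds x
  have hc : ContinuousAt (fun s => f (ψ s)) (extChartAt (𝓡 k) x x) := by
    refine ContinuousAt.comp (g := f) hf.continuous.continuousAt (continuousAt_extChartAt_symm x)
  have h2 : ∀ᶠ s in 𝓝 (extChartAt (𝓡 k) x x), f (ψ s) ∈ (extChartAt (𝓡 n) (f x)).source := by
    refine hc.eventually (extChartAt_source_mem_nhds' ?_)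
    change f (ψ _) ∈ _
    rw [hψ, symm_extChartAt_self]
    exact mem_extChartAt_source _
  filter_upwards [h1.eventually_nhds, h2.eventually_nhds] with s hs1 hs2
  have e1 : ∀ᶠ r in 𝓝 s, (extChartAt (𝓡 n) (f x)).symm (F r) = f (ψ r) := by
    filter_upwards [hs2] with r hr
    exact (extChartAt (𝓡 n) (f x)).left_inv hr
  have hs1 := hs1.self_of_nhds
  have hs2 := hs2.self_of_nhds
  have m1 : MDifferentiableAt 𝓘(ℝ, EuclideanSpace ℝ (Fin k)) (𝓡 k) ψ s :=
    ((contMDiffOn_extChartAt_symm (n := ∞) x).contMDiffAt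
      ((isOpen_extChartAt_target x).mem_nhds hs1)).mdifferentiableAt (by simp)
  have m2 : MDifferentiableAt (𝓡 k) (𝓡 n) f (ψ s) := (hf (ψ s)).mdifferentiableAt (by simp)
  have m3 : MDifferentiableAt (𝓡 n) 𝓘(ℝ, EuclideanSpace ℝ (Fin n)) (extChartAt (𝓡 n) (f x))
      (f (ψ s)) := ((contMDiffOn_extChartAt (n := ∞) (x := f x)).contMDiffAt
      ((chartAt _ (f x)).open_source.mem_nhds (by rwa [extChartAt_source] at hs2))).mdifferentiableAt (by simp)
  have m4 : MDifferentiableAt 𝓘(ℝ, EuclideanSpace ℝ (Fin k)) 𝓘(ℝ, EuclideanSpace ℝ (Fin n)) F s :=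
    m3.comp s (m2.comp s m1)
  have hFs : F s ∈ (extChartAt (𝓡 n) (f x)).target := (extChartAt (𝓡 n) (f x)).map_source hs2
  have m5 : MDifferentiableAt 𝓘(ℝ, EuclideanSpace ℝ (Fin n)) (𝓡 n) (extChartAt (𝓡 n) (f x)).symm
      (F s) := ((contMDiffOn_extChartAt_symm (n := ∞) (f x)).contMDiffAt
      ((isOpen_extChartAt_target (f x)).mem_nhds hFs)).mdifferentiableAt (by simp)
  -- The same map is differentiated by the chain rule in two ways, as the inverse chart of `M` after
  -- `F` and as `f` after the inverse chart of `N`. The differential of the latter chart is onto, so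
  -- it does not change the range.
  have d1 := HasMFDerivAt.comp s m5.hasMFDerivAt m4.hasMFDerivAt
  have d2 := HasMFDerivAt.comp s m2.hasMFDerivAt m1.hasMFDerivAt
  have d3 := d2.congr_of_eventuallyEq e1
  have d4 := hasMFDerivAt_unique d1 d3
  rw [mfderiv_eq_fderiv] at d4
  have hz : (extChartAt (𝓡 n) (f x)).symm (F s) = f (ψ s) := e1.self_of_nhds
  have key : @Eq (Submodule ℝ (EuclideanSpace ℝ (Fin n)))
      (LinearMap.range ((chartD (f x) (F s)).comp (fderiv ℝ F s)).toLinearMap)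
      (tangent n k f (ψ s)) := by
    have h5 : @Eq (Submodule ℝ (EuclideanSpace ℝ (Fin n)))
      (LinearMap.range ((chartD (f x) (F s)).comp (fderiv ℝ F s)).toLinearMap)
      (LinearMap.range ((mfderiv (𝓡 k) (𝓡 n) f (ψ s)).comp (chartD x s)).toLinearMap) :=
      congrArg (fun L : EuclideanSpace ℝ (Fin k) →L[ℝ] EuclideanSpace ℝ (Fin n) =>
        LinearMap.range L.toLinearMap) d4
    rw [h5]
    exact LinearMap.range_comp_of_range_eq_top _
      (LinearMap.range_eq_top.2 (chartD_bijective x hs1).2)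
  -- Subspaces over different base points have different types; generalising point and subspace
  -- together permits the substitution.
  have trans : ∀ z : M, z = f (ψ s) → ∀ W : Submodule ℝ (EuclideanSpace ℝ (Fin n)),
      @Eq (Submodule ℝ (EuclideanSpace ℝ (Fin n))) W (tangent n k f (ψ s)) → P (ψ s) z W := by
    rintro _ rfl W rfl
    exact hP _
  exact trans _ hz _ key

end Transfer

/-! ### Closure under the cross product as vanishing of the form. -/

section Pointwise

set_option maxSynthPendingDepth 3

open Filter Topology Function

variable {n : ℕ} {M : Type u} [TopologicalSpace M] [ChartedSpace (EuclideanSpace ℝ (Fin n)) M]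
  [IsManifold (𝓡 n) ∞ M] {𝔤 : Type w} [LieRing 𝔤] [LieAlgebra ℝ 𝔤] {ω₃ : DiffForm n M 3}
  {K : Metric n M} {hωK : IsCartanPair 𝔤 ω₃ K}

/-- The value equals `-⟨Z, [u, v]⟩`, and `[u, v]` stays in `W`. -/
theorem IsStrongAt.form_eq_zero {z : M} {W : Submodule ℝ (TangentSpace (𝓡 n) z)}
    (h : IsStrongAt hωK z W) {u v Z : TangentSpace (𝓡 n) z} (hu : u ∈ W) (hv : v ∈ W)
    (hZ : ∀ t ∈ W, K.inner z Z t = 0) : ω₃ z ![Z, u, v] = 0 := by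
  have h1 := hZ _ (h.1 u hu v hv)
  rw [bracket, (hωK z).choose_spec.2, LinearEquiv.apply_symm_apply] at h1
  rw [(hωK z).choose_spec.1, cartanForm]
  linarith

omit [IsManifold (𝓡 n) ∞ M] in
theorem inChart_vec₃ (ω₃ : DiffForm n M 3) (x₀ : M) (y u v z : EuclideanSpace ℝ (Fin n)) :
    ω₃.inChart x₀ y ![u, v, z] = ω₃ _ ![chartD x₀ y u, chartD x₀ y v, chartD x₀ y z] := by
  rw [inChart_apply]
  congr 1
  ext1 i
  fin_cases i <;> rfl

theorem chartD_mem_orthogonal {k : ℕ} {x₀ : M} {y : EuclideanSpace ℝ (Fin n)}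
    {L : EuclideanSpace ℝ (Fin k) →L[ℝ] EuclideanSpace ℝ (Fin n)}
    {a : Fin k → EuclideanSpace ℝ (Fin k)} (ha : ⊤ ≤ Submodule.span ℝ (Set.range a))
    {Z : EuclideanSpace ℝ (Fin n)} (hZ : ∀ j, metricInChart K x₀ y Z (L (a j)) = 0) :
    chartD x₀ y Z ∈ orthogonal K _ (LinearMap.range ((chartD x₀ y).comp L).toLinearMap) := by
  rintro _ ⟨c, rfl⟩
  change K.inner _ (chartD x₀ y Z) (chartD x₀ y (L c)) = 0
  rw [← metricInChart_apply]
  have hc : c ∈ Submodule.span ℝ (Set.range a) := ha Submodule.mem_top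
  induction hc using Submodule.span_induction with
  | mem x hx => obtain ⟨j, rfl⟩ := hx; exact hZ j
  | zero => simp
  | add x y _ _ hx hy => rw [map_add, map_add, hx, hy, add_zero]
  | smul c x _ hx => rw [map_smul, map_smul, hx, smul_zero]

theorem IsStrongAt.inChart_tangent {k : ℕ} {x₀ : M} {y : EuclideanSpace ℝ (Fin n)}
    {L : EuclideanSpace ℝ (Fin k) →L[ℝ] EuclideanSpace ℝ (Fin n)}
    (h : IsStrongAt hωK _ (LinearMap.range ((chartD x₀ y).comp L).toLinearMap))
    {a : Fin k → EuclideanSpace ℝ (Fin k)} (ha : ⊤ ≤ Submodule.span ℝ (Set.range a))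
    {Z : EuclideanSpace ℝ (Fin n)} (hZ : ∀ j, metricInChart K x₀ y Z (L (a j)) = 0) (i j : Fin k) :
    ω₃.inChart x₀ y ![L (a i), L (a j), Z] = 0 := by
  rw [inChart_vec₃]
  refine (map_rotate (ω₃ _).toAlternatingMap (chartD x₀ y Z) _ _).trans ?_
  exact h.form_eq_zero ⟨a i, rfl⟩ ⟨a j, rfl⟩ (chartD_mem_orthogonal ha hZ)

theorem IsStrongAt.inChart_normal {k : ℕ} {x₀ : M} {y : EuclideanSpace ℝ (Fin n)}
    {L : EuclideanSpace ℝ (Fin k) →L[ℝ] EuclideanSpace ℝ (Fin n)}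
    (h : IsStrongAt hωK _
      (orthogonal K _ (LinearMap.range ((chartD x₀ y).comp L).toLinearMap)))
    {a : Fin k → EuclideanSpace ℝ (Fin k)} (ha : ⊤ ≤ Submodule.span ℝ (Set.range a))
    {Z Z' : EuclideanSpace ℝ (Fin n)} (hZ : ∀ j, metricInChart K x₀ y Z (L (a j)) = 0)
    (hZ' : ∀ j, metricInChart K x₀ y Z' (L (a j)) = 0) (i : Fin k) :
    ω₃.inChart x₀ y ![L (a i), Z, Z'] = 0 := by
  rw [inChart_vec₃]
  refine h.form_eq_zero (chartD_mem_orthogonal ha hZ) (chartD_mem_orthogonal ha hZ') ?_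
  intro t ht
  rw [K.symm]
  exact ht _ ⟨a i, rfl⟩

end Pointwise

/-! ### The mean curvature paired with a normal vector. -/

section MeanCurvature

set_option maxSynthPendingDepth 3

open Filter Topology Function

variable {n : ℕ} {M : Type u} [TopologicalSpace M] [ChartedSpace (EuclideanSpace ℝ (Fin n)) M]
  [IsManifold (𝓡 n) ∞ M] {k : ℕ} {N : Type v} [TopologicalSpace N]
  [ChartedSpace (EuclideanSpace ℝ (Fin k)) N]

theorem inner_normalPart (K : Metric n M) (x : M) (W : Submodule ℝ (TangentSpace (𝓡 n) x))
    (v : TangentSpace (𝓡 n) x) {X : TangentSpace (𝓡 n) x} (hX : ∀ u ∈ W, K.inner x u X = 0) :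
    K.inner x (normalPart K x W v) X = K.inner x v X := by
  have h := hX _ (normalPart_spec K x W v).1
  rw [map_sub, sub_apply, sub_eq_zero] at h
  exact h.symm

theorem christoffel_apply (K : Metric n M) (x₀ : M) (y u v w : EuclideanSpace ℝ (Fin n)) :
    christoffel K x₀ y u v w = 2⁻¹ * (fderiv ℝ (metricInChart K x₀) y u v w
      + fderiv ℝ (metricInChart K x₀) y v u w - fderiv ℝ (metricInChart K x₀) y w u v) := rfl

theorem inner_secondFundamentalForm (K : Metric n M) {f : N → M} (x : N)
    (u v : EuclideanSpace ℝ (Fin k)) {X : EuclideanSpace ℝ (Fin n)}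
    (hX : ∀ u ∈ tangent n k f x, K.inner (f x) u X = 0) :
    K.inner (f x) (secondFundamentalForm K f x u v) X =
      metricInChart K (f x) (extChartAt (𝓡 n) (f x) (f x))
        (fderiv ℝ (fderiv ℝ (writtenInExtChartAt (𝓡 k) (𝓡 n) x f)) (extChartAt (𝓡 k) x x) u v) X
      + christoffel K (f x) (extChartAt (𝓡 n) (f x) (f x))
        (fderiv ℝ (writtenInExtChartAt (𝓡 k) (𝓡 n) x f) (extChartAt (𝓡 k) x x) u)
        (fderiv ℝ (writtenInExtChartAt (𝓡 k) (𝓡 n) x f) (extChartAt (𝓡 k) x x) v) X := by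
  have hadd : ∀ (z : M) (a b X : TangentSpace (𝓡 n) z),
      K.inner z (a + b) X = K.inner z a X + K.inner z b X := fun z a b X => by
    rw [map_add, add_apply]
  refine (inner_normalPart K _ _ _ hX).trans ((hadd _ _ _ _).trans ?_)
  refine congrArg₂ (· + ·) ?_ ?_
  · rw [metricInChart_self]
    exact congrArg (fun a : EuclideanSpace ℝ (Fin n) => K.inner (f x) a X) (chartD_self (f x) _)
  · exact (inner_sharp K _ _ X).trans
      (congrArg (christoffel K (f x) (extChartAt (𝓡 n) (f x) (f x)) _ _)
        (mfderiv_extChartAt_self_apply (f x) X))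

/-- The trace through the inverse of the first fundamental form equals the sum over an orthonormal
basis. The right side is the expression that occurs in `extDeriv_calibration`. -/
theorem inner_meanCurvature [IsManifold (𝓡 k) ∞ N] (K : Metric n M) {f : N → M} (x : N)
    (hinj : Injective (mfderiv (𝓡 k) (𝓡 n) f x))
    (hF : ∀ u : EuclideanSpace ℝ (Fin k), @Eq (EuclideanSpace ℝ (Fin n))
      (fderiv ℝ (writtenInExtChartAt (𝓡 k) (𝓡 n) x f) (extChartAt (𝓡 k) x x) u)
      (mfderiv (𝓡 k) (𝓡 n) f x u))
    {a : Fin k → EuclideanSpace ℝ (Fin k)} {e : Fin k → EuclideanSpace ℝ (Fin n)}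
    (hea : ∀ i, mfderiv (𝓡 k) (𝓡 n) f x (a i) = e i) (he : IsOrthonormal K (f x) e)
    (has : ⊤ ≤ Submodule.span ℝ (Set.range a))
    {X : EuclideanSpace ℝ (Fin n)} (hX : ∀ u ∈ tangent n k f x, K.inner (f x) u X = 0) :
    K.inner (f x) (meanCurvature k K f x) X =
      ∑ j, (metricInChart K (f x) (extChartAt (𝓡 n) (f x) (f x))
        (fderiv ℝ (fderiv ℝ (writtenInExtChartAt (𝓡 k) (𝓡 n) x f)) (extChartAt (𝓡 k) x x)
          (a j) (a j)) X
      + fderiv ℝ (metricInChart K (f x)) (extChartAt (𝓡 n) (f x) (f x)) (e j) (e j) X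
      - 2⁻¹ * fderiv ℝ (metricInChart K (f x)) (extChartAt (𝓡 n) (f x) (f x)) X (e j) (e j)) := by
  set F := writtenInExtChartAt (𝓡 k) (𝓡 n) x f
  set p := extChartAt (𝓡 k) x x
  set q := extChartAt (𝓡 n) (f x) (f x)
  let Df : EuclideanSpace ℝ (Fin k) →L[ℝ] EuclideanSpace ℝ (Fin n) := mfderiv (𝓡 k) (𝓡 n) f x
  let Kx : EuclideanSpace ℝ (Fin n) →L[ℝ] EuclideanSpace ℝ (Fin n) →L[ℝ] ℝ := K.inner (f x)
  let g₀ : EuclideanSpace ℝ (Fin k) →ₗ[ℝ] EuclideanSpace ℝ (Fin k) →ₗ[ℝ] ℝ :=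
    (lin₂ Kx).compl₁₂ Df.toLinearMap Df.toLinearMap
  let ψ : EuclideanSpace ℝ (Fin k) → EuclideanSpace ℝ (Fin k) → ℝ := fun u v =>
    metricInChart K (f x) q (fderiv ℝ (fderiv ℝ F) p u v) X
      + christoffel K (f x) q (fderiv ℝ F p u) (fderiv ℝ F p v) X
  let c : Basis (Fin k) ℝ (EuclideanSpace ℝ (Fin k)) :=
    (EuclideanSpace.basisFun (Fin k) ℝ).toBasis
  have hc : ∀ i, c i = EuclideanSpace.single i 1 := fun i => by simp [c]
  set G := firstFundamentalForm (k := k) K f x with hG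
  have hGij : ∀ i j, G i j = g₀ (c i) (c j) := by
    intro i j
    rw [hc, hc]
    have : ∀ i, @Eq (EuclideanSpace ℝ (Fin k)) (mfderiv 𝓘(ℝ, EuclideanSpace ℝ (Fin k)) (𝓡 k)
      (extChartAt (𝓡 k) x).symm p (EuclideanSpace.single i 1)) (EuclideanSpace.single i 1) :=
      fun i => chartD_self x _
    exact congrArg₂ (fun u v => g₀ u v) (this i) (this j)
  have hGdet : IsUnit G.det := by
    rw [isUnit_iff_ne_zero]
    -- A null vector of `G` would give a nonzero tangent vector of length zero, against the
    -- immersion hypothesis.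
    intro h0
    obtain ⟨v, hv, hGv⟩ := Matrix.exists_mulVec_eq_zero_iff.2 h0
    have h1 : g₀ (∑ i, v i • c i) (∑ i, v i • c i) = dotProduct v (G.mulVec v) := by
      simp only [map_sum, map_smul, LinearMap.sum_apply, LinearMap.smul_apply, smul_eq_mul,
        dotProduct, Matrix.mulVec, hGij, Finset.mul_sum]
      exact Finset.sum_comm.trans (Finset.sum_congr rfl fun i _ => Finset.sum_congr rfl
        fun j _ => by ring)
    rw [hGv, dotProduct_zero] at h1
    have h2 : ∑ i, v i • c i ≠ 0 := fun h => hv (funext fun i =>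
      Fintype.linearIndependent_iff.1 c.linearIndependent v h i)
    have h3 : Df (∑ i, v i • c i) ≠ 0 := fun h => h2 (hinj (h.trans (map_zero Df).symm))
    exact (K.pos (f x) (Df (∑ i, v i • c i)) h3).ne' h1
  -- The basis dual to `c` for the pulled-back metric, as `sum_orthonormal_eq` requires.
  let r : Fin k → EuclideanSpace ℝ (Fin k) := fun j => ∑ i, G⁻¹ j i • c i
  have hr : ∀ j v, g₀ (r j) v = c.coord j v := by
    intro j
    suffices g₀ (r j) = c.coord j from fun v => by rw [this]
    refine c.ext fun l => ?_
    have : g₀ (r j) (c l) = (G⁻¹ * G) j l := by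
      simp only [r, map_sum, map_smul, LinearMap.sum_apply, LinearMap.smul_apply, smul_eq_mul,
        Matrix.mul_apply, hGij]
    rw [this, Matrix.nonsing_inv_mul G hGdet, Matrix.one_apply]
    simp [Finsupp.single_apply, eq_comm]
  have ha : IsOrtho g₀ a := fun i j => by
    refine Eq.trans ?_ (he i j)
    exact congrArg₂ (fun u v : EuclideanSpace ℝ (Fin n) => Kx u v) (hea i) (hea j)
  have h1 := sum_orthonormal_eq ha has c r hr ψ
    (fun v => ⟨fun u u' => by simp only [ψ, map_add, add_apply, christoffel_apply]; ring,
      fun t u => by simp only [ψ, map_smul, smul_apply, smul_eq_mul, christoffel_apply]; ring⟩)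
    (fun u => ⟨fun v v' => by simp only [ψ, map_add, add_apply, christoffel_apply]; ring,
      fun t v => by simp only [ψ, map_smul, smul_apply, smul_eq_mul, christoffel_apply]; ring⟩)
  have h2 : ∀ i j, K.inner (f x) (secondFundamentalForm K f x (EuclideanSpace.single i 1)
      (EuclideanSpace.single j 1)) X = ψ (c i) (c j) := fun i j => by
    rw [hc, hc]
    exact inner_secondFundamentalForm K x _ _ hX
  have hlin : ∀ u, IsLinearMap ℝ (ψ u) := fun u =>
    ⟨fun v v' => by simp only [ψ, map_add, add_apply, christoffel_apply]; ring,
      fun t v => by simp only [ψ, map_smul, smul_apply, smul_eq_mul, christoffel_apply]; ring⟩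
  have h3 : K.inner (f x) (meanCurvature k K f x) X = ∑ i, ψ (c i) (r i) := by
    let ℓ : EuclideanSpace ℝ (Fin n) →ₗ[ℝ] ℝ := (lin₂ Kx).flip X
    let II : Fin k → Fin k → EuclideanSpace ℝ (Fin n) := fun i j =>
      secondFundamentalForm K f x (EuclideanSpace.single i 1) (EuclideanSpace.single j 1)
    have h2' : ∀ i j, ℓ (II i j) = ψ (c i) (c j) := h2
    change ℓ (∑ i, ∑ j, G⁻¹ i j • II i j) = _
    simp only [map_sum, map_smul, h2', smul_eq_mul]
    refine Finset.sum_congr rfl fun i _ => ?_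
    have h4 := map_sum (hlin (c i)).mk' (fun j => G⁻¹ i j • c j) Finset.univ
    simp only [map_smul, IsLinearMap.mk'_apply, smul_eq_mul] at h4
    exact h4.symm
  rw [h3, ← h1]
  refine Finset.sum_congr rfl fun j _ => ?_
  have h5 : fderiv ℝ F p (a j) = e j := (hF (a j)).trans (hea j)
  -- On the diagonal the first two Christoffel terms coincide, which leaves `∂_e g(e, X) - ½ ∂_X
  -- g(e, e)`.
  simp only [ψ, christoffel_apply, h5]
  ring

end MeanCurvature

/-! ### The constant attached to a Lie type. -/

section LieType

variable {𝔤 : Type w} [LieRing 𝔤] [LieAlgebra ℝ 𝔤]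

/-- The square of `ω_𝔤` on `𝔥` is `s` times the Gram determinant for minus the Killing form.
This determines `s` if `𝔥` is 3-dimensional and the Killing form is negative definite. -/
def HasRatio (𝔥 : LieSubalgebra ℝ 𝔤) (s : ℝ) : Prop :=
  ∀ ν : Fin 3 → 𝔤, (∀ i, ν i ∈ 𝔥) →
    cartanForm (ν 0) (ν 1) (ν 2) ^ 2 = s * (gram (-killingForm ℝ 𝔤) ν).det

theorem HasRatio.map {𝔥 : LieSubalgebra ℝ 𝔤} {s : ℝ} (h : HasRatio 𝔥 s) (φ : 𝔤 ≃ₗ⁅ℝ⁆ 𝔤) :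
    HasRatio (𝔥.map φ.toLieHom) s := by
  intro ν hν
  choose η hη hην using hν
  have hην : ∀ i, φ (η i) = ν i := hην
  have h1 := h η hη
  have h2 : gram (-killingForm ℝ 𝔤) η = gram (-killingForm ℝ 𝔤) ν := by
    ext i j
    simp [gram, ← hην]
  rw [h2] at h1
  rw [← h1]
  simp only [cartanForm, ← hην, ← LieEquiv.map_lie, LieAlgebra.killingForm_of_equiv_apply]

theorem hasRatio_map_iff (𝔥 : LieSubalgebra ℝ 𝔤) (s : ℝ) (φ : 𝔤 ≃ₗ⁅ℝ⁆ 𝔤) :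
    HasRatio (𝔥.map φ.toLieHom) s ↔ HasRatio 𝔥 s := by
  refine ⟨fun h => ?_, fun h => h.map φ⟩
  have h1 : HasRatio ((𝔥.map φ.toLieHom).map φ.symm.toLieHom) s := h.map φ.symm
  have h2 : (𝔥.map φ.toLieHom).map φ.symm.toLieHom = 𝔥 := by
    ext z
    constructor
    · rintro ⟨_, ⟨y, hy, rfl⟩, rfl⟩
      have : φ.symm (φ y) = y := φ.symm_apply_apply y
      exact this.symm ▸ hy
    · intro hz
      exact ⟨φ z, ⟨z, hz, rfl⟩, φ.symm_apply_apply z⟩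
  rwa [h2] at h1

/-- The positive function of the ratio `s` in `HasRatio` that gives the constants. -/
def ratioConst (s : ℝ) : ℝ := if 0 < s then (√s)⁻¹ else 1

theorem ratioConst_pos (s : ℝ) : 0 < ratioConst s := by
  unfold ratioConst
  split_ifs with h
  · positivity
  · exact one_pos

/-- Applied with `t` the positive value of the critical form on an oriented orthonormal basis, up to
the orientation sign. The value `1` of `ratioConst` at `s ≤ 0` is a default that keeps the constant
positive on every subalgebra. -/
theorem ratioConst_sq_mul {t : ℝ} (ht : 0 < t) : ratioConst (t ^ 2) * t = 1 := by
  rw [ratioConst, if_pos (by positivity), Real.sqrt_sq ht.le, inv_mul_cancel₀ ht.ne']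

/-- The constant of a Lie subalgebra of `𝔤`. -/
def lieTypeConst (𝔥 : LieSubalgebra ℝ 𝔤) : ℝ := ratioConst (Classical.epsilon (HasRatio 𝔥))

/-- Automorphisms preserve bracket and Killing form, hence the predicate `HasRatio`, and
`Classical.epsilon` takes the same value on equal predicates. Existence or uniqueness of the ratio
plays no role here. -/
theorem isLieTypeConstant_lieTypeConst : IsLieTypeConstant 𝔤 lieTypeConst := by
  refine ⟨fun 𝔥 => ratioConst_pos _, fun φ 𝔥 => ?_⟩
  have : HasRatio (𝔥.map φ.toLieHom) = HasRatio 𝔥 :=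
    funext fun s => propext (hasRatio_map_iff 𝔥 s φ)
  rw [lieTypeConst, lieTypeConst, this]

variable {n : ℕ} {M : Type u} [TopologicalSpace M] [ChartedSpace (EuclideanSpace ℝ (Fin n)) M]
  [IsManifold (𝓡 n) ∞ M]

/-- The square of `ω₃` on `W` is `s` times the Gram determinant. -/
def HasRatioAt (ω₃ : DiffForm n M 3) (K : Metric n M) (z : M)
    (W : Submodule ℝ (TangentSpace (𝓡 n) z)) (s : ℝ) : Prop :=
  ∀ ν : Fin 3 → TangentSpace (𝓡 n) z, (∀ i, ν i ∈ W) →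
    ω₃ z ν ^ 2 = s * (gram (bilin K z) ν).det

/-- The factor in `HasRatioAt`. -/
def ratioAt (ω₃ : DiffForm n M 3) (K : Metric n M) (z : M)
    (W : Submodule ℝ (TangentSpace (𝓡 n) z)) : ℝ := Classical.epsilon (HasRatioAt ω₃ K z W)

variable {ω₃ : DiffForm n M 3} {K : Metric n M} {z : M}
  {W : Submodule ℝ (TangentSpace (𝓡 n) z)}

/-- An adapted frame identifies the predicates on `𝔥` and on `W`, so the constant can be read off
from the form and the metric at `z`. -/
theorem HasLieType.lieTypeConst_eq {𝔥 : LieSubalgebra ℝ 𝔤} (h : HasLieType ω₃ K z W 𝔥) :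
    lieTypeConst 𝔥 = ratioConst (ratioAt ω₃ K z W) := by
  obtain ⟨I, hI, hW⟩ := h
  have hmem : ∀ v, I v ∈ 𝔥 ↔ v ∈ W := fun v => by
    rw [← LieSubalgebra.mem_toSubmodule, ← hW]
    exact ⟨fun ⟨u, hu, huv⟩ => I.injective huv ▸ hu, fun hv => ⟨v, hv, rfl⟩⟩
  have hform : ∀ ν : Fin 3 → TangentSpace (𝓡 n) z,
      cartanForm (I (ν 0)) (I (ν 1)) (I (ν 2)) = ω₃ z ν := fun ν => by
    rw [← hI.1]
    congr 1
    ext1 i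
    fin_cases i <;> rfl
  have hgram : ∀ ν : Fin 3 → TangentSpace (𝓡 n) z,
      gram (-killingForm ℝ 𝔤) (fun i => I (ν i)) = gram (bilin K z) ν := fun ν => by
    ext i j
    exact (hI.2 _ _).symm
  have : HasRatio 𝔥 = HasRatioAt ω₃ K z W := by
    funext s
    refine propext ⟨fun h ν hν => ?_, fun h ν hν => ?_⟩
    · rw [← hform, ← hgram]
      exact h (fun i => I (ν i)) fun i => (hmem _).2 (hν i)
    · have hν' : (fun i => I (I.symm (ν i))) = ν := funext fun i => I.apply_symm_apply _
      have h1 := h (fun i => I.symm (ν i)) fun i => (hmem _).1 (by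
        rw [I.apply_symm_apply]; exact hν i)
      rw [← hform, ← hgram, hν'] at h1
      simpa using h1
  rw [lieTypeConst, ratioAt, this]

theorem hasRatioAt_of_isOrthonormal {f : Fin 3 → TangentSpace (𝓡 n) z}
    (hf : IsOrthonormal K z f) (hfW : W ≤ Submodule.span ℝ (Set.range f)) :
    HasRatioAt ω₃ K z W (ω₃ z f ^ 2) := fun _ hν =>
  map_sq_eq (g := bilin K z) (ω₃ z).toAlternatingMap (f := f) hf fun i => hfW (hν i)

theorem ratioAt_eq {f : Fin 3 → TangentSpace (𝓡 n) z} (hf : IsOrthonormal K z f)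
    (hfW : Submodule.span ℝ (Set.range f) = W) : ratioAt ω₃ K z W = ω₃ z f ^ 2 := by
  have h1 : HasRatioAt ω₃ K z W (ratioAt ω₃ K z W) :=
    Classical.epsilon_spec ⟨_, hasRatioAt_of_isOrthonormal hf hfW.ge⟩
  have h2 := h1 f fun i => hfW.le (Submodule.subset_span ⟨i, rfl⟩)
  have h3 : gram (bilin K z) f = 1 := gram_eq_one (g := bilin K z) hf
  rw [h3, Matrix.det_one, mul_one] at h2
  exact h2.symm

theorem hasRatioAt_ratioAt (hW : finrank ℝ W = 3) :
    HasRatioAt ω₃ K z W (ratioAt ω₃ K z W) := by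
  obtain ⟨b, hb⟩ := exists_orthonormal_basis ((bilin K z).domRestrict₁₂ W W)
    (fun u v => K.symm z u v) (fun u hu => K.pos z u (by simpa using hu)) hW
  refine Classical.epsilon_spec
    ⟨_, hasRatioAt_of_isOrthonormal (f := fun i => (b i : TangentSpace (𝓡 n) z)) hb ?_⟩
  intro v hv
  have h1 := congrArg W.subtype (b.sum_repr ⟨v, hv⟩)
  simp only [map_sum, map_smul, Submodule.subtype_apply] at h1
  rw [← h1]
  exact Submodule.sum_mem _ fun i _ => Submodule.smul_mem _ _ (Submodule.subset_span ⟨i, rfl⟩)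

end LieType

/-! ### Stationary functions on a manifold. -/

section Constancy

open Filter Topology Function

variable {k : ℕ} {N : Type v} [TopologicalSpace N] [ChartedSpace (EuclideanSpace ℝ (Fin k)) N]
  [IsManifold (𝓡 k) ∞ N]

/-- A function whose expression in the preferred chart at every point is stationary at this point
is constant on connected components. -/
theorem eq_of_mem_connectedComponent {σ : N → ℝ}
    (h : ∀ x : N, HasFDerivAt (fun s => σ ((extChartAt (𝓡 k) x).symm s))
      (0 : EuclideanSpace ℝ (Fin k) →L[ℝ] ℝ) (extChartAt (𝓡 k) x x))
    {x y : N} (hy : y ∈ connectedComponent x) : σ x = σ y := by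
  have hσ : ∀ x : N, HasMFDerivAt (𝓡 k) 𝓘(ℝ, ℝ) σ x
      (0 : EuclideanSpace ℝ (Fin k) →L[ℝ] ℝ) := by
    intro x
    have h1 : MDifferentiableAt (𝓡 k) 𝓘(ℝ, EuclideanSpace ℝ (Fin k)) (extChartAt (𝓡 k) x) x :=
      ((contMDiffAt_extChartAt (n := ∞) (x := x))).mdifferentiableAt (by simp)
    have h2 := HasMFDerivAt.comp x (h x).hasMFDerivAt h1.hasMFDerivAt
    have h3 := h2.congr_of_eventuallyEq (f₁ := σ) (by
      filter_upwards [extChartAt_source_mem_nhds (I := 𝓡 k) x] with y hy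
      exact (congrArg σ ((extChartAt (𝓡 k) x).left_inv hy)).symm)
    exact (congrArg (fun L : EuclideanSpace ℝ (Fin k) →L[ℝ] ℝ => HasMFDerivAt (𝓡 k) 𝓘(ℝ, ℝ) σ x L)
      (ContinuousLinearMap.zero_comp _)).mp h3
  have hloc : IsLocallyConstant σ := by
    rw [IsLocallyConstant.iff_eventually_eq]
    intro x
    -- The hypothesis concerns each chart at its centre only. As a statement on manifold
    -- derivatives, `hσ` transfers to all points of one chart, where a ball is convex and a
    -- vanishing derivative gives constancy.
    obtain ⟨r, hr, hball⟩ := Metric.mem_nhds_iff.1 (extChartAt_target_mem_nhds (I := 𝓡 k) x)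
    have h1 : ∀ s ∈ Metric.ball (extChartAt (𝓡 k) x x) r,
        HasFDerivAt (fun s => σ ((extChartAt (𝓡 k) x).symm s))
          (0 : EuclideanSpace ℝ (Fin k) →L[ℝ] ℝ) s := by
      intro s hs
      have m1 : MDifferentiableAt 𝓘(ℝ, EuclideanSpace ℝ (Fin k)) (𝓡 k) (extChartAt (𝓡 k) x).symm s :=
        ((contMDiffOn_extChartAt_symm (n := ∞) x).contMDiffAt
          ((isOpen_extChartAt_target x).mem_nhds (hball hs))).mdifferentiableAt (by simp)
      have h2 := HasMFDerivAt.comp s (hσ _) m1.hasMFDerivAt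
      exact (congrArg (fun L : EuclideanSpace ℝ (Fin k) →L[ℝ] ℝ => HasFDerivAt
        (fun s => σ ((extChartAt (𝓡 k) x).symm s)) L s)
        (ContinuousLinearMap.zero_comp _)).mp h2.hasFDerivAt
    have h2 : ∀ s ∈ Metric.ball (extChartAt (𝓡 k) x x) r,
        σ ((extChartAt (𝓡 k) x).symm s) = σ x := by
      intro s hs
      have h3 := (convex_ball (extChartAt (𝓡 k) x x) r).is_const_of_fderivWithin_eq_zero (𝕜 := ℝ)
        (f := fun s => σ ((extChartAt (𝓡 k) x).symm s))
        (fun s hs => (h1 s hs).differentiableAt.differentiableWithinAt)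
        (fun s hs => by
          rw [fderivWithin_of_isOpen Metric.isOpen_ball hs]
          exact (h1 s hs).fderiv) hs (Metric.mem_ball_self hr)
      rw [h3, extChartAt_to_inv]
    filter_upwards [extChartAt_source_mem_nhds (I := 𝓡 k) x,
      (continuousAt_extChartAt (I := 𝓡 k) x).eventually (Metric.ball_mem_nhds _ hr)] with y h4 h5
    have h6 := h2 _ h5
    rwa [(extChartAt (𝓡 k) x).left_inv h4] at h6
  exact hloc.apply_eq_of_isPreconnected isPreconnected_connectedComponent
    mem_connectedComponent hy

end Constancy

/-! ### Orthonormal tangent frames and the contraction. -/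

section Transfer

set_option maxSynthPendingDepth 3

open Filter Topology Function

variable {n : ℕ} {M : Type u} [TopologicalSpace M] [ChartedSpace (EuclideanSpace ℝ (Fin n)) M]
  [IsManifold (𝓡 n) ∞ M] {𝔤 : Type w} [LieRing 𝔤] [LieAlgebra ℝ 𝔤]

theorem eventually_isAdapted {ω₃ : DiffForm n M 3} {K : Metric n M} (hωK : IsCartanPair 𝔤 ω₃ K)
    (x₀ : M) : ∀ᶠ y in 𝓝 (extChartAt (𝓡 n) x₀ x₀), ∃ J : EuclideanSpace ℝ (Fin n) ≃ₗ[ℝ] 𝔤,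
      IsAdapted (ω₃.inChart x₀ y) (metricInChart K x₀ y) J := by
  filter_upwards [extChartAt_target_mem_nhds (I := 𝓡 n) x₀] with y hy
  obtain ⟨J, hJ⟩ := hωK ((extChartAt (𝓡 n) x₀).symm y)
  exact ⟨_, hJ.inChart x₀ hy⟩

theorem HasRatioAt.inChart {ω₃ : DiffForm n M 3} {K : Metric n M} {x₀ : M}
    {y : EuclideanSpace ℝ (Fin n)}
    {W : Submodule ℝ (TangentSpace (𝓡 n) ((extChartAt (𝓡 n) x₀).symm y))} {s : ℝ}
    (h : HasRatioAt ω₃ K _ W s) {ν : Fin 3 → EuclideanSpace ℝ (Fin n)}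
    (hν : ∀ i, chartD x₀ y (ν i) ∈ W) :
    ω₃.inChart x₀ y ν ^ 2 = s * (gram (lin₂ (metricInChart K x₀ y)) ν).det := by
  rw [inChart_apply]
  exact h (fun i => chartD x₀ y (ν i)) hν

theorem isOrtho_metricInChart_self {K : Metric n M} {x : M} {k : ℕ}
    {e : Fin k → EuclideanSpace ℝ (Fin n)} (he : IsOrthonormal K x e) :
    IsOrtho (lin₂ (metricInChart K x (extChartAt (𝓡 n) x x))) e := fun i j => by
  rw [lin₂_apply, metricInChart_self]
  exact he i j

variable {k : ℕ} {N : Type v} [TopologicalSpace N] [ChartedSpace (EuclideanSpace ℝ (Fin k)) N]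

omit [IsManifold (𝓡 n) ∞ M] in
theorem finrank_tangent {f : N → M} {x : N} (hinj : Injective (mfderiv (𝓡 k) (𝓡 n) f x)) :
    finrank ℝ (tangent n k f x) = k :=
  (LinearMap.finrank_range_of_inj hinj).trans (finrank_euclideanSpace_fin (𝕜 := ℝ) (n := k))

theorem exists_orthonormal_tangent (K : Metric n M) {f : N → M} {x : N}
    (hinj : Injective (mfderiv (𝓡 k) (𝓡 n) f x)) :
    ∃ e : Fin k → TangentSpace (𝓡 n) (f x), (∀ i, e i ∈ tangent n k f x) ∧
      IsOrthonormal K (f x) e := by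
  obtain ⟨b, hb⟩ := exists_orthonormal_basis
    ((bilin K (f x)).domRestrict₁₂ (tangent n k f x) (tangent n k f x))
    (fun u v => K.symm (f x) u v) (fun u hu => K.pos (f x) u (by simpa using hu))
    (finrank_tangent hinj)
  exact ⟨fun i => b i, fun i => (b i).2, hb⟩

theorem exists_lift {K : Metric n M} {f : N → M} {x : N}
    {e : Fin k → TangentSpace (𝓡 n) (f x)} (he : ∀ i, e i ∈ tangent n k f x)
    (heo : IsOrthonormal K (f x) e) :
    ∃ a : Fin k → EuclideanSpace ℝ (Fin k), (∀ i, mfderiv (𝓡 k) (𝓡 n) f x (a i) = e i) ∧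
      ⊤ ≤ Submodule.span ℝ (Set.range a) := by
  choose a ha using he
  have ha : ∀ i, mfderiv (𝓡 k) (𝓡 n) f x (a i) = e i := ha
  refine ⟨a, ha, ?_⟩
  have h1 : LinearIndependent ℝ e := IsOrtho.linearIndependent (g := bilin K (f x)) heo
  let D : EuclideanSpace ℝ (Fin k) →ₗ[ℝ] EuclideanSpace ℝ (Fin n) :=
    (mfderiv (𝓡 k) (𝓡 n) f x).toLinearMap
  have h2 : LinearIndependent ℝ (D ∘ a) := by
    have : (D ∘ a) = e := funext ha
    rw [this]
    exact h1
  have h3 : LinearIndependent ℝ a := h2.of_comp D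
  exact (h3.span_eq_top_of_card_eq_finrank' (by
    rw [Fintype.card_fin]
    exact (finrank_euclideanSpace_fin (𝕜 := ℝ) (n := k)).symm)).ge

theorem span_eq_tangent {K : Metric n M} {f : N → M} {x : N}
    (hinj : Injective (mfderiv (𝓡 k) (𝓡 n) f x))
    {e : Fin k → TangentSpace (𝓡 n) (f x)} (he : ∀ i, e i ∈ tangent n k f x)
    (heo : IsOrthonormal K (f x) e) : Submodule.span ℝ (Set.range e) = tangent n k f x := by
  refine Submodule.eq_of_le_of_finrank_eq (Submodule.span_le.2 ?_) ?_
  · rintro _ ⟨i, rfl⟩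
    exact he i
  · rw [finrank_tangent hinj]
    exact finrank_span_of_isOrtho (g := bilin K (f x)) heo

theorem map_snoc {V : Type*} [AddCommGroup V] [Module ℝ V] (β : V [⋀^Fin (k + 1)]→ₗ[ℝ] ℝ)
    (e : Fin k → V) (X : V) :
    β (Fin.snoc (α := fun _ => V) e X) = (-1) ^ k * β (Fin.cons X e) := by
  rw [Fin.snoc_eq_cons_rotate]
  have := β.map_perm (Fin.cons X e) (finRotate (k + 1))
  refine Eq.trans this ?_
  rw [sign_finRotate, Nat.add_sub_cancel, Units.smul_def]
  simp

theorem inner_meanCurvature_tangent (K : Metric n M) (f : N → M) (x : N)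
    {u : EuclideanSpace ℝ (Fin n)} (hu : u ∈ tangent n k f x) :
    K.inner (f x) (meanCurvature k K f x) u = 0 := by
  let ℓ : EuclideanSpace ℝ (Fin n) →ₗ[ℝ] ℝ :=
    (lin₂ (E := EuclideanSpace ℝ (Fin n)) (K.inner (f x))).flip u
  let II : Fin k → Fin k → EuclideanSpace ℝ (Fin n) := fun i j =>
    secondFundamentalForm K f x (EuclideanSpace.single i 1) (EuclideanSpace.single j 1)
  have h : ∀ i j, ℓ (II i j) = 0 := fun i j => (normalPart_spec K (f x) (tangent n k f x) _).2 u hu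
  change ℓ (∑ i, ∑ j, (firstFundamentalForm (k := k) K f x)⁻¹ i j • II i j) = 0
  simp only [map_sum, map_smul, h, smul_zero, Finset.sum_const_zero]

/-- Both covectors vanish on `W`: the left one because `η` is normal, the right one because `k + 1`
vectors of a `k`-dimensional space are dependent. It remains to test normal `X`, and moving `X` from
the last slot to the first costs `(-1) ^ k`. -/
theorem eq_smul_contract (K : Metric n M) {z : M} {W : Submodule ℝ (TangentSpace (𝓡 n) z)}
    (hW : finrank ℝ W = k) {e : Fin k → TangentSpace (𝓡 n) z} (he : ∀ i, e i ∈ W)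
    {η : TangentSpace (𝓡 n) z} (hη : ∀ u ∈ W, K.inner z η u = 0)
    (β : TangentSpace (𝓡 n) z [⋀^Fin (k + 1)]→L[ℝ] ℝ) {C : ℝ}
    (h : ∀ X : TangentSpace (𝓡 n) z, (∀ u ∈ W, K.inner z u X = 0) →
      K.inner z η X = C * ((-1) ^ k * β (Fin.cons X e))) :
    K.inner z η = C • contract e β := by
  ext X
  obtain ⟨Z, hZ₁, hZ₂⟩ := exists_normal_part (bilin K z) (bilin_pos K z) W X
  have h1 : contract e β (X - Z) = 0 := by
    rw [contract_apply]
    refine map_eq_zero_of_finrank_lt β.toAlternatingMap _ W Finset.univ (fun j _ => ?_)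
      (by rw [hW]; simp)
    refine Fin.lastCases ?_ (fun i => ?_) j
    · simpa using hZ₁
    · simpa using he i
  have h2 := hη _ hZ₁
  rw [map_sub, sub_eq_zero] at h1 h2
  rw [h2, h Z (fun u hu => (K.symm z _ _).trans (hZ₂ u hu)), smul_apply, h1,
    contract_apply, smul_eq_mul]
  congr 1
  exact (map_snoc β.toAlternatingMap e Z).symm

end Transfer

theorem written_self {n k : ℕ} {M : Type u} [TopologicalSpace M]
    [ChartedSpace (EuclideanSpace ℝ (Fin n)) M] {N : Type v} [TopologicalSpace N]
    [ChartedSpace (EuclideanSpace ℝ (Fin k)) N] (f : N → M) (x : N) :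
    writtenInExtChartAt (𝓡 k) (𝓡 n) x f (extChartAt (𝓡 k) x x) = extChartAt (𝓡 n) (f x) (f x) :=
  congrArg (fun y => extChartAt (𝓡 n) (f x) (f y)) (extChartAt_to_inv x)

/-! ### Strongly associative submanifolds. -/

section Associative

set_option maxSynthPendingDepth 3

open Filter Topology Function

variable {n : ℕ} {M : Type u} [TopologicalSpace M] [ChartedSpace (EuclideanSpace ℝ (Fin n)) M]
  [IsManifold (𝓡 n) ∞ M] {𝔤 : Type w} [LieRing 𝔤] [LieAlgebra ℝ 𝔤]
  {N : Type v} [TopologicalSpace N] [ChartedSpace (EuclideanSpace ℝ (Fin 3)) N]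
  [IsManifold (𝓡 3) ∞ N] {ω₃ : DiffForm n M 3} {K : Metric n M} {hωK : IsCartanPair 𝔤 ω₃ K}
  {f : N → M}

theorem hasFDerivAt_ratioAt_tangent (h𝔤 : IsCompactSimple 𝔤) (hω : ω₃.IsSmoothOn Set.univ)
    (hf : IsImmersedSubmanifold n 3 f) (hs : IsStronglyAssociative 3 hωK f) (x : N) :
    HasFDerivAt (fun s => ratioAt ω₃ K (f ((extChartAt (𝓡 3) x).symm s))
      (tangent n 3 f ((extChartAt (𝓡 3) x).symm s)))
      (0 : EuclideanSpace ℝ (Fin 3) →L[ℝ] ℝ) (extChartAt (𝓡 3) x x) := by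
  obtain ⟨e, he, heo⟩ := exists_orthonormal_tangent K (hf.2 x)
  obtain ⟨a, hea, ha⟩ := exists_lift he heo
  have hFp : writtenInExtChartAt (𝓡 3) (𝓡 n) x f (extChartAt (𝓡 3) x x)
      = extChartAt (𝓡 n) (f x) (f x) := written_self f x
  have hq := mem_extChartAt_target (I := 𝓡 n) (f x)
  -- The ratio is taken at the point of `N` itself while the subspace is expressed in the chart of
  -- `M`; the transferred predicate thereby carries the actual function `σ` of the chart variable.
  have hP := eventually_tangent hf.1 x
    (fun x' z W => IsStrongAt hωK z W ∧ HasRatioAt ω₃ K z W (ratioAt ω₃ K (f x') (tangent n 3 f x')))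
    fun x' => ⟨hs x', hasRatioAt_ratioAt (finrank_tangent (hf.2 x'))⟩
  have hDF : ∀ i, fderiv ℝ (writtenInExtChartAt (𝓡 3) (𝓡 n) x f) (extChartAt (𝓡 3) x x) (a i)
      = e i := fun i => (fderiv_written hf.1 x (a i)).trans (hea i)
  refine hasFDerivAt_ratio_tangent h𝔤 (g := metricInChart K (f x)) (w := ω₃.inChart (f x))
    (F := writtenInExtChartAt (𝓡 3) (𝓡 n) x f) (contDiffAt_written hf.1 x)
    (by rw [hFp]; exact differentiableAt_metricInChart K (f x) hq)
    (by rw [hFp]; exact hω.differentiableAt isOpen_univ (f x) hq trivial)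
    (by rw [hFp]; exact eventually_isAdapted hωK (f x)) a
    (fun Z hZ i j => hP.self_of_nhds.1.inChart_tangent ha hZ i j) ?_ ?_
  · simp only [hDF, hFp]
    exact isOrtho_metricInChart_self heo
  · filter_upwards [hP] with s hs
    exact hs.2.inChart fun i => ⟨a i, rfl⟩

theorem inner_meanCurvature_associative (h𝔤 : IsCompactSimple 𝔤) (hω : ω₃.IsSmoothOn Set.univ)
    (hf : IsImmersedSubmanifold n 3 f) (hs : IsStronglyAssociative 3 hωK f) (x : N)
    {e : Fin 3 → TangentSpace (𝓡 n) (f x)} (he : ∀ i, e i ∈ tangent n 3 f x)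
    (heo : IsOrthonormal K (f x) e) (hpos : 0 < ω₃ (f x) e) :
    K.inner (f x) (meanCurvature 3 K f x) =
      ratioConst (ratioAt ω₃ K (f x) (tangent n 3 f x)) • contract e (ω₃.d (f x)) := by
  obtain ⟨a, hea, ha⟩ := exists_lift he heo
  have hFp : writtenInExtChartAt (𝓡 3) (𝓡 n) x f (extChartAt (𝓡 3) x x)
      = extChartAt (𝓡 n) (f x) (f x) := written_self f x
  have hq := mem_extChartAt_target (I := 𝓡 n) (f x)
  have hP := eventually_tangent hf.1 x (fun x' z W => IsStrongAt hωK z W) hs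
  have hDF : ∀ i, fderiv ℝ (writtenInExtChartAt (𝓡 3) (𝓡 n) x f) (extChartAt (𝓡 3) x x) (a i)
      = e i := fun i => (fderiv_written hf.1 x (a i)).trans (hea i)
  refine eq_smul_contract K (finrank_tangent (hf.2 x)) he
    (fun u hu => inner_meanCurvature_tangent K f x hu) _ fun X hX => ?_
  have h1 := extDeriv_form_of_closed h𝔤 (g := metricInChart K (f x)) (w := ω₃.inChart (f x))
    (F := writtenInExtChartAt (𝓡 3) (𝓡 n) x f) (e := e) (X := X) (contDiffAt_written hf.1 x)
    (by rw [hFp]; exact differentiableAt_metricInChart K (f x) hq)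
    (by rw [hFp]; exact hω.differentiableAt isOpen_univ (f x) hq trivial)
    (by rw [hFp]; exact eventually_isAdapted hωK (f x)) a
    (hP.mono fun s hs Z hZ i j => hs.inChart_tangent ha hZ i j) hDF
    (by rw [hFp]; exact isOrtho_metricInChart_self heo)
    (fun i => by rw [hFp]; exact (metricInChart_self K (f x) (e i) X).trans (hX _ (he i)))
  rw [hFp] at h1
  have h2 := inner_meanCurvature K x (hf.2 x) (fderiv_written hf.1 x) hea heo ha hX
  rw [ratioAt_eq heo (span_eq_tangent (hf.2 x) he heo)]
  have h3 : ω₃.d (f x) (Fin.cons X e) = -ω₃ (f x) e * K.inner (f x) (meanCurvature 3 K f x) X := by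
    rw [h2]
    refine (d_apply ω₃ (f x) _).trans (h1.trans ?_)
    exact congrArg (fun t => -t * _) (inChart_self ω₃ (f x) e)
  rw [h3]
  -- `(-1) ^ 3` cancels the minus sign in `h3`, and the constant is the inverse of `ω₃ (f x) e`.
  have h4 := ratioConst_sq_mul hpos
  linear_combination (-K.inner (f x) (meanCurvature 3 K f x) X) * h4

end Associative

/-! ### The Hodge star on a manifold, expressed in a chart. -/

section Star

set_option maxSynthPendingDepth 3

open Filter Topology Function

theorem sum_smul_curryLeft_apply {E : Type*} [NormedAddCommGroup E] [NormedSpace ℝ E] {k m : ℕ}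
    (b : Fin m → E) (w : E [⋀^Fin 3]→L[ℝ] ℝ) (μ : E [⋀^Fin (k + 3)]→L[ℝ] ℝ) (v : Fin k → E) :
    ((6 : ℝ)⁻¹ • ∑ i, ∑ j, ∑ l, w ![b i, b j, b l] •
      ((μ.curryLeft (b i)).curryLeft (b j)).curryLeft (b l)) v
      = starSum b w.toAlternatingMap μ.toAlternatingMap v := by
  simp only [starSum, ContinuousAlternatingMap.smul_apply, ContinuousAlternatingMap.sum_apply,
    smul_eq_mul]
  rfl

variable {k : ℕ} {M : Type u} [TopologicalSpace M]
  [ChartedSpace (EuclideanSpace ℝ (Fin (k + 3))) M] [IsManifold (𝓡 (k + 3)) ∞ M]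

theorem hodgeStar_apply (K : Metric (k + 3) M) (μ : DiffForm (k + 3) M (k + 3))
    (ω₃ : DiffForm (k + 3) M 3) (z : M) (v : Fin k → TangentSpace (𝓡 (k + 3)) z) :
    hodgeStar K μ ω₃ z v
      = starSum (orthoBasis K z) (ω₃ z).toAlternatingMap (μ z).toAlternatingMap v :=
  sum_smul_curryLeft_apply (E := EuclideanSpace ℝ (Fin (k + 3))) (orthoBasis K z) (ω₃ z) (μ z) v

theorem inChart_hodgeStar (K : Metric (k + 3) M) (μ : DiffForm (k + 3) M (k + 3))
    (ω₃ : DiffForm (k + 3) M 3) (x₀ : M) {y : EuclideanSpace ℝ (Fin (k + 3))}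
    (hy : y ∈ (extChartAt (𝓡 (k + 3)) x₀).target) :
    ∃ b : Fin (k + 3) → EuclideanSpace ℝ (Fin (k + 3)),
      IsOrtho (lin₂ (metricInChart K x₀ y)) b ∧ ⊤ ≤ Submodule.span ℝ (Set.range b) ∧
      ∀ v, (hodgeStar K μ ω₃).inChart x₀ y v
        = starSum b (ω₃.inChart x₀ y).toAlternatingMap (μ.inChart x₀ y).toAlternatingMap v := by
  let B := (orthoBasis K ((extChartAt (𝓡 (k + 3)) x₀).symm y)).map (chartIso x₀ hy).symm
  have hB : ∀ i, chartD x₀ y (B i) = orthoBasis K _ i := fun i => by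
    rw [Basis.map_apply, ← chartIso_apply x₀ hy, LinearEquiv.apply_symm_apply]
  refine ⟨B, fun i j => ?_, B.span_eq.ge, fun v => ?_⟩
  · rw [lin₂_apply, metricInChart_apply, hB, hB]
    exact orthoBasis_orthonormal K _ i j
  · rw [inChart_apply, hodgeStar_apply, starSum, starSum]
    congr 1
    refine Finset.sum_congr rfl fun i _ => Finset.sum_congr rfl fun j _ =>
      Finset.sum_congr rfl fun l _ => ?_
    congr 1
    · refine Eq.trans ?_ (inChart_vec₃ ω₃ x₀ y (B i) (B j) (B l)).symm
      rw [hB, hB, hB]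
      rfl
    · refine Eq.trans ?_ (inChart_apply μ x₀ y
        (Matrix.vecCons (B i) (Matrix.vecCons (B j) (Matrix.vecCons (B l) v)))).symm
      refine congrArg (μ ((extChartAt (𝓡 (k + 3)) x₀).symm y)) (funext fun m => ?_)
      refine Fin.cases (hB i).symm (fun m => ?_) m
      refine Fin.cases (hB j).symm (fun m => ?_) m
      exact Fin.cases (hB l).symm (fun m => rfl) m

theorem IsVolumeFormOn.inChart {K : Metric (k + 3) M} {U : Set M}
    {μ : DiffForm (k + 3) M (k + 3)} (h : IsVolumeFormOn K U μ) {x₀ : M}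
    {y : EuclideanSpace ℝ (Fin (k + 3))} (hy : (extChartAt (𝓡 (k + 3)) x₀).symm y ∈ U)
    (b : Fin (k + 3) → EuclideanSpace ℝ (Fin (k + 3)))
    (hb : IsOrtho (lin₂ (metricInChart K x₀ y)) b) : μ.inChart x₀ y b ^ 2 = 1 := by
  rw [inChart_apply]
  rcases h.2 _ hy (fun i => chartD x₀ y (b i)) hb with h1 | h1 <;> rw [h1] <;> norm_num

end Star

/-! ### Strongly coassociative submanifolds. -/

section Coassociative

set_option maxSynthPendingDepth 3

open Filter Topology Function

variable {k : ℕ} {M : Type u} [TopologicalSpace M]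
  [ChartedSpace (EuclideanSpace ℝ (Fin (k + 3))) M] [IsManifold (𝓡 (k + 3)) ∞ M]
  {𝔤 : Type w} [LieRing 𝔤] [LieAlgebra ℝ 𝔤]
  {N : Type v} [TopologicalSpace N] [ChartedSpace (EuclideanSpace ℝ (Fin k)) N]
  [IsManifold (𝓡 k) ∞ N] {ω₃ : DiffForm (k + 3) M 3} {K : Metric (k + 3) M}
  {hωK : IsCartanPair 𝔤 ω₃ K} {f : N → M}

omit [IsManifold (𝓡 k) ∞ N] in
/-- An orthonormal basis of the normal space. -/
theorem exists_orthonormal_normal (K : Metric (k + 3) M) {f : N → M} {x : N}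
    {e : Fin k → TangentSpace (𝓡 (k + 3)) (f x)} (he : ∀ i, e i ∈ tangent (k + 3) k f x)
    (heo : IsOrthonormal K (f x) e) (hinj : Injective (mfderiv (𝓡 k) (𝓡 (k + 3)) f x)) :
    ∃ ν : Fin 3 → TangentSpace (𝓡 (k + 3)) (f x),
      IsOrtho (bilin K (f x)) (Sum.elim ν e) ∧
      ⊤ ≤ Submodule.span ℝ (Set.range (Sum.elim ν e)) ∧
      Submodule.span ℝ (Set.range ν) = normal k K f x := by
  have hV : finrank ℝ (TangentSpace (𝓡 (k + 3)) (f x)) = k + 3 :=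
    finrank_euclideanSpace_fin (𝕜 := ℝ) (n := k + 3)
  obtain ⟨ν, e', h1, -, h3, -⟩ := exists_adapted_basis_span (bilin K (f x)) (K.symm _)
    (bilin_pos K _) (IsOrtho.linearIndependent (g := bilin K (f x)) heo) hV
  have h4 : IsOrtho (bilin K (f x)) (Sum.elim ν e) := h1.inl.sumElim (K.symm _) heo fun i =>
    (h3 _).1 (Submodule.subset_span ⟨i, rfl⟩)
  refine ⟨ν, h4, ?_, ?_⟩
  · exact (h4.linearIndependent.span_eq_top_of_card_eq_finrank' (by
      rw [hV, Fintype.card_sum, Fintype.card_fin, Fintype.card_fin, add_comm])).ge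
  · ext v
    rw [h3, normal, ← span_eq_tangent hinj he heo]
    refine ⟨fun h u hu => ?_, fun h j => h _ (Submodule.subset_span ⟨j, rfl⟩)⟩
    induction hu using Submodule.span_induction with
    | mem x hx => obtain ⟨j, rfl⟩ := hx; exact h j
    | zero => simp
    | add x y _ _ hx hy => rw [map_add, hx, hy, add_zero]
    | smul c x _ hx => rw [map_smul, hx, smul_zero]

theorem hasFDerivAt_ratioAt_normal (h𝔤 : IsCompactSimple 𝔤) (hω : ω₃.IsSmoothOn Set.univ)
    (hf : IsImmersedSubmanifold (k + 3) k f) (hs : IsStronglyCoassociative k hωK f) (x : N) :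
    HasFDerivAt (fun s => ratioAt ω₃ K (f ((extChartAt (𝓡 k) x).symm s))
      (normal k K f ((extChartAt (𝓡 k) x).symm s)))
      (0 : EuclideanSpace ℝ (Fin k) →L[ℝ] ℝ) (extChartAt (𝓡 k) x x) := by
  obtain ⟨e, he, heo⟩ := exists_orthonormal_tangent K (hf.2 x)
  obtain ⟨a, hea, ha⟩ := exists_lift he heo
  have hFp : writtenInExtChartAt (𝓡 k) (𝓡 (k + 3)) x f (extChartAt (𝓡 k) x x)
      = extChartAt (𝓡 (k + 3)) (f x) (f x) := written_self f x
  have hq := mem_extChartAt_target (I := 𝓡 (k + 3)) (f x)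
  have hP := eventually_tangent hf.1 x
    (fun x' z W => IsStrongAt hωK z (orthogonal K z W) ∧
      HasRatioAt ω₃ K z (orthogonal K z W) (ratioAt ω₃ K (f x') (normal k K f x')))
    fun x' => ⟨hs x', by
      obtain ⟨e', he', heo'⟩ := exists_orthonormal_tangent K (hf.2 x')
      obtain ⟨ν, h1, -, h2⟩ := exists_orthonormal_normal K he' heo' (hf.2 x')
      refine hasRatioAt_ratioAt ?_
      have h3 := finrank_span_of_isOrtho h1.inl
      rwa [h2] at h3⟩
  have hDF : ∀ i, fderiv ℝ (writtenInExtChartAt (𝓡 k) (𝓡 (k + 3)) x f) (extChartAt (𝓡 k) x x) (a i)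
      = e i := fun i => (fderiv_written hf.1 x (a i)).trans (hea i)
  refine hasFDerivAt_ratio_normal h𝔤 (g := metricInChart K (f x)) (w := ω₃.inChart (f x))
    (F := writtenInExtChartAt (𝓡 k) (𝓡 (k + 3)) x f) (contDiffAt_written hf.1 x)
    finrank_euclideanSpace_fin
    (by rw [hFp]; exact differentiableAt_metricInChart K (f x) hq)
    (by rw [hFp]; exact hω.differentiableAt isOpen_univ (f x) hq trivial)
    (by rw [hFp]; exact eventually_isAdapted hωK (f x)) a
    (fun Z Z' hZ hZ' i => hP.self_of_nhds.1.inChart_normal ha hZ hZ' i) ?_ ?_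
  · simp only [hDF, hFp]
    exact isOrtho_metricInChart_self heo
  · filter_upwards [hP] with s hs ν hν
    exact hs.2.inChart fun i => chartD_mem_orthogonal ha (hν i)

theorem inner_meanCurvature_coassociative (h𝔤 : IsCompactSimple 𝔤) (hω : ω₃.IsSmoothOn Set.univ)
    (hf : IsImmersedSubmanifold (k + 3) k f) (hs : IsStronglyCoassociative k hωK f) (x : N)
    {U : Set M} {μ : DiffForm (k + 3) M (k + 3)} (hU : IsOpen U) (hxU : f x ∈ U)
    (hμ : IsVolumeFormOn K U μ)
    {e : Fin k → TangentSpace (𝓡 (k + 3)) (f x)} (he : ∀ i, e i ∈ tangent (k + 3) k f x)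
    (heo : IsOrthonormal K (f x) e) (hpos : 0 < (-1) ^ (k + 3) * hodgeStar K μ ω₃ (f x) e) :
    K.inner (f x) (meanCurvature k K f x) =
      ratioConst (ratioAt ω₃ K (f x) (normal k K f x))
        • contract e ((hodgeStar K μ ω₃).d (f x)) := by
  obtain ⟨a, hea, ha⟩ := exists_lift he heo
  have hFp : writtenInExtChartAt (𝓡 k) (𝓡 (k + 3)) x f (extChartAt (𝓡 k) x x)
      = extChartAt (𝓡 (k + 3)) (f x) (f x) := written_self f x
  have hq := mem_extChartAt_target (I := 𝓡 (k + 3)) (f x)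
  have hqU : (extChartAt (𝓡 (k + 3)) (f x)).symm (extChartAt (𝓡 (k + 3)) (f x) (f x)) ∈ U := by
    rwa [extChartAt_to_inv]
  have hP := eventually_tangent hf.1 x (fun x' z W => IsStrongAt hωK z (orthogonal K z W)) hs
  have hDF : ∀ i, fderiv ℝ (writtenInExtChartAt (𝓡 k) (𝓡 (k + 3)) x f) (extChartAt (𝓡 k) x x) (a i)
      = e i := fun i => (fderiv_written hf.1 x (a i)).trans (hea i)
  obtain ⟨ν, hνe, hνs, hν⟩ := exists_orthonormal_normal K he heo (hf.2 x)
  -- the value of `*ω₃` on the tangent space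
  have hsq : hodgeStar K μ ω₃ (f x) e ^ 2 = ω₃ (f x) ν ^ 2 := by
    have h1 := star_sq_eq hνe (w := (ω₃ (f x)).toAlternatingMap) (μ := (μ (f x)).toAlternatingMap)
      (φ := (hodgeStar K μ ω₃ (f x)).toAlternatingMap)
      (fun b hb => by rcases hμ.2 _ hxU b hb with h | h <;>
        exact (congrArg (· ^ 2) h).trans (by norm_num))
      (fun v => (hodgeStar_apply K μ ω₃ (f x) v).trans
        (starSum_congr (g := bilin K (f x)) (orthoBasis_orthonormal K (f x)) hνe
          (orthoBasis K (f x)).span_eq.ge hνs (K.symm _) _ _ v))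
      (fun i => Submodule.subset_span ⟨i, rfl⟩) (fun i => Submodule.subset_span ⟨i, rfl⟩)
    rw [gram_eq_one hνe.inl, gram_eq_one hνe.inr, Matrix.det_one, mul_one, Matrix.det_one,
      mul_one] at h1
    exact h1
  have hne : hodgeStar K μ ω₃ (f x) e ≠ 0 := fun h => by rw [h, mul_zero] at hpos; exact hpos.false
  -- Linear independence is an open condition, and the differential of the immersion is continuous
  -- in the chart.
  have hli : ∀ᶠ s in 𝓝 (extChartAt (𝓡 k) x x), LinearIndependent ℝ fun j =>
      fderiv ℝ (writtenInExtChartAt (𝓡 k) (𝓡 (k + 3)) x f) s (a j) := by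
    have hF2 : ContinuousAt (fderiv ℝ (writtenInExtChartAt (𝓡 k) (𝓡 (k + 3)) x f))
        (extChartAt (𝓡 k) x x) :=
      ((contDiffAt_written hf.1 x).fderiv_right (m := 1) (by norm_num)).continuousAt
    have hc : ContinuousAt (fun s => fun j =>
        fderiv ℝ (writtenInExtChartAt (𝓡 k) (𝓡 (k + 3)) x f) s (a j)) (extChartAt (𝓡 k) x x) :=
      continuousAt_pi.2 fun j => hF2.clm_apply continuousAt_const
    refine hc.eventually (isOpen_setOfPred_linearIndependent.mem_nhds ?_)
    have : LinearIndependent ℝ e := IsOrtho.linearIndependent (g := bilin K (f x)) heo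
    simp only [hDF]
    exact this
  refine eq_smul_contract K (finrank_tangent (hf.2 x)) he
    (fun u hu => inner_meanCurvature_tangent K f x hu) _ fun X hX => ?_
  have htarget := extChartAt_target_mem_nhds (I := 𝓡 (k + 3)) (f x)
  have h1 := extDeriv_star_of_coclosed h𝔤 (g := metricInChart K (f x)) (w := ω₃.inChart (f x))
    (μ := μ.inChart (f x)) (φ := (hodgeStar K μ ω₃).inChart (f x))
    (F := writtenInExtChartAt (𝓡 k) (𝓡 (k + 3)) x f) (e := e) (X := X) (contDiffAt_written hf.1 x)
    finrank_euclideanSpace_fin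
    (by rw [hFp]; exact differentiableAt_metricInChart K (f x) hq)
    (by rw [hFp]; exact hω.differentiableAt isOpen_univ (f x) hq trivial)
    (by rw [hFp]; exact hμ.1.differentiableAt hU (f x) hq hqU)
    (by rw [hFp]; exact eventually_isAdapted hωK (f x))
    (by
      rw [hFp]
      filter_upwards [htarget] with y hy
      exact inChart_hodgeStar K μ ω₃ (f x) hy)
    (by
      rw [hFp]
      filter_upwards [(continuousAt_extChartAt_symm (I := 𝓡 (k + 3)) (f x)).eventually
        (hU.mem_nhds hqU)] with y hy
      exact hμ.inChart hy) a hli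
    (hP.mono fun s hs Z Z' hZ hZ' i => hs.inChart_normal ha hZ hZ' i) hDF
    (by rw [hFp]; exact isOrtho_metricInChart_self heo)
    (by rw [hFp]; exact (inChart_self (hodgeStar K μ ω₃) (f x) e).trans_ne hne)
    (fun i => by rw [hFp]; exact (metricInChart_self K (f x) (e i) X).trans (hX _ (he i)))
  rw [hFp] at h1
  have h2 := inner_meanCurvature K x (hf.2 x) (fderiv_written hf.1 x) hea heo ha hX
  have h3 : (hodgeStar K μ ω₃).d (f x) (Fin.cons X e)
      = -hodgeStar K μ ω₃ (f x) e * K.inner (f x) (meanCurvature k K f x) X := by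
    rw [h2]
    refine (d_apply (hodgeStar K μ ω₃) (f x) _).trans (h1.trans ?_)
    exact congrArg (fun t => -t * _) (inChart_self (hodgeStar K μ ω₃) (f x) e)
  rw [h3]
  have h4 := ratioConst_sq_mul hpos
  have h5 : ((-1) ^ (k + 3) * hodgeStar K μ ω₃ (f x) e) ^ 2
      = ratioAt ω₃ K (f x) (normal k K f x) := by
    rw [ratioAt_eq (K := K) (f := ν) hνe.inl hν, ← hsq, mul_pow, ← pow_mul, mul_comm (k + 3) 2,
      pow_mul]
    norm_num
  rw [h5] at h4
  -- The codimension is odd, so the sign `(-1) ^ n` of the orientation convention is minus the sign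
  -- from `eq_smul_contract`; this absorbs the minus sign in `h3`.
  have h6 : (-1 : ℝ) ^ (k + 3) = -(-1) ^ k := by ring
  rw [h6] at h4
  linear_combination (-K.inner (f x) (meanCurvature k K f x) X) * h4

end Coassociative

end CartanGeometry

end

/-! ### The theorem, with `lieTypeConst` as the constant in both parts. -/

open CartanGeometry in
theorem proposition6p4 {𝔤 : Type*} [LieRing 𝔤] [LieAlgebra ℝ 𝔤] [FiniteDimensional ℝ 𝔤]
    (h𝔤 : IsCompactSimple 𝔤) :
    -- Part 1: strongly associative 3-submanifolds
    (∃ c : LieSubalgebra ℝ 𝔤 → ℝ, IsLieTypeConstant 𝔤 c ∧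
      ∀ (n : ℕ) (M : Type*) [TopologicalSpace M] [ChartedSpace (EuclideanSpace ℝ (Fin n)) M]
        [IsManifold (𝓡 n) ∞ M] (ω₃ : DiffForm n M 3) (K : Metric n M)
        (_ : ω₃.IsSmoothOn Set.univ) (hωK : IsCartanPair 𝔤 ω₃ K)
        (N : Type*) [TopologicalSpace N] [ChartedSpace (EuclideanSpace ℝ (Fin 3)) N]
        [IsManifold (𝓡 3) ∞ N] (f : N → M),
        IsImmersedSubmanifold n 3 f → IsStronglyAssociative 3 hωK f →
        -- the constant is the same at all points of a connected component of `N`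
        (∀ x y : N, y ∈ connectedComponent x → ∀ 𝔥 𝔥' : LieSubalgebra ℝ 𝔤,
          HasLieType ω₃ K (f x) (tangent n 3 f x) 𝔥 →
          HasLieType ω₃ K (f y) (tangent n 3 f y) 𝔥' → c 𝔥 = c 𝔥') ∧
        ∀ (x : N) (𝔥 : LieSubalgebra ℝ 𝔤), HasLieType ω₃ K (f x) (tangent n 3 f x) 𝔥 →
        -- `e` is an orthonormal basis of `T_x N` with `ω₃(e₁, e₂, e₃) > 0`
        ∀ e : Fin 3 → TangentSpace (𝓡 n) (f x), (∀ i, e i ∈ tangent n 3 f x) →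
          IsOrthonormal K (f x) e → 0 < ω₃ (f x) e →
          K.inner (f x) (meanCurvature 3 K f x) = c 𝔥 • contract e (ω₃.d (f x))) ∧
    -- Part 2: strongly coassociative submanifolds of codimension 3
    (∃ c : LieSubalgebra ℝ 𝔤 → ℝ, IsLieTypeConstant 𝔤 c ∧
      ∀ (k : ℕ) (M : Type*) [TopologicalSpace M]
        [ChartedSpace (EuclideanSpace ℝ (Fin (k + 3))) M]
        [IsManifold (𝓡 (k + 3)) ∞ M] (ω₃ : DiffForm (k + 3) M 3) (K : Metric (k + 3) M)
        (_ : ω₃.IsSmoothOn Set.univ) (hωK : IsCartanPair 𝔤 ω₃ K)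
        (N : Type*) [TopologicalSpace N] [ChartedSpace (EuclideanSpace ℝ (Fin k)) N]
        [IsManifold (𝓡 k) ∞ N] (f : N → M),
        IsImmersedSubmanifold (k + 3) k f → IsStronglyCoassociative k hωK f →
        (∀ x y : N, y ∈ connectedComponent x → ∀ 𝔥 𝔥' : LieSubalgebra ℝ 𝔤,
          HasLieType ω₃ K (f x) (normal k K f x) 𝔥 →
          HasLieType ω₃ K (f y) (normal k K f y) 𝔥' → c 𝔥 = c 𝔥') ∧
        ∀ (x : N) (𝔥 : LieSubalgebra ℝ 𝔤), HasLieType ω₃ K (f x) (normal k K f x) 𝔥 →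
        -- `μ` is the volume form of an orientation of `M` near `f x`
        ∀ (U : Set M) (μ : DiffForm (k + 3) M (k + 3)), IsOpen U → f x ∈ U →
          IsVolumeFormOn K U μ →
        -- `e` is an orthonormal basis of `T_x N` with `(-1)^n (*ω₃)(e₁, …, e_{n-3}) > 0`
        ∀ e : Fin k → TangentSpace (𝓡 (k + 3)) (f x), (∀ i, e i ∈ tangent (k + 3) k f x) →
          IsOrthonormal K (f x) e → 0 < (-1) ^ (k + 3) * hodgeStar K μ ω₃ (f x) e →
          K.inner (f x) (meanCurvature k K f x)
            = c 𝔥 • contract e ((hodgeStar K μ ω₃).d (f x))) := by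
  refine ⟨⟨lieTypeConst, isLieTypeConstant_lieTypeConst, ?_⟩,
    ⟨lieTypeConst, isLieTypeConstant_lieTypeConst, ?_⟩⟩
  · intro n M _ _ _ ω₃ K hω hωK N _ _ _ f hf hs
    refine ⟨fun x y hy 𝔥 𝔥' hx hy' => ?_, fun x 𝔥 hx e he heo hpos => ?_⟩
    · rw [hx.lieTypeConst_eq, hy'.lieTypeConst_eq]
      exact congrArg ratioConst (eq_of_mem_connectedComponent
        (σ := fun x => ratioAt ω₃ K (f x) (tangent n 3 f x))
        (hasFDerivAt_ratioAt_tangent h𝔤 hω hf hs) hy)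
    · rw [hx.lieTypeConst_eq]
      exact inner_meanCurvature_associative h𝔤 hω hf hs x he heo hpos
  · intro k M _ _ _ ω₃ K hω hωK N _ _ _ f hf hs
    refine ⟨fun x y hy 𝔥 𝔥' hx hy' => ?_, fun x 𝔥 hx U μ hU hxU hμ e he heo hpos => ?_⟩
    · rw [hx.lieTypeConst_eq, hy'.lieTypeConst_eq]
      exact congrArg ratioConst (eq_of_mem_connectedComponent
        (σ := fun x => ratioAt ω₃ K (f x) (normal k K f x))
        (hasFDerivAt_ratioAt_normal h𝔤 hω hf hs) hy)
    · rw [hx.lieTypeConst_eq]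
      exact inner_meanCurvature_coassociative h𝔤 hω hf hs x hU hxU hμ he heo hpos
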